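/- **Theorem 1.1.** $\mathsf{APSP}$ and $\mathsf{CoDiameter}$ are subcubic equivalent, that is, there is a subcubic reduction from $\mathsf{APSP}$ to $\mathsf{CoDiameter}$ and a subcubic reduction from $\mathsf{CoDiameter}$ to $\mathsf{APSP}$. Here graphs are directed graphs on $n$ vertices with integer edge weights in $[-M,M]$, where $M$ is polynomially bounded in $n$. The distance $d(u,v)$ is the infimum of the weights of the walks from $u$ to $v$, and it is $\infty$ if $v$ is not reachable from $u$. * $\mathsf{APSP}$: given a graph without negative cycles, output the $n\times n$ matrix of all distances $d(u,v)$. * $\mathsf{CoDiameter}$: given a graph with non-negative edge weights, output a vertex $u$ that is not an endpoint of a diameter (i.e. no vertex $v$ satisfies $d(u,v)=\max_{x,y} d(x,y)$), or report that there is no such vertex. A function $T(n,M)$ is *truly subcubic* if for every constant $c$ there is $\varepsilon>0$ with $T(n,M)=O(n^{3-\varepsilon})$ for all $M\le n^{c}$ (the constants in this and the following bounds may depend on $c$; for $n\le 1$ read $n+2$ for $n$ in the bounds on the weights and words, and $n+1$ for $n$ in the bounds on the time). A *subcubic reduction* from $A$ to $B$ is a program $P$ for a random access machine with words of $O(\log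 n)$ bits and unit-cost basic operations, using $B$ as a black box, such that $P$ solves $A$ correctly with every black box that answers all instances of $B$ correctly, and such that for every truly subcubic $T$ and every constant $c$ there is $\delta>0$ for which the following holds: if each call of the black box on an instance with $m$ vertices and largest absolute weight $M'$ is charged time $T(m,M')$, then $P$ takes total time $O(n^{3-\delta})$ on all instances of $A$ with $n$ vertices and weights at most $n^{c}$ in absolute value. -/

import Mathlib

namespace FineGrained

/-! ### Weighted directed graphs and distances -/

/-- A weighted directed graph on `n` vertices with integer edge weights; the weight `⊤` (infinity)
of a pair means that the pair is not an edge. -/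
structure WDigraph where
  n : ℕ
  w : Fin n → Fin n → WithTop ℤ

namespace WDigraph

/-- `G.HasWalk u v c`: there is a directed walk from `u` to `v` of total weight `c`. -/
inductive HasWalk (G : WDigraph) : Fin G.n → Fin G.n → ℤ → Prop
  | nil (u : Fin G.n) : HasWalk G u u 0
  | cons {u x v : Fin G.n} {a c : ℤ} :
      G.w u x = (a : WithTop ℤ) → HasWalk G x v c → HasWalk G u v (a + c)

/-- `d` is the distance from `u` to `v`: the infimum of the weights of the walks from `u` to `v`
(`⊤` if there is no walk). -/
def IsDist (G : WDigraph) (u v : Fin G.n) (d : WithTop ℤ) : Prop :=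
  IsGLB {z : WithTop ℤ | ∃ c : ℤ, G.HasWalk u v c ∧ z = (c : WithTop ℤ)} d

/-- Every closed walk has nonnegative weight. -/
def NoNegCycle (G : WDigraph) : Prop :=
  ∀ (u : Fin G.n) (c : ℤ), G.HasWalk u u c → 0 ≤ c

/-- All edge weights are nonnegative. -/
def NonnegWeights (G : WDigraph) : Prop :=
  ∀ u v : Fin G.n, 0 ≤ G.w u v

/-- The largest absolute value of an edge weight (`0` if there are no edges). -/
def maxWeight (G : WDigraph) : ℕ :=
  Finset.univ.sup fun p : Fin G.n × Fin G.n => ((G.w p.1 p.2).untopD 0).natAbs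

/-- `d` is the diameter: the longest distance between two vertices. -/
def IsDiameter (G : WDigraph) (d : WithTop ℤ) : Prop :=
  IsGreatest {z : WithTop ℤ | ∃ x y : Fin G.n, G.IsDist x y z} d

/-- `u` is an endpoint of a diameter: some vertex has distance from `u` equal to the diameter. -/
def IsDiameterVertex (G : WDigraph) (u : Fin G.n) : Prop :=
  ∃ (v : Fin G.n) (d : WithTop ℤ), G.IsDist u v d ∧ G.IsDiameter d

end WDigraph

/-! ### Computational problems

Inputs and outputs are laid out in arrays of integers. -/

/-- A computational problem, whose instances carry two parameters: a size (number of vertices) and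
a bound on the weights. -/
structure Problem where
  Inst : Type
  size : Inst → ℕ
  weight : Inst → ℕ
  /-- the array holds (the encoding of) the instance -/
  Input : Inst → (ℤ → ℤ) → Prop
  /-- the array holds (the encoding of) a correct answer for the instance -/
  Output : Inst → (ℤ → ℤ) → Prop

/-- The array `a` holds, from cell `b` on, the `n × n` matrix `D` in row-major order. An entry takes
two cells: `0, 0` for `⊤` and `1, z` for the integer `z`. -/
def HoldsMatrix (a : ℤ → ℤ) (b : ℤ) {n : ℕ} (D : Fin n → Fin n → WithTop ℤ) : Prop :=
  ∀ i j : Fin n,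
    a (b + 2 * ((i : ℤ) * (n : ℤ) + (j : ℤ))) = (if D i j = ⊤ then 0 else 1) ∧
    a (b + 2 * ((i : ℤ) * (n : ℤ) + (j : ℤ)) + 1) = (D i j).untopD 0

/-- The array `a` holds the graph `G`: the number of vertices, then the matrix of weights. -/
def HoldsGraph (a : ℤ → ℤ) (G : WDigraph) : Prop :=
  a 0 = (G.n : ℤ) ∧ HoldsMatrix a 1 G.w

/-- All-pairs shortest paths: given a graph without negative cycles, output the matrix of all
distances. -/
def APSP : Problem where
  Inst := {G : WDigraph // G.NoNegCycle}
  size G := G.1.n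
  weight G := G.1.maxWeight
  Input G a := HoldsGraph a G.1
  Output G a := ∃ D : Fin G.1.n → Fin G.1.n → WithTop ℤ,
    (∀ u v, G.1.IsDist u v (D u v)) ∧ HoldsMatrix a 0 D

/-- CoDiameter: given a graph with nonnegative weights, output (the index of) a vertex that is not
an endpoint of a diameter, or `-1` if every vertex is an endpoint of a diameter. -/
def CoDiameter : Problem where
  Inst := {G : WDigraph // G.NonnegWeights}
  size G := G.1.n
  weight G := G.1.maxWeight
  Input G a := HoldsGraph a G.1
  Output G a :=
    (∃ u : Fin G.1.n, a 0 = ((u : ℕ) : ℤ) ∧ ¬ G.1.IsDiameterVertex u) ∨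
    (a 0 = -1 ∧ ∀ u : Fin G.1.n, G.1.IsDiameterVertex u)

/-! ### The machine model

Programs for a random access machine with oracle calls. The memory consists of registers and of
arrays of cells, all holding integers (a program mentions only finitely many registers and arrays).
Every basic operation costs one step, and all integers that a program handles have to fit into a
machine word. -/

/-- The memory. -/
structure State where
  reg : ℕ → ℤ
  arr : ℕ → ℤ → ℤ

namespace State

def setReg (s : State) (x : ℕ) (v : ℤ) : State :=
  { s with reg := Function.update s.reg x v }

def setCell (s : State) (r : ℕ) (i v : ℤ) : State :=
  { s with arr := Function.update s.arr r (Function.update (s.arr r) i v) }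

def setArr (s : State) (r : ℕ) (a : ℤ → ℤ) : State :=
  { s with arr := Function.update s.arr r a }

/-- The initial memory: the input is in array `0`, everything else is zero. -/
def start (a : ℤ → ℤ) : State where
  reg := fun _ => 0
  arr := Function.update (fun _ _ => 0) 0 a

end State

/-- The basic binary operations: arithmetic (with integer division) and comparison. -/
inductive BinOp
  | add | sub | mul | div | lt

def BinOp.eval : BinOp → ℤ → ℤ → ℤ
  | .add, x, y => x + y
  | .sub, x, y => x - y
  | .mul, x, y => x * y
  | .div, x, y => x / y
  | .lt, x, y => if x < y then 1 else 0

/-- Expressions: constants, registers, array cells, and basic operations. -/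
inductive Expr
  | const (c : ℤ)
  | reg (x : ℕ)
  | cell (r : ℕ) (e : Expr)
  | bin (o : BinOp) (e f : Expr)

namespace Expr

def eval (s : State) : Expr → ℤ
  | const c => c
  | reg x => s.reg x
  | cell r e => s.arr r (e.eval s)
  | bin o e f => o.eval (e.eval s) (f.eval s)

/-- The number of basic operations needed for evaluating the expression. -/
def cost : Expr → ℕ
  | const _ => 1
  | reg _ => 1
  | cell _ e => e.cost + 1
  | bin _ e f => e.cost + f.cost + 1

/-- All values that occur in the evaluation have absolute value at most `W`. -/
def Fits (W : ℕ) (s : State) : Expr → Prop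
  | const c => c.natAbs ≤ W
  | reg x => (s.reg x).natAbs ≤ W
  | cell r e => e.Fits W s ∧ ((cell r e).eval s).natAbs ≤ W
  | bin o e f => e.Fits W s ∧ f.Fits W s ∧ ((bin o e f).eval s).natAbs ≤ W

end Expr

/-- Programs. A condition holds if its value is not `0`; `call q r` submits the content of array `q`
to the oracle, whose answer overwrites array `r`. -/
inductive Prog
  | skip
  | assign (x : ℕ) (e : Expr)
  | store (r : ℕ) (i e : Expr)
  | seq (p q : Prog)
  | ite (e : Expr) (p q : Prog)
  | loop (e : Expr) (p : Prog)
  | call (q r : ℕ)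

/-- An oracle for `B` returns a fixed correct answer to each instance of `B`. -/
def IsOracle (B : Problem) (O : B.Inst → ℤ → ℤ) : Prop :=
  ∀ x : B.Inst, B.Output x (O x)

/-- `Exec B O T W p s s' t`: with oracle `O` for `B` and words bounded by `W`, the program `p` started
in memory `s` halts in memory `s'`, never exceeding the word size, after total time `t`, where an
oracle call on an instance of size `m` and weight `M` is charged `T m M` (plus one step for the call
itself). Only instances of `B` may be submitted to the oracle. -/
inductive Exec (B : Problem) (O : B.Inst → ℤ → ℤ) (T : ℕ → ℕ → ℕ) (W : ℕ) :
    Prog → State → State → ℕ → Prop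
  | skip (s : State) : Exec B O T W .skip s s 1
  | assign {s : State} {x : ℕ} {e : Expr} :
      e.Fits W s → Exec B O T W (.assign x e) s (s.setReg x (e.eval s)) (e.cost + 1)
  | store {s : State} {r : ℕ} {i e : Expr} :
      i.Fits W s → e.Fits W s →
      Exec B O T W (.store r i e) s (s.setCell r (i.eval s) (e.eval s)) (i.cost + e.cost + 1)
  | seq {p q : Prog} {s₁ s₂ s₃ : State} {t₁ t₂ : ℕ} :
      Exec B O T W p s₁ s₂ t₁ → Exec B O T W q s₂ s₃ t₂ →
      Exec B O T W (.seq p q) s₁ s₃ (t₁ + t₂)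
  | ite_true {e : Expr} {p q : Prog} {s s' : State} {t : ℕ} :
      e.Fits W s → e.eval s ≠ 0 → Exec B O T W p s s' t →
      Exec B O T W (.ite e p q) s s' (e.cost + 1 + t)
  | ite_false {e : Expr} {p q : Prog} {s s' : State} {t : ℕ} :
      e.Fits W s → e.eval s = 0 → Exec B O T W q s s' t →
      Exec B O T W (.ite e p q) s s' (e.cost + 1 + t)
  | loop_done {e : Expr} {p : Prog} {s : State} :
      e.Fits W s → e.eval s = 0 → Exec B O T W (.loop e p) s s (e.cost + 1)
  | loop_step {e : Expr} {p : Prog} {s₁ s₂ s₃ : State} {t₁ t₂ : ℕ} :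
      e.Fits W s₁ → e.eval s₁ ≠ 0 → Exec B O T W p s₁ s₂ t₁ →
      Exec B O T W (.loop e p) s₂ s₃ t₂ →
      Exec B O T W (.loop e p) s₁ s₃ (e.cost + 1 + t₁ + t₂)
  | call {q r : ℕ} {s : State} (x : B.Inst) :
      B.Input x (s.arr q) →
      Exec B O T W (.call q r) s (s.setArr r (O x)) (1 + T (B.size x) (B.weight x))

/-! ### Subcubic reductions -/

/-- The time bound `T n M` (for size `n` and weight `M`) is truly subcubic: whenever the weights are
polynomially bounded, it is `O(n ^ (3 - ε))` for some `ε > 0`. (Writing `n + 2` and `n + 1` only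
matters for `n ≤ 1`.) -/
def TrulySubcubic (T : ℕ → ℕ → ℕ) : Prop :=
  ∀ c : ℕ, ∃ ε : ℝ, 0 < ε ∧ ∃ C : ℝ, ∀ n M : ℕ, M ≤ (n + 2) ^ c →
    (T n M : ℝ) ≤ C * ((n : ℝ) + 1) ^ (3 - ε)

/-- A subcubic reduction from `A` to `B`: one oracle program that solves `A` with any oracle for `B`,
such that if the oracle answers in some truly subcubic time `T`, then the program solves `A`, for
polynomially bounded weights, in total time `O(n ^ (3 - δ))` for some `δ > 0`, on words of
`O(log n)` bits (absolute values at most `(n + 2) ^ b`). -/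
def SubcubicReducible (A B : Problem) : Prop :=
  ∃ P : Prog, ∀ c : ℕ, ∃ b : ℕ, ∀ T : ℕ → ℕ → ℕ, TrulySubcubic T →
    ∃ δ : ℝ, 0 < δ ∧ ∃ C : ℝ, ∀ O : B.Inst → ℤ → ℤ, IsOracle B O →
      ∀ x : A.Inst, A.weight x ≤ (A.size x + 2) ^ c →
        ∀ a : ℤ → ℤ, A.Input x a →
          ∃ (s : State) (t : ℕ),
            Exec B O T ((A.size x + 2) ^ b) P (State.start a) s t ∧
            A.Output x (s.arr 1) ∧
            (t : ℝ) ≤ C * ((A.size x : ℝ) + 1) ^ (3 - δ)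

/-- Subcubic equivalence: subcubic reductions in both directions. -/
def SubcubicEquivalent (A B : Problem) : Prop :=
  SubcubicReducible A B ∧ SubcubicReducible B A

end FineGrained

/-!
To solve `CoDiameter` with `APSP`, one call yields all distances, and their maximum shows which
vertices are endpoints of a diameter.

To solve `APSP` with `CoDiameter`, note that the distances are entries of the `2 ^ e`-th min-plus
power of the weight matrix for large `2 ^ e`, so it suffices to square a matrix `A` of order
`m = σ ^ 3` about `log n` times. The entries of the min-plus square `C` of `A` are approximated from
above to within `h`, for `h = 2 ^ f, …, 2, 1`. Cut the rows, the columns, and the intermediate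
indices into blocks of side `σ`. For three blocks, a graph with `4 * σ + 1` vertices is built in
which the vertex of row `i` fails to be an endpoint of a diameter exactly if a path `i, k, j`
through the block of `k` undercuts the estimate at some `(i, j)` by more than `h`. Each vertex that
`CoDiameter` returns thus pays for lowering an estimate by `h`. As the estimates start out within
`2 * h` of `C`, this happens `O(m ^ 2)` times in a phase, while there are also `m ^ 2` triples of
blocks, hence `O(m ^ 2 * log n)` calls on `O(m ^ (1 / 3))` vertices per squaring. Their total cost
is `O(m ^ (3 - ε / 3))` up to logarithms if a call on `v` vertices takes time `O(v ^ (3 - ε))`.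
-/

namespace FineGrained

namespace WDigraph

variable {G : WDigraph} {u v x y : Fin G.n} {a c d : ℤ}

theorem HasWalk.single (h : G.w u v = (a : WithTop ℤ)) : G.HasWalk u v a := by
  simpa using HasWalk.cons h (.nil v)

theorem HasWalk.trans (huv : G.HasWalk u v c) (hvx : G.HasWalk v x d) :
    G.HasWalk u x (c + d) := by
  induction huv with
  | nil => simpa using hvx
  | cons ha _ ih => rw [add_assoc]; exact .cons ha (ih hvx)

theorem HasWalk.eq_or_cons (h : G.HasWalk u v c) :
    (u = v ∧ c = 0) ∨ ∃ (x : Fin G.n) (a d : ℤ), G.w u x = (a : WithTop ℤ) ∧ G.HasWalk x v d ∧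
      c = a + d := by
  cases h with
  | nil => exact .inl ⟨rfl, rfl⟩
  | cons ha h => exact .inr ⟨_, _, _, ha, h, rfl⟩

theorem NonnegWeights.nonneg_of_hasWalk (hG : G.NonnegWeights) (h : G.HasWalk u v c) :
    0 ≤ c := by
  induction h with
  | nil => exact le_rfl
  | @cons u x _ a c ha _ ih =>
    have hedge : (0 : WithTop ℤ) ≤ a := ha ▸ hG u x
    exact add_nonneg (by exact_mod_cast hedge) ih

theorem NonnegWeights.noNegCycle (hG : G.NonnegWeights) : G.NoNegCycle :=
  fun _ _ h => hG.nonneg_of_hasWalk h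

theorem isDist_coe (h : G.HasWalk u v d) (hmin : ∀ c, G.HasWalk u v c → d ≤ c) :
    G.IsDist u v (d : WithTop ℤ) := by
  refine IsLeast.isGLB ⟨⟨d, h, rfl⟩, ?_⟩
  rintro _ ⟨c, hc, rfl⟩
  exact_mod_cast hmin c hc

theorem isDist_top (h : ∀ c, ¬ G.HasWalk u v c) : G.IsDist u v ⊤ :=
  ⟨fun _ ⟨c, hc, _⟩ => (h c hc).elim, fun _ _ => le_top⟩

theorem NonnegWeights.exists_shortest (hG : G.NonnegWeights) (h : G.HasWalk u v c) :
    ∃ d : ℤ, G.HasWalk u v d ∧ ∀ c, G.HasWalk u v c → d ≤ c :=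
  Int.exists_least_of_bdd (P := G.HasWalk u v) ⟨0, fun _ hz => hG.nonneg_of_hasWalk hz⟩ ⟨c, h⟩

theorem NonnegWeights.isDist_coe_iff (hG : G.NonnegWeights) :
    G.IsDist u v (d : WithTop ℤ) ↔ G.HasWalk u v d ∧ ∀ c, G.HasWalk u v c → d ≤ c := by
  refine ⟨fun h => ?_, fun h => isDist_coe h.1 h.2⟩
  by_cases hreach : ∃ c, G.HasWalk u v c
  · obtain ⟨c, hc⟩ := hreach
    obtain ⟨e, he, hmin⟩ := hG.exists_shortest hc
    have hde : d = e := by exact_mod_cast h.unique (isDist_coe he hmin)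
    exact hde ▸ ⟨he, hmin⟩
  · push Not at hreach
    exact absurd (h.unique (isDist_top hreach)) WithTop.coe_ne_top

/-- All edges of `G` have weight at most `M` in absolute value. -/
def WeightsLE (G : WDigraph) (M : ℤ) : Prop :=
  ∀ ⦃u v : Fin G.n⦄ ⦃a : ℤ⦄, G.w u v = (a : WithTop ℤ) → |a| ≤ M

theorem weightsLE_maxWeight (G : WDigraph) : G.WeightsLE G.maxWeight := by
  intro u v a h
  have hle := Finset.le_sup (f := fun p : Fin G.n × Fin G.n => ((G.w p.1 p.2).untopD 0).natAbs)
    (Finset.mem_univ (u, v))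
  rw [Int.abs_eq_natAbs, Nat.cast_le]
  simpa [h, maxWeight] using hle

/-- `G.SimplePath u v c l`: there is a path of weight `c` from `u` to `v` through the distinct
vertices `l`. -/
inductive SimplePath (G : WDigraph) : Fin G.n → Fin G.n → ℤ → List (Fin G.n) → Prop
  | nil (u : Fin G.n) : SimplePath G u u 0 [u]
  | cons {u x v : Fin G.n} {a c : ℤ} {l : List (Fin G.n)} :
      G.w u x = (a : WithTop ℤ) → SimplePath G x v c l → u ∉ l →
      SimplePath G u v (a + c) (u :: l)

namespace SimplePath

variable {l : List (Fin G.n)}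

theorem nodup (h : G.SimplePath u v c l) : l.Nodup := by
  induction h with
  | nil => simp
  | cons _ _ hu ih => exact List.nodup_cons.2 ⟨hu, ih⟩

theorem hasWalk (h : G.SimplePath u v c l) : G.HasWalk u v c := by
  induction h with
  | nil u => exact .nil u
  | cons ha _ _ ih => exact .cons ha ih

theorem length_le (h : G.SimplePath u v c l) : l.length ≤ G.n := by
  simpa using h.nodup.length_le_card

theorem mem_head (h : G.SimplePath u v c l) : u ∈ l := by
  cases h <;> simp

theorem split (h : G.SimplePath u v c l) (hy : y ∈ l) :
    ∃ (c₁ c₂ : ℤ) (l₂ : List (Fin G.n)),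
      G.HasWalk u y c₁ ∧ G.SimplePath y v c₂ l₂ ∧ c = c₁ + c₂ := by
  induction h with
  | nil u =>
    obtain rfl : y = u := by simpa using hy
    exact ⟨0, 0, _, .nil _, .nil _, rfl⟩
  | @cons u x v a c l ha hp hu ih =>
    rcases List.mem_cons.1 hy with rfl | hy
    · exact ⟨0, a + c, _, .nil _, .cons ha hp hu, by ring⟩
    · obtain ⟨c₁, c₂, l₂, hwalk, hpath, rfl⟩ := ih hy
      exact ⟨a + c₁, c₂, l₂, .cons ha hwalk, hpath, by ring⟩

theorem abs_le {M : ℤ} (hM : G.WeightsLE M) (hM0 : 0 ≤ M) (h : G.SimplePath u v c l) :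
    |c| ≤ l.length * M := by
  induction h with
  | nil u => simpa using hM0
  | @cons u x _ a c l ha _ _ ih =>
    calc |a + c| ≤ |a| + |c| := abs_add_le a c
      _ ≤ M + l.length * M := add_le_add (hM ha) ih
      _ = (u :: l).length * M := by rw [List.length_cons]; push_cast; ring

end SimplePath

theorem HasWalk.exists_simplePath (hG : G.NoNegCycle) (h : G.HasWalk u v c) :
    ∃ (d : ℤ) (l : List (Fin G.n)), d ≤ c ∧ G.SimplePath u v d l := by
  induction h with
  | nil u => exact ⟨0, _, le_rfl, .nil u⟩
  | @cons u x v a c ha _ ih =>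
    obtain ⟨d, l, hd, hp⟩ := ih
    by_cases hu : u ∈ l
    · obtain ⟨c₁, c₂, l₂, hwalk, hpath, rfl⟩ := hp.split hu
      have hcycle : 0 ≤ a + c₁ := hG u _ (.cons ha hwalk)
      exact ⟨c₂, l₂, by omega, hpath⟩
    · exact ⟨a + d, _, by omega, .cons ha hp hu⟩

end WDigraph

/-! ### Minimum-plus powers of a matrix -/

/-- `StepWalk W m k i j c`: there is a walk of `k` steps and weight `c` from `i` to `j` in the
`m × m` matrix `W`. -/
inductive StepWalk (W : ℕ → ℕ → ℤ) (m : ℕ) : ℕ → ℕ → ℕ → ℤ → Prop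
  | nil {i : ℕ} : i < m → StepWalk W m 0 i i 0
  | cons {k i x j : ℕ} {c : ℤ} : i < m → StepWalk W m k x j c → StepWalk W m (k + 1) i j (W i x + c)

namespace StepWalk

variable {W : ℕ → ℕ → ℤ} {m k l i x j : ℕ} {c d : ℤ}

theorem lt_left (h : StepWalk W m k i j c) : i < m := by
  cases h <;> assumption

theorem append (h : StepWalk W m k i x c) (h' : StepWalk W m l x j d) :
    StepWalk W m (k + l) i j (c + d) := by
  induction h with
  | nil => simpa using h'
  | @cons k i x j c hi _ ih =>
    rw [show k + 1 + l = k + l + 1 by omega, add_assoc (W i x)]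
    exact .cons hi (ih h')

theorem split (h : StepWalk W m (k + l) i j c) :
    ∃ (x : ℕ) (c₁ c₂ : ℤ), StepWalk W m k i x c₁ ∧ StepWalk W m l x j c₂ ∧ c = c₁ + c₂ := by
  induction k generalizing i c with
  | zero =>
    rw [Nat.zero_add] at h
    exact ⟨i, 0, c, .nil h.lt_left, h, by ring⟩
  | succ k ih =>
    rw [Nat.add_right_comm] at h
    cases h with
    | cons hi h =>
      obtain ⟨x, c₁, c₂, hk, hl, rfl⟩ := ih h
      exact ⟨x, _, c₂, .cons hi hk, hl, by ring⟩

theorem abs_le {H : ℤ} (hW : ∀ i j, |W i j| ≤ H) (h : StepWalk W m k i j c) : |c| ≤ k * H := by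
  induction h with
  | nil => simp
  | @cons k i x _ c _ _ ih =>
    calc |W i x + c| ≤ |W i x| + |c| := abs_add_le _ _
      _ ≤ H + k * H := add_le_add (hW i x) ih
      _ = (k + 1 : ℕ) * H := by push_cast; ring

end StepWalk

/-- `A` is the `k`-th power of the `m × m` matrix `W` with respect to minimum and addition: its
entries are the smallest weights of walks with `k` steps in `W`. -/
def IsMinWalk (W : ℕ → ℕ → ℤ) (m k : ℕ) (A : ℕ → ℕ → ℤ) : Prop :=
  ∀ i j, i < m → j < m → StepWalk W m k i j (A i j) ∧ ∀ c, StepWalk W m k i j c → A i j ≤ c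

/-- `C` is the square of the `m × m` matrix `A` with respect to minimum and addition. -/
def IsMinPlusSq (m : ℕ) (A C : ℕ → ℕ → ℤ) : Prop :=
  ∀ i j, i < m → j < m → (∀ k, k < m → C i j ≤ A i k + A k j) ∧ ∃ k, k < m ∧ C i j = A i k + A k j

theorem exists_isMinPlusSq (m : ℕ) (A : ℕ → ℕ → ℤ) : ∃ C, IsMinPlusSq m A C := by
  have hmin : ∀ i j, ∃ c : ℤ, i < m → (∀ k, k < m → c ≤ A i k + A k j) ∧
      ∃ k, k < m ∧ c = A i k + A k j := by
    intro i j
    by_cases hi : i < m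
    · obtain ⟨k, hk, h⟩ := Finset.exists_min_image (Finset.range m) (fun k => A i k + A k j)
        ⟨i, by simpa using hi⟩
      exact ⟨_, fun _ => ⟨fun l hl => h l (by simpa using hl), k, by simpa using hk, rfl⟩⟩
    · exact ⟨0, fun h => (hi h).elim⟩
  choose C hC using hmin
  exact ⟨C, fun i j hi _ => hC i j hi⟩

theorem isMinWalk_one (W : ℕ → ℕ → ℤ) (m : ℕ) : IsMinWalk W m 1 W := by
  refine fun i j hi hj => ⟨by simpa using StepWalk.cons (W := W) hi (.nil hj), fun c h => ?_⟩
  cases h with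
  | cons _ h => cases h with
    | nil => simp

theorem IsMinWalk.sq {W A C : ℕ → ℕ → ℤ} {m k : ℕ} (hA : IsMinWalk W m k A)
    (hC : IsMinPlusSq m A C) : IsMinWalk W m (k + k) C := by
  intro i j hi hj
  obtain ⟨hle, x, hx, heq⟩ := hC i j hi hj
  refine ⟨heq ▸ (hA i x hi hx).1.append (hA x j hx hj).1, fun c hc => ?_⟩
  obtain ⟨y, c₁, c₂, hiy, hyj, rfl⟩ := hc.split
  have hy := hyj.lt_left
  exact (hle y hy).trans (add_le_add ((hA i y hi hy).2 _ hiy) ((hA y j hy hj).2 _ hyj))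

/-! ### Distances as a minimum-plus power -/

namespace WDigraph

/-- The matrix of weights, with zeros on the diagonal (so that walks may pause) and the finite
value `H` in place of missing edges and vertices. -/
def finWeight (G : WDigraph) (H : ℤ) (i j : ℕ) : ℤ :=
  if i = j then 0
  else if h : i < G.n ∧ j < G.n then (G.w ⟨i, h.1⟩ ⟨j, h.2⟩).untopD H else H

variable {G : WDigraph} {H M c : ℤ} {m k l i j : ℕ}

theorem finWeight_cases (G : WDigraph) (H : ℤ) (i x : ℕ) :
    (i = x ∧ G.finWeight H i x = 0) ∨ G.finWeight H i x = H ∨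
      ∃ (hi : i < G.n) (hx : x < G.n), G.w ⟨i, hi⟩ ⟨x, hx⟩ = (G.finWeight H i x : WithTop ℤ) := by
  unfold finWeight
  split_ifs with hix h
  · exact .inl ⟨hix, rfl⟩
  · cases hw : G.w ⟨i, h.1⟩ ⟨x, h.2⟩ with
    | top => exact .inr (.inl rfl)
    | coe a => exact .inr (.inr ⟨h.1, h.2, by simp [hw]⟩)
  · exact .inr (.inl rfl)

theorem WeightsLE.abs_finWeight_le (hM : G.WeightsLE M) (hMH : M ≤ H) (hH : 0 ≤ H) (i j : ℕ) :
    |G.finWeight H i j| ≤ H := by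
  rcases G.finWeight_cases H i j with ⟨-, h⟩ | h | ⟨_, _, h⟩
  · simpa [h] using hH
  · rw [h, abs_of_nonneg hH]
  · exact (hM h).trans hMH

theorem WeightsLE.neg_le_finWeight (hM : G.WeightsLE M) (hM0 : 0 ≤ M) (hH : 0 ≤ H) (i j : ℕ) :
    -M ≤ G.finWeight H i j := by
  rcases G.finWeight_cases H i j with ⟨-, h⟩ | h | ⟨_, _, h⟩
  · linarith
  · linarith
  · exact neg_le_of_abs_le (hM h)

theorem WeightsLE.neg_le_of_stepWalk (hM : G.WeightsLE M) (hM0 : 0 ≤ M) (hH : 0 ≤ H)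
    (h : StepWalk (G.finWeight H) m k i j c) : -(k * M) ≤ c := by
  induction h with
  | nil => simp
  | @cons k i x j c _ _ ih =>
    push_cast
    linarith [hM.neg_le_finWeight hM0 hH i x]

theorem WeightsLE.hasWalk_or_of_stepWalk (hM : G.WeightsLE M) (hM0 : 0 ≤ M) (hH : 0 ≤ H)
    (h : StepWalk (G.finWeight H) m k i j c) (hj : j < G.n) :
    (∃ hi : i < G.n, G.HasWalk ⟨i, hi⟩ ⟨j, hj⟩ c) ∨ H - k * M ≤ c := by
  induction h with
  | nil => exact .inl ⟨hj, .nil _⟩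
  | @cons k i x j c _ hw ih =>
    push_cast
    rcases ih hj with ⟨hx, ih⟩ | ih
    · rcases G.finWeight_cases H i x with ⟨rfl, h⟩ | h | ⟨hi, _, h⟩
      · exact .inl ⟨hx, by simpa [h] using ih⟩
      · exact .inr (by linarith [hM.neg_le_of_stepWalk hM0 hH hw])
      · exact .inl ⟨hi, .cons h ih⟩
    · exact .inr (by linarith [hM.neg_le_finWeight hM0 hH i x])

theorem stepWalk_succ (h : StepWalk (G.finWeight H) m k i j c) :
    StepWalk (G.finWeight H) m (k + 1) i j c := by
  simpa [finWeight] using StepWalk.cons h.lt_left h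

theorem stepWalk_of_le (h : StepWalk (G.finWeight H) m k i j c) (hkl : k ≤ l) :
    StepWalk (G.finWeight H) m l i j c := by
  induction hkl with
  | refl => exact h
  | step _ ih => exact stepWalk_succ ih

theorem SimplePath.stepWalk (hm : G.n ≤ m) {u v : Fin G.n} {l : List (Fin G.n)}
    (h : G.SimplePath u v c l) : StepWalk (G.finWeight H) m l.length u v c := by
  induction h with
  | nil u => exact stepWalk_succ (.nil (u.2.trans_le hm))
  | @cons u x v a c l ha hp hu ih =>
    have hne : (u : ℕ) ≠ x := fun h => hu (Fin.ext h ▸ hp.mem_head)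
    have hedge : G.finWeight H u x = a := by simp [finWeight, hne, ha]
    exact hedge ▸ .cons (u.2.trans_le hm) ih

theorem SimplePath.abs_le_mul {N : ℕ} (hM : G.WeightsLE M) (hM0 : 0 ≤ M) (hN : G.n ≤ N)
    {u v : Fin G.n} {l : List (Fin G.n)} (h : G.SimplePath u v c l) : |c| ≤ N * M :=
  (h.abs_le hM hM0).trans
    (mul_le_mul_of_nonneg_right (by exact_mod_cast h.length_le.trans hN) hM0)

-- With `2 N M + 1` for missing edges, a walk of `N` steps that uses one weighs more than `N M`.
theorem isDist_of_isMinWalk (hG : G.NoNegCycle) (hM : G.WeightsLE M) (hM0 : 0 ≤ M) {N : ℕ}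
    (hN : G.n ≤ N) (hm : G.n ≤ m) {A : ℕ → ℕ → ℤ}
    (hA : IsMinWalk (G.finWeight (2 * (N * M) + 1)) m N A) (u v : Fin G.n) :
    G.IsDist u v (if A u v ≤ N * M then (A u v : WithTop ℤ) else ⊤) := by
  have hNM : 0 ≤ N * M := by positivity
  obtain ⟨hwalk, hmin⟩ := hA u v (u.2.trans_le hm) (v.2.trans_le hm)
  have hle : ∀ c, G.HasWalk u v c → A u v ≤ c ∧ A u v ≤ N * M := by
    intro c hc
    obtain ⟨d, l, hd, hp⟩ := hc.exists_simplePath hG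
    have hAd := hmin _ (stepWalk_of_le (hp.stepWalk hm) (hp.length_le.trans hN))
    exact ⟨hAd.trans hd, hAd.trans ((le_abs_self d).trans (hp.abs_le_mul hM hM0 hN))⟩
  split_ifs with h
  · refine isDist_coe ?_ fun c hc => (hle c hc).1
    rcases hM.hasWalk_or_of_stepWalk hM0 (by omega) hwalk v.2 with ⟨_, hwalk⟩ | hlarge
    · exact hwalk
    · omega
  · exact isDist_top fun c hc => h (hle c hc).2

end WDigraph

/-! ### Negative triangles and diameter endpoints -/

/-- The weight of the edge from `x` to `y` in the triangle graph, which has four groups of `s`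
vertices and one more vertex. The first group is joined to the second one, the second to the third,
and the third to the fourth by the weights `P`, `Q` and `-E`, all raised by `K`. The edges from a
vertex of the first group to anything but the second group and its copy in the fourth group have
weight `3 * K - 1`; all other edges have weight `3 * K`. -/
def triangleWeight (s K : ℤ) (P Q E : ℤ → ℤ → ℤ) (x y : ℤ) : ℤ :=
  if x < s then
    if y < s then 3 * K - 1
    else if y < 2 * s then K + P x (y - s)
    else if y = x + 3 * s then 3 * K else 3 * K - 1
  else if x < 2 * s then
    if 2 * s ≤ y ∧ y < 3 * s then K + Q (x - s) (y - 2 * s) else 3 * K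
  else if x < 3 * s then
    if 3 * s ≤ y ∧ y < 4 * s then K - E (y - 3 * s) (x - 2 * s) else 3 * K
  else 3 * K

/-- The graph in which a vertex `x` of the first group and its copy in the fourth group have
distance less than `3 * K`, the diameter, exactly if `P x z + Q z y < E x y` for some `y`, `z`. -/
def triangleGraph (s : ℕ) (K : ℤ) (P Q E : ℤ → ℤ → ℤ) : WDigraph where
  n := 4 * s + 1
  w x y := (triangleWeight s K P Q E (x : ℕ) (y : ℕ) : WithTop ℤ)

/-- The entries of the three `s × s` matrices are less than `K` in absolute value. -/
structure TriangleBounds (s : ℕ) (K : ℤ) (P Q E : ℤ → ℤ → ℤ) : Prop where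
  left : ∀ x z : ℤ, 0 ≤ x → x < s → 0 ≤ z → z < s → -K < P x z ∧ P x z < K
  right : ∀ z y : ℤ, 0 ≤ z → z < s → 0 ≤ y → y < s → -K < Q z y ∧ Q z y < K
  base : ∀ x y : ℤ, 0 ≤ x → x < s → 0 ≤ y → y < s → -K < E x y ∧ E x y < K

section TriangleWeight

variable {s K x y : ℤ} {P Q E : ℤ → ℤ → ℤ}

theorem triangleWeight_first_second (hx : x < s) (hy : s ≤ y) (hy' : y < 2 * s) :
    triangleWeight s K P Q E x y = K + P x (y - s) := by
  rw [triangleWeight, if_pos hx, if_neg (by omega), if_pos hy']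

theorem triangleWeight_second_third (hx : s ≤ x) (hx' : x < 2 * s) (hy : 2 * s ≤ y)
    (hy' : y < 3 * s) : triangleWeight s K P Q E x y = K + Q (x - s) (y - 2 * s) := by
  rw [triangleWeight, if_neg (by omega), if_pos hx', if_pos ⟨hy, hy'⟩]

theorem triangleWeight_third_fourth (hx : 2 * s ≤ x) (hx' : x < 3 * s)
    (hy : 3 * s ≤ y) (hy' : y < 4 * s) :
    triangleWeight s K P Q E x y = K - E (y - 3 * s) (x - 2 * s) := by
  rw [triangleWeight, if_neg (by omega), if_neg (by omega), if_pos hx', if_pos ⟨hy, hy'⟩]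

end TriangleWeight

namespace TriangleBounds

variable {s : ℕ} {K : ℤ} {P Q E : ℤ → ℤ → ℤ}

theorem pos (h : TriangleBounds s K P Q E) (hs : 0 < s) : 0 < K := by
  have hP := h.left 0 0 le_rfl (by exact_mod_cast hs) le_rfl (by exact_mod_cast hs)
  omega

theorem weight_mem (h : TriangleBounds s K P Q E) (hs : 0 < s) {x y : ℤ} (hx : 0 ≤ x) :
    1 ≤ triangleWeight s K P Q E x y ∧ triangleWeight s K P Q E x y ≤ 3 * K := by
  have hK := h.pos hs
  unfold triangleWeight
  split_ifs
  · omega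
  · have hP := h.left x (y - s) hx (by omega) (by omega) (by omega)
    omega
  · omega
  · omega
  · have hQ := h.right (x - s) (y - 2 * s) (by omega) (by omega) (by omega) (by omega)
    omega
  · omega
  · have hE := h.base (y - 3 * s) (x - 2 * s) (by omega) (by omega) (by omega) (by omega)
    omega
  · omega
  · omega

end TriangleBounds

namespace triangleGraph

variable {s : ℕ} {K c : ℤ} {P Q E : ℤ → ℤ → ℤ}

local notation "Γ" => triangleGraph s K P Q E

variable {u v : Fin (triangleGraph s K P Q E).n}

theorem weight_pos (h : TriangleBounds s K P Q E) (hs : 0 < s) (u v : ℕ) :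
    1 ≤ triangleWeight s K P Q E u v :=
  (h.weight_mem hs u.cast_nonneg).1

theorem weight_le (h : TriangleBounds s K P Q E) (hs : 0 < s) (u v : ℕ) :
    triangleWeight s K P Q E u v ≤ 3 * K :=
  (h.weight_mem hs u.cast_nonneg).2

theorem nonnegWeights (h : TriangleBounds s K P Q E) (hs : 0 < s) : (Γ).NonnegWeights := by
  intro u v
  change (0 : WithTop ℤ) ≤ (triangleWeight s K P Q E (u : ℕ) (v : ℕ) : ℤ)
  exact_mod_cast zero_le_one.trans (weight_pos h hs u v)

theorem maxWeight_le (h : TriangleBounds s K P Q E) (hs : 0 < s) :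
    (Γ).maxWeight ≤ (3 * K).natAbs := by
  refine Finset.sup_le fun p _ => ?_
  have hpos := weight_pos h hs p.1 p.2
  have hle := weight_le h hs p.1 p.2
  change (triangleWeight s K P Q E (p.1 : ℕ) (p.2 : ℕ)).natAbs ≤ _
  omega

theorem hasWalk_edge (u v : Fin (Γ).n) :
    (Γ).HasWalk u v (triangleWeight s K P Q E (u : ℕ) (v : ℕ)) := .single rfl

theorem exists_edge_of_hasWalk (huv : u ≠ v) (hw : (Γ).HasWalk u v c) :
    ∃ (x : Fin (Γ).n) (d : ℤ), (Γ).HasWalk x v d ∧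
      c = triangleWeight s K P Q E (u : ℕ) (x : ℕ) + d := by
  rcases hw.eq_or_cons with ⟨h, _⟩ | ⟨x, a, d, ha, hd, rfl⟩
  · exact absurd h huv
  · obtain rfl : triangleWeight s K P Q E (u : ℕ) (x : ℕ) = a := WithTop.coe_inj.1 ha
    exact ⟨x, d, hd, rfl⟩

theorem le_of_hasWalk_last (h : TriangleBounds s K P Q E) (hs : 0 < s) (hw : (Γ).HasWalk u v c)
    (hv : (v : ℕ) = 4 * s) (hu : u ≠ v) : 3 * K - 1 ≤ c ∧ (s ≤ (u : ℕ) → 3 * K ≤ c) := by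
  induction hw with
  | nil => exact absurd rfl hu
  | @cons u x v a c ha hw ih =>
    obtain rfl : triangleWeight s K P Q E (u : ℕ) (x : ℕ) = a := WithTop.coe_inj.1 ha
    have hpos := weight_pos h hs u x
    by_cases hx : x = v
    · have hc := (nonnegWeights h hs).nonneg_of_hasWalk hw
      have : (u : ℕ) < 4 * s + 1 := u.2
      have huv : (u : ℕ) ≠ v := fun h => hu (Fin.ext h)
      subst hx
      rw [triangleWeight]
      split_ifs <;> omega
    · have hc := (ih hv hx).1
      omega

theorem le_of_hasWalk_fourth (h : TriangleBounds s K P Q E) (hs : 0 < s) (hu : 3 * s ≤ (u : ℕ))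
    (huv : u ≠ v) (hw : (Γ).HasWalk u v c) : 3 * K ≤ c := by
  obtain ⟨x, d, hd, rfl⟩ := exists_edge_of_hasWalk huv hw
  have hd0 := (nonnegWeights h hs).nonneg_of_hasWalk hd
  rw [triangleWeight, if_neg (by omega), if_neg (by omega), if_neg (by omega)]
  omega

theorem le_of_hasWalk_third (h : TriangleBounds s K P Q E) (hs : 0 < s) (hu : 2 * s ≤ (u : ℕ))
    (hu' : (u : ℕ) < 3 * s) (hv : 3 * s ≤ (v : ℕ)) (hv' : (v : ℕ) < 4 * s)
    (hw : (Γ).HasWalk u v c) (hc : c < 3 * K) :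
    K - E ((v : ℕ) - 3 * s) ((u : ℕ) - 2 * s) ≤ c := by
  obtain ⟨x, d, hd, rfl⟩ := exists_edge_of_hasWalk (by rintro rfl; omega) hw
  have hd0 := (nonnegWeights h hs).nonneg_of_hasWalk hd
  have hpos := weight_pos h hs u x
  by_cases hx : x = v
  · subst hx
    rw [triangleWeight_third_fourth (by omega) (by omega) (by omega) (by omega)]
    omega
  · exfalso
    by_cases hx3 : 3 * s ≤ (x : ℕ)
    · have hfar := le_of_hasWalk_fourth h hs hx3 hx hd
      omega
    · rw [triangleWeight, if_neg (by omega), if_neg (by omega), if_pos (by omega),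
        if_neg (by omega)] at hc
      omega

theorem exists_le_of_hasWalk_second (h : TriangleBounds s K P Q E) (hs : 0 < s)
    (hu : s ≤ (u : ℕ)) (hu' : (u : ℕ) < 2 * s) (hv : 3 * s ≤ (v : ℕ)) (hv' : (v : ℕ) < 4 * s)
    (hw : (Γ).HasWalk u v c) (hc : c < 3 * K) :
    ∃ y : ℕ, y < s ∧ K + Q ((u : ℕ) - s) y + (K - E ((v : ℕ) - 3 * s) y) ≤ c := by
  obtain ⟨x, d, hd, rfl⟩ := exists_edge_of_hasWalk (by rintro rfl; omega) hw
  have hd0 := (nonnegWeights h hs).nonneg_of_hasWalk hd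
  have hpos := weight_pos h hs u x
  by_cases hx : 2 * s ≤ (x : ℕ) ∧ (x : ℕ) < 3 * s
  · have hthird := le_of_hasWalk_third h hs hx.1 hx.2 hv hv' hd (by omega)
    rw [triangleWeight_second_third (by omega) (by omega) (by omega) (by omega)]
    refine ⟨(x : ℕ) - 2 * s, by omega, ?_⟩
    rw [Nat.cast_sub hx.1]
    push_cast
    omega
  · rw [triangleWeight, if_neg (by omega), if_pos (by omega), if_neg (by omega)] at hc
    omega

theorem exists_triangle_of_hasWalk (h : TriangleBounds s K P Q E) (hs : 0 < s)
    (hu : (u : ℕ) < s) (hv : (v : ℕ) = u + 3 * s) (hw : (Γ).HasWalk u v c) (hc : c < 3 * K) :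
    ∃ y z : ℕ, y < s ∧ z < s ∧ P (u : ℕ) z + Q z y < E (u : ℕ) y := by
  obtain ⟨x, d, hd, rfl⟩ := exists_edge_of_hasWalk (by rintro rfl; omega) hw
  have hd0 := (nonnegWeights h hs).nonneg_of_hasWalk hd
  by_cases hx : s ≤ (x : ℕ) ∧ (x : ℕ) < 2 * s
  · have hpos := weight_pos h hs u x
    obtain ⟨y, hy, hsecond⟩ :=
      exists_le_of_hasWalk_second h hs hx.1 hx.2 (by omega) (by omega) hd (by omega)
    refine ⟨y, (x : ℕ) - s, hy, by omega, ?_⟩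
    rw [triangleWeight_first_second (by omega) (by omega) (by omega)] at hc
    rw [show ((v : ℕ) : ℤ) - 3 * s = (u : ℕ) by omega] at hsecond
    rw [Nat.cast_sub hx.1]
    omega
  · exfalso
    have hedge : triangleWeight s K P Q E (u : ℕ) (x : ℕ) =
        if ((x : ℕ) : ℤ) = (u : ℕ) + 3 * s then 3 * K else 3 * K - 1 := by
      unfold triangleWeight
      split_ifs <;> omega
    split_ifs at hedge with hxv
    · omega
    · obtain ⟨y, e, he, rfl⟩ := exists_edge_of_hasWalk (by rintro rfl; omega) hd
      have he0 := (nonnegWeights h hs).nonneg_of_hasWalk he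
      have hpos := weight_pos h hs x y
      omega

theorem exists_shortest (h : TriangleBounds s K P Q E) (hs : 0 < s) (u v : Fin (Γ).n) :
    ∃ d : ℤ, (Γ).HasWalk u v d ∧ d ≤ 3 * K ∧ (Γ).IsDist u v d := by
  obtain ⟨d, hd, hmin⟩ := (nonnegWeights h hs).exists_shortest (hasWalk_edge u v)
  exact ⟨d, hd, (hmin _ (hasWalk_edge u v)).trans (weight_le h hs u v), WDigraph.isDist_coe hd hmin⟩

theorem isDist_of_forall_le (h : TriangleBounds s K P Q E) (hs : 0 < s)
    (hc : ∀ c, (Γ).HasWalk u v c → 3 * K ≤ c) : (Γ).IsDist u v (3 * K : ℤ) := by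
  obtain ⟨d, hd, hle, hdist⟩ := exists_shortest h hs u v
  obtain rfl : d = 3 * K := le_antisymm hle (hc d hd)
  exact hdist

/-- The vertex of the triangle graph with number `i`. -/
abbrev vertex (s : ℕ) (K : ℤ) (P Q E : ℤ → ℤ → ℤ) (i : ℕ) (hi : i < 4 * s + 1) :
    Fin (triangleGraph s K P Q E).n :=
  ⟨i, hi⟩

theorem isDiameter (h : TriangleBounds s K P Q E) (hs : 0 < s) : (Γ).IsDiameter (3 * K : ℤ) := by
  refine ⟨⟨vertex s K P Q E (4 * s) (by omega), vertex s K P Q E 0 (by omega),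
    isDist_of_forall_le h hs fun c hc => ?_⟩, ?_⟩
  · exact le_of_hasWalk_fourth h hs (by simp only; omega)
      (Fin.ne_of_val_ne (by simp only; omega)) hc
  · rintro z ⟨x, y, hz⟩
    obtain ⟨d, -, hle, hdist⟩ := exists_shortest h hs x y
    rw [hz.unique hdist]
    exact_mod_cast hle

theorem isDiameterVertex_iff (h : TriangleBounds s K P Q E) (hs : 0 < s) (u : Fin (Γ).n) :
    (Γ).IsDiameterVertex u ↔ ∃ v, ∀ c, (Γ).HasWalk u v c → 3 * K ≤ c := by
  constructor
  · rintro ⟨v, d, hdist, hd⟩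
    obtain rfl := hd.unique (isDiameter h hs)
    exact ⟨v, ((nonnegWeights h hs).isDist_coe_iff.1 hdist).2⟩
  · rintro ⟨v, hv⟩
    exact ⟨v, _, isDist_of_forall_le h hs hv, isDiameter h hs⟩

theorem exists_far_vertex (h : TriangleBounds s K P Q E) (hs : 0 < s) (hu : s ≤ (u : ℕ)) :
    ∃ v, ∀ c, (Γ).HasWalk u v c → 3 * K ≤ c := by
  by_cases hu4 : (u : ℕ) = 4 * s
  · refine ⟨vertex s K P Q E 0 (by omega), fun c hc =>
      le_of_hasWalk_fourth h hs (by omega) (fun huv => ?_) hc⟩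
    rw [huv] at hu4
    simp only at hu4
    omega
  · exact ⟨vertex s K P Q E (4 * s) (by omega), fun c hc =>
      (le_of_hasWalk_last h hs hc rfl fun huv => hu4 (by rw [huv])).2 hu⟩

theorem exists_hasWalk_of_triangle (hu : (u : ℕ) < s) (hv : (v : ℕ) = u + 3 * s) {y z : ℕ}
    (hy : y < s) (hz : z < s) (hlt : P (u : ℕ) z + Q z y < E (u : ℕ) y) :
    ∃ c < 3 * K, (Γ).HasWalk u v c := by
  have huz := hasWalk_edge u (vertex s K P Q E (s + z) (by omega))
  have hzy := hasWalk_edge (vertex s K P Q E (s + z) (by omega))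
    (vertex s K P Q E (2 * s + y) (by omega))
  have hyv := hasWalk_edge (vertex s K P Q E (2 * s + y) (by omega)) v
  refine ⟨_, ?_, huz.trans (hzy.trans hyv)⟩
  rw [triangleWeight_first_second (by omega) (by push_cast; omega) (by push_cast; omega),
    triangleWeight_second_third (by push_cast; omega) (by push_cast; omega) (by push_cast; omega)
      (by push_cast; omega),
    triangleWeight_third_fourth (by push_cast; omega) (by push_cast; omega) (by omega) (by omega),
    show ((v : ℕ) : ℤ) - 3 * s = (u : ℕ) by omega]
  push_cast
  rw [add_sub_cancel_left, add_sub_cancel_left]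
  omega

theorem exists_hasWalk_of_ne_copy (h : TriangleBounds s K P Q E) (hu : (u : ℕ) < s)
    (hv : (v : ℕ) ≠ u + 3 * s) : ∃ c < 3 * K, (Γ).HasWalk u v c := by
  refine ⟨_, ?_, hasWalk_edge u v⟩
  have := h.pos (by omega)
  rw [triangleWeight, if_pos (by omega)]
  split_ifs
  · omega
  · have hP := h.left (u : ℕ) ((v : ℕ) - s) (by omega) (by omega) (by omega) (by omega)
    omega
  · omega
  · omega

theorem not_isDiameterVertex_iff (h : TriangleBounds s K P Q E) (hs : 0 < s) (u : Fin (Γ).n) :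
    ¬ (Γ).IsDiameterVertex u ↔
      (u : ℕ) < s ∧ ∃ y z : ℕ, y < s ∧ z < s ∧ P (u : ℕ) z + Q z y < E (u : ℕ) y := by
  rw [isDiameterVertex_iff h hs]
  push Not
  constructor
  · intro hnear
    have hus : (u : ℕ) < s := by
      by_contra! hu
      obtain ⟨v, hv⟩ := exists_far_vertex h hs hu
      obtain ⟨c, hc, hlt⟩ := hnear v
      exact (hv c hc).not_gt hlt
    obtain ⟨c, hc, hlt⟩ := hnear (vertex s K P Q E (u + 3 * s) (by omega))
    exact ⟨hus, exists_triangle_of_hasWalk h hs hus rfl hc hlt⟩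
  · rintro ⟨hus, y, z, hy, hz, hlt⟩ v
    obtain ⟨c, hlt, hc⟩ := (em ((v : ℕ) = u + 3 * s)).elim
      (fun hv => exists_hasWalk_of_triangle hus hv hy hz hlt) (exists_hasWalk_of_ne_copy h hus)
    exact ⟨c, hc, hlt⟩

end triangleGraph

-- Registers are named `r…` and arrays `a…`.
local notation "aInput" => (0 : ℕ)
local notation "aOutput" => (1 : ℕ)
local notation "aAnswer" => (3 : ℕ)

/-! ### Expressions whose values fit into words -/

namespace Expr

instance : Add Expr := ⟨Expr.bin .add⟩
instance : Sub Expr := ⟨Expr.bin .sub⟩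
instance : Mul Expr := ⟨Expr.bin .mul⟩
instance : Div Expr := ⟨Expr.bin .div⟩
instance (k : ℕ) : OfNat Expr k := ⟨Expr.const k⟩

/-- The comparison `e < f`, with value `1` or `0`. -/
abbrev lt (e f : Expr) : Expr := .bin .lt e f

/-- The degree of an expression as a polynomial, up to constants: all values in the evaluation are
bounded by `B ^ e.deg` if `B ≥ 8` bounds the leaves. -/
def deg : Expr → ℕ
  | const _ => 1
  | reg _ => 1
  | cell _ e => e.deg
  | bin _ e f => e.deg + f.deg

/-- Constants are small, and the cells that are read from the arrays of the input and of the oracle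
answers, over which the program has no control, are bounded by `B`. -/
def Safe (B : ℕ) (s : State) : Expr → Prop
  | const c => |c| ≤ 8
  | reg _ => True
  | cell r e => e.Safe B s ∧ (r = aInput ∨ r = aAnswer →
      -(B : ℤ) ≤ s.arr r (e.eval s) ∧ s.arr r (e.eval s) ≤ B)
  | bin _ e f => e.Safe B s ∧ f.Safe B s

@[simp] theorem eval_ofNat (s : State) (k : ℕ) :
    (no_index (OfNat.ofNat k) : Expr).eval s = (k : ℤ) := rfl
@[simp] theorem eval_const (s : State) (c : ℤ) : (const c).eval s = c := rfl
@[simp] theorem eval_reg (s : State) (x : ℕ) : (reg x).eval s = s.reg x := rfl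
@[simp] theorem eval_cell (s : State) (r : ℕ) (e : Expr) :
    (cell r e).eval s = s.arr r (e.eval s) := rfl
@[simp] theorem eval_add (s : State) (e f : Expr) : (e + f).eval s = e.eval s + f.eval s := rfl
@[simp] theorem eval_sub (s : State) (e f : Expr) : (e - f).eval s = e.eval s - f.eval s := rfl
@[simp] theorem eval_mul (s : State) (e f : Expr) : (e * f).eval s = e.eval s * f.eval s := rfl
@[simp] theorem eval_div (s : State) (e f : Expr) : (e / f).eval s = e.eval s / f.eval s := rfl
@[simp] theorem eval_lt (s : State) (e f : Expr) :
    (bin .lt e f).eval s = if e.eval s < f.eval s then 1 else 0 := rfl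

@[simp] theorem cost_ofNat (k : ℕ) : (no_index (OfNat.ofNat k) : Expr).cost = 1 := rfl
@[simp] theorem cost_const (c : ℤ) : (const c).cost = 1 := rfl
@[simp] theorem cost_reg (x : ℕ) : (reg x).cost = 1 := rfl
@[simp] theorem cost_cell (r : ℕ) (e : Expr) : (cell r e).cost = e.cost + 1 := rfl
@[simp] theorem cost_add (e f : Expr) : (e + f).cost = e.cost + f.cost + 1 := rfl
@[simp] theorem cost_sub (e f : Expr) : (e - f).cost = e.cost + f.cost + 1 := rfl
@[simp] theorem cost_mul (e f : Expr) : (e * f).cost = e.cost + f.cost + 1 := rfl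
@[simp] theorem cost_div (e f : Expr) : (e / f).cost = e.cost + f.cost + 1 := rfl
@[simp] theorem cost_bin (o : BinOp) (e f : Expr) :
    (bin o e f).cost = e.cost + f.cost + 1 := rfl

@[simp] theorem safe_ofNat (B : ℕ) (s : State) (k : ℕ) :
    (no_index (OfNat.ofNat k) : Expr).Safe B s ↔ k ≤ 8 := by
  change |(k : ℤ)| ≤ 8 ↔ _
  rw [abs_of_nonneg (by positivity)]; omega
@[simp] theorem safe_const (B : ℕ) (s : State) (c : ℤ) : (const c).Safe B s ↔ |c| ≤ 8 := Iff.rfl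
@[simp] theorem safe_reg (B : ℕ) (s : State) (x : ℕ) : (reg x).Safe B s := trivial
@[simp] theorem safe_cell (B : ℕ) (s : State) (r : ℕ) (e : Expr) :
    (cell r e).Safe B s ↔ e.Safe B s ∧ (r = aInput ∨ r = aAnswer →
      -(B : ℤ) ≤ s.arr r (e.eval s) ∧ s.arr r (e.eval s) ≤ B) := Iff.rfl
@[simp] theorem safe_add (B : ℕ) (s : State) (e f : Expr) :
    (e + f).Safe B s ↔ e.Safe B s ∧ f.Safe B s := Iff.rfl
@[simp] theorem safe_sub (B : ℕ) (s : State) (e f : Expr) :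
    (e - f).Safe B s ↔ e.Safe B s ∧ f.Safe B s := Iff.rfl
@[simp] theorem safe_mul (B : ℕ) (s : State) (e f : Expr) :
    (e * f).Safe B s ↔ e.Safe B s ∧ f.Safe B s := Iff.rfl
@[simp] theorem safe_div (B : ℕ) (s : State) (e f : Expr) :
    (e / f).Safe B s ↔ e.Safe B s ∧ f.Safe B s := Iff.rfl
@[simp] theorem safe_bin (B : ℕ) (s : State) (o : BinOp) (e f : Expr) :
    (bin o e f).Safe B s ↔ e.Safe B s ∧ f.Safe B s := Iff.rfl

theorem deg_pos (e : Expr) : 1 ≤ e.deg := by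
  induction e with
  | const => exact le_rfl
  | reg => exact le_rfl
  | cell _ _ ih => exact ih
  | bin o e f ih _ => exact le_trans ih (Nat.le_add_right _ _)

end Expr

namespace State

@[simp] theorem reg_setReg (s : State) (x : ℕ) (v : ℤ) (y : ℕ) :
    (s.setReg x v).reg y = if y = x then v else s.reg y := by
  simp [setReg, Function.update_apply]
@[simp] theorem arr_setReg (s : State) (x : ℕ) (v : ℤ) (r : ℕ) : (s.setReg x v).arr r = s.arr r :=
  rfl
@[simp] theorem reg_setCell (s : State) (r : ℕ) (i v : ℤ) (y : ℕ) :
    (s.setCell r i v).reg y = s.reg y := rfl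
theorem arr_setCell (s : State) (r : ℕ) (i v : ℤ) (q : ℕ) :
    (s.setCell r i v).arr q = if q = r then Function.update (s.arr r) i v else s.arr q := by
  simp only [setCell, Function.update_apply]
@[simp] theorem arr_setCell_same (s : State) (r : ℕ) (i v : ℤ) :
    (s.setCell r i v).arr r = Function.update (s.arr r) i v := by simp [arr_setCell]
@[simp] theorem reg_setArr (s : State) (r : ℕ) (a : ℤ → ℤ) (y : ℕ) :
    (s.setArr r a).reg y = s.reg y := rfl
@[simp] theorem arr_setArr (s : State) (r : ℕ) (a : ℤ → ℤ) (q : ℕ) :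
    (s.setArr r a).arr q = if q = r then a else s.arr q := by
  simp [setArr, Function.update_apply]

/-- All registers, and all arrays except those of the input and of the oracle answers, are bounded
by `B`. -/
def Bounded (B : ℕ) (s : State) : Prop :=
  (∀ x, -(B : ℤ) ≤ s.reg x ∧ s.reg x ≤ B) ∧
  ∀ r, r ≠ aInput → r ≠ aAnswer → ∀ i, -(B : ℤ) ≤ s.arr r i ∧ s.arr r i ≤ B

theorem Bounded.setReg {B : ℕ} {s : State} (h : s.Bounded B) {x : ℕ} {v : ℤ}
    (hv : -(B : ℤ) ≤ v ∧ v ≤ B) : (s.setReg x v).Bounded B := by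
  refine ⟨fun y => ?_, fun r h0 h3 i => by simpa using h.2 r h0 h3 i⟩
  rw [reg_setReg]; split
  · exact hv
  · exact h.1 y

theorem Bounded.setCell {B : ℕ} {s : State} (h : s.Bounded B) {r : ℕ} {i v : ℤ}
    (hv : -(B : ℤ) ≤ v ∧ v ≤ B) : (s.setCell r i v).Bounded B := by
  refine ⟨fun y => h.1 y, fun q h0 h3 j => ?_⟩
  rw [arr_setCell]; split
  · subst q; rw [Function.update_apply]; split
    · exact hv
    · exact h.2 r h0 h3 j
  · exact h.2 q h0 h3 j

theorem Bounded.setArr {B : ℕ} {s : State} (h : s.Bounded B) {a : ℤ → ℤ} :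
    (s.setArr aAnswer a).Bounded B := by
  refine ⟨fun y => h.1 y, fun q h0 h3 j => ?_⟩
  rw [arr_setArr, if_neg h3]
  exact h.2 q h0 h3 j

end State

theorem BinOp.natAbs_eval_le (o : BinOp) {x y : ℤ} {B d e : ℕ} (hB : 2 ≤ B) (hd : 1 ≤ d)
    (he : 1 ≤ e) (hx : x.natAbs ≤ B ^ d) (hy : y.natAbs ≤ B ^ e) :
    (o.eval x y).natAbs ≤ B ^ (d + e) := by
  have hdB : 2 ≤ B ^ d := hB.trans (Nat.le_self_pow (by omega) B)
  have heB : 2 ≤ B ^ e := hB.trans (Nat.le_self_pow (by omega) B)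
  have hsum : B ^ d + B ^ e ≤ B ^ (d + e) := by rw [pow_add]; nlinarith
  cases o with
  | add => exact (Int.natAbs_add_le x y).trans (by omega)
  | sub => exact (Int.natAbs_sub_le x y).trans (by omega)
  | mul =>
    change (x * y).natAbs ≤ _
    rw [Int.natAbs_mul, pow_add]
    exact Nat.mul_le_mul hx hy
  | div => exact (Int.natAbs_ediv_le_natAbs x y).trans (by omega)
  | lt =>
    change (if x < y then (1 : ℤ) else 0).natAbs ≤ _
    split <;> omega

theorem Expr.fits_of_safe {B W : ℕ} {s : State} (hB : 8 ≤ B) (hs : s.Bounded B) (e : Expr)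
    (he : e.Safe B s) (hW : B ^ e.deg ≤ W) :
    e.Fits W s ∧ (e.eval s).natAbs ≤ B ^ e.deg := by
  induction e with
  | const c =>
    have hc : c.natAbs ≤ B := by
      have : |c| ≤ 8 := he
      rw [Int.abs_eq_natAbs] at this
      omega
    simp only [Expr.deg, pow_one] at hW ⊢
    exact ⟨hc.trans hW, hc⟩
  | reg x =>
    have hx : (s.reg x).natAbs ≤ B := by
      have := hs.1 x
      omega
    simp only [Expr.deg, pow_one] at hW ⊢
    exact ⟨hx.trans hW, hx⟩
  | cell r e ih =>
    obtain ⟨hindex, hcell⟩ := he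
    have hle : -(B : ℤ) ≤ s.arr r (e.eval s) ∧ s.arr r (e.eval s) ≤ B := by
      by_cases hr : r = aInput ∨ r = aAnswer
      · exact hcell hr
      · rw [not_or] at hr
        exact hs.2 r hr.1 hr.2 _
    have habs : (s.arr r (e.eval s)).natAbs ≤ B ^ e.deg :=
      le_trans (by omega) (Nat.le_self_pow (Nat.one_le_iff_ne_zero.1 e.deg_pos) B)
    exact ⟨⟨(ih hindex hW).1, habs.trans hW⟩, habs⟩
  | bin o e f ihe ihf =>
    have hpow {d : ℕ} (hd : d ≤ e.deg + f.deg) : B ^ d ≤ W :=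
      (Nat.pow_le_pow_right (by omega) hd).trans hW
    obtain ⟨hefits, heabs⟩ := ihe he.1 (hpow (Nat.le_add_right _ _))
    obtain ⟨hffits, hfabs⟩ := ihf he.2 (hpow (Nat.le_add_left _ _))
    have habs := o.natAbs_eval_le (by omega) e.deg_pos f.deg_pos heabs hfabs
    exact ⟨⟨hefits, hffits, habs.trans hW⟩, habs⟩

/-! ### Total correctness with time and space bounds -/

namespace Prog

/-- The registers that the program may change. -/
def regs : Prog → List ℕ
  | skip => []
  | assign x _ => [x]
  | store _ _ _ => []
  | seq p q => p.regs ++ q.regs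
  | ite _ p q => p.regs ++ q.regs
  | loop _ p => p.regs
  | call _ _ => []

/-- The arrays that the program may change. -/
def arrs : Prog → List ℕ
  | skip => []
  | assign _ _ => []
  | store r _ _ => [r]
  | seq p q => p.arrs ++ q.arrs
  | ite _ p q => p.arrs ++ q.arrs
  | loop _ p => p.arrs
  | call _ r => [r]

/-- The two memories agree on everything that the program does not change. -/
def Frame (p : Prog) (s s' : State) : Prop :=
  (∀ x, x ∉ p.regs → s'.reg x = s.reg x) ∧ ∀ r, r ∉ p.arrs → s'.arr r = s.arr r

theorem Frame.rfl {p : Prog} {s : State} : p.Frame s s :=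
  ⟨fun _ _ => Eq.refl _, fun _ _ => Eq.refl _⟩

theorem Frame.trans {p : Prog} {s₁ s₂ s₃ : State} (h : p.Frame s₁ s₂) (h' : p.Frame s₂ s₃) :
    p.Frame s₁ s₃ :=
  ⟨fun x hx => (h'.1 x hx).trans (h.1 x hx), fun r hr => (h'.2 r hr).trans (h.2 r hr)⟩

theorem Frame.mono {p q : Prog} {s s' : State} (h : p.Frame s s') (hregs : p.regs ⊆ q.regs)
    (harrs : p.arrs ⊆ q.arrs) : q.Frame s s' :=
  ⟨fun x hx => h.1 x fun hx' => hx (hregs hx'), fun r hr => h.2 r fun hr' => hr (harrs hr')⟩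

theorem Frame.seq_left {p q : Prog} {s s' : State} (h : p.Frame s s') : (p.seq q).Frame s s' :=
  h.mono (List.subset_append_left _ _) (List.subset_append_left _ _)

theorem Frame.seq_right {p q : Prog} {s s' : State} (h : q.Frame s s') : (p.seq q).Frame s s' :=
  h.mono (List.subset_append_right _ _) (List.subset_append_right _ _)

theorem frame_setReg (s : State) (x : ℕ) (e : Expr) (v : ℤ) :
    (Prog.assign x e).Frame s (s.setReg x v) :=
  ⟨fun y hy => by rw [State.reg_setReg, if_neg (by simpa [regs] using hy)], fun _ _ => Eq.refl _⟩

theorem frame_setCell (s : State) (r : ℕ) (i e : Expr) (j v : ℤ) :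
    (Prog.store r i e).Frame s (s.setCell r j v) :=
  ⟨fun _ _ => Eq.refl _,
    fun q hq => by rw [State.arr_setCell, if_neg (by simpa [arrs] using hq)]⟩

theorem frame_setArr (s : State) (q r : ℕ) (a : ℤ → ℤ) :
    (Prog.call q r).Frame s (s.setArr r a) :=
  ⟨fun _ _ => Eq.refl _, fun q hq => by rw [State.arr_setArr, if_neg (by simpa [arrs] using hq)]⟩

end Prog

/-- An oracle `O` for the problem `P`, the time `T` charged for its answers, the word size `W`, and
a bound `B` on the contents of the memory. All expressions of degree at most `40`, hence all that
occur in the programs below, then fit into words. -/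
structure Env where
  P : Problem
  O : P.Inst → ℤ → ℤ
  T : ℕ → ℕ → ℕ
  W : ℕ
  B : ℕ
  eight_le : 8 ≤ B
  pow_le : B ^ 40 ≤ W

/-- The weakest precondition of `p` for `Q`: from the memory `s`, if it is bounded, the program
halts in a bounded memory, and this memory and the time satisfy `Q`. -/
def WP (E : Env) (p : Prog) (s : State) (Q : State → ℕ → Prop) : Prop :=
  s.Bounded E.B → ∃ s' t, Exec E.P E.O E.T E.W p s s' t ∧ s'.Bounded E.B ∧ p.Frame s s' ∧ Q s' t

section Rules

variable {E : Env} {s : State} {Q : State → ℕ → Prop}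

theorem Expr.Safe.fits {e : Expr} (he : e.Safe E.B s) (hs : s.Bounded E.B)
    (hd : e.deg ≤ 40) : e.Fits E.W s :=
  (Expr.fits_of_safe E.eight_le hs e he
    ((Nat.pow_le_pow_right (by have := E.eight_le; omega) hd).trans E.pow_le)).1

theorem WP.mono {p : Prog} {Q' : State → ℕ → Prop} (h : WP E p s Q')
    (hQ : ∀ s' t, s'.Bounded E.B → p.Frame s s' → Q' s' t → Q s' t) : WP E p s Q := fun hs => by
  obtain ⟨s', t, hexec, hs', hF, hQ'⟩ := h hs
  exact ⟨s', t, hexec, hs', hF, hQ s' t hs' hF hQ'⟩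

theorem WP.of_bounded {p : Prog} (h : s.Bounded E.B → WP E p s Q) : WP E p s Q :=
  fun hs => h hs hs

theorem WP.of_frame {p : Prog} (h : WP E p s fun s' t => p.Frame s s' → Q s' t) : WP E p s Q :=
  h.mono fun _ _ _ hF hQ => hQ hF

theorem WP.skip (h : Q s 1) : WP E .skip s Q :=
  fun hs => ⟨s, 1, .skip s, hs, .rfl, h⟩

theorem WP.assign {x : ℕ} {e : Expr} (he : e.Safe E.B s)
    (hv : -(E.B : ℤ) ≤ e.eval s ∧ e.eval s ≤ E.B) (h : Q (s.setReg x (e.eval s)) (e.cost + 1))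
    (hd : e.deg ≤ 40 := by decide) : WP E (.assign x e) s Q := fun hs =>
  ⟨_, _, .assign (he.fits hs hd), hs.setReg hv, Prog.frame_setReg .., h⟩

theorem WP.store {r : ℕ} {i e : Expr} (hi : i.Safe E.B s) (he : e.Safe E.B s)
    (hv : -(E.B : ℤ) ≤ e.eval s ∧ e.eval s ≤ E.B)
    (h : Q (s.setCell r (i.eval s) (e.eval s)) (i.cost + e.cost + 1))
    (hd : i.deg ≤ 40 := by decide) (hd' : e.deg ≤ 40 := by decide) :
    WP E (.store r i e) s Q := fun hs =>
  ⟨_, _, .store (hi.fits hs hd) (he.fits hs hd'), hs.setCell hv, Prog.frame_setCell .., h⟩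

theorem WP.seq {p q : Prog}
    (h : WP E p s fun s₁ t₁ => WP E q s₁ fun s₂ t₂ => Q s₂ (t₁ + t₂)) :
    WP E (.seq p q) s Q := fun hs => by
  obtain ⟨s₁, t₁, hp, hs₁, hF₁, hq⟩ := h hs
  obtain ⟨s₂, t₂, hq, hs₂, hF₂, hQ⟩ := hq hs₁
  exact ⟨s₂, t₁ + t₂, .seq hp hq, hs₂, hF₁.seq_left.trans hF₂.seq_right, hQ⟩

theorem WP.assign_seq {x : ℕ} {e : Expr} {q : Prog} (he : e.Safe E.B s)
    (hv : -(E.B : ℤ) ≤ e.eval s ∧ e.eval s ≤ E.B)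
    (h : WP E q (s.setReg x (e.eval s)) fun s' t => Q s' (e.cost + 1 + t))
    (hd : e.deg ≤ 40 := by decide) : WP E (.seq (.assign x e) q) s Q :=
  .seq (.assign he hv h hd)

theorem WP.store_seq {r : ℕ} {i e : Expr} {q : Prog} (hi : i.Safe E.B s) (he : e.Safe E.B s)
    (hv : -(E.B : ℤ) ≤ e.eval s ∧ e.eval s ≤ E.B)
    (h : WP E q (s.setCell r (i.eval s) (e.eval s)) fun s' t => Q s' (i.cost + e.cost + 1 + t))
    (hd : i.deg ≤ 40 := by decide) (hd' : e.deg ≤ 40 := by decide) :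
    WP E (.seq (.store r i e) q) s Q :=
  .seq (.store hi he hv h hd hd')

theorem WP.ite {e : Expr} {p q : Prog} (he : e.Safe E.B s)
    (hp : e.eval s ≠ 0 → WP E p s fun s' t => Q s' (e.cost + 1 + t))
    (hq : e.eval s = 0 → WP E q s fun s' t => Q s' (e.cost + 1 + t))
    (hd : e.deg ≤ 40 := by decide) : WP E (.ite e p q) s Q := fun hs => by
  by_cases h : e.eval s = 0
  · obtain ⟨s', t, hexec, hs', hF, hQ⟩ := hq h hs
    exact ⟨s', _, .ite_false (he.fits hs hd) h hexec, hs', hF.seq_right, hQ⟩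
  · obtain ⟨s', t, hexec, hs', hF, hQ⟩ := hp h hs
    exact ⟨s', _, .ite_true (he.fits hs hd) h hexec, hs', hF.seq_left, hQ⟩

theorem WP.ite_lt {e f : Expr} {p q : Prog} (he : e.Safe E.B s) (hf : f.Safe E.B s)
    (hp : e.eval s < f.eval s → WP E p s fun s' t => Q s' (e.cost + f.cost + 2 + t))
    (hq : f.eval s ≤ e.eval s → WP E q s fun s' t => Q s' (e.cost + f.cost + 2 + t))
    (hd : (Expr.lt e f).deg ≤ 40 := by decide) : WP E (.ite (.lt e f) p q) s Q :=
  .ite ⟨he, hf⟩ (fun h => hp (by simpa using h)) (fun h => hq (by simpa using h)) hd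

theorem WP.call {q : ℕ} (x : E.P.Inst) (hx : E.P.Input x (s.arr q))
    (h : Q (s.setArr aAnswer (E.O x)) (1 + E.T (E.P.size x) (E.P.weight x))) :
    WP E (.call q aAnswer) s Q := fun hs =>
  ⟨_, _, .call x hx, hs.setArr, Prog.frame_setArr .., h⟩

theorem WP.loop {e : Expr} {p : Prog} (μ : State → ℕ) (I : State → ℕ → Prop) (h0 : I s 0)
    (hsafe : ∀ s' t, I s' t → e.Safe E.B s')
    (hstep : ∀ s' t, I s' t → p.Frame s s' → e.eval s' ≠ 0 →
      WP E p s' fun s'' t' => μ s'' < μ s' ∧ I s'' (t + (e.cost + 1 + t')))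
    (hend : ∀ s' t, I s' t → p.Frame s s' → e.eval s' = 0 → Q s' (t + (e.cost + 1)))
    (hd : e.deg ≤ 40 := by decide) : WP E (.loop e p) s Q := by
  have hloop : ∀ k s' t, μ s' = k → I s' t → p.Frame s s' → s'.Bounded E.B →
      ∃ s'' t', Exec E.P E.O E.T E.W (.loop e p) s' s'' t' ∧ s''.Bounded E.B ∧
        p.Frame s s'' ∧ Q s'' (t + t') := by
    intro k
    induction k using Nat.strong_induction_on with
    | _ k ih =>
      intro s' t hk hI hF hs'
      have hfits := (hsafe s' t hI).fits hs' hd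
      by_cases h : e.eval s' = 0
      · exact ⟨s', _, .loop_done hfits h, hs', hF, hend s' t hI hF h⟩
      · obtain ⟨s₁, t₁, hp, hs₁, hF₁, hlt, hI₁⟩ := hstep s' t hI hF h hs'
        obtain ⟨s₂, t₂, hrest, hs₂, hF₂, hQ⟩ := ih _ (hk ▸ hlt) s₁ _ rfl hI₁ (hF.trans hF₁) hs₁
        refine ⟨s₂, _, .loop_step hfits h hp hrest, hs₂, hF₂, ?_⟩
        convert hQ using 1
        ring
  intro hs
  obtain ⟨s', t, hexec, hs', hF, hQ⟩ := hloop _ s 0 rfl h0 .rfl hs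
  exact ⟨s', t, hexec, hs', hF, by simpa using hQ⟩

end Rules

/-- Run `p` with the register `x` going through all values below the register `y`. -/
def Prog.forTo (x y : ℕ) (p : Prog) : Prog :=
  .seq (.assign x 0) (.loop (.lt (.reg x) (.reg y)) (.seq p (.assign x (.reg x + 1))))

section ForTo

variable {E : Env} {s : State} {Q : State → ℕ → Prop} {x y : ℕ} {p : Prog}

theorem Prog.regs_forTo : (p.forTo x y).regs = x :: (p.regs ++ [x]) := rfl

theorem Prog.Frame.forTo {s' : State}
    (h : (Prog.seq p (.assign x (.reg x + 1))).Frame (s.setReg x 0) s') :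
    (p.forTo x y).Frame s s' :=
  (Prog.Frame.seq_left (Prog.frame_setReg s x 0 0)).trans
    (h.mono (List.subset_append_right _ _) (List.subset_append_right _ _))

theorem Prog.Frame.reg_forTo {s' : State} (h : (p.forTo x y).Frame s s') (hxy : x ≠ y)
    (hy : y ∉ p.regs) : s'.reg y = s.reg y :=
  h.1 y (by simp [Prog.regs_forTo, hxy.symm, hy])

theorem WP.forTo (N : ℕ) (I : ℕ → State → ℕ → Prop)
    (hN : s.reg y = N) (hx : x ≠ y ∧ x ∉ p.regs ∧ y ∉ p.regs)
    (h0 : I 0 (s.setReg x 0) 0)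
    (hstep : ∀ k s' t, k < N → I k s' t → s'.reg x = k → (p.forTo x y).Frame s s' →
      WP E p s' fun s'' t' => I (k + 1) (s''.setReg x (k + 1)) (t + t'))
    (hend : ∀ s' t, I N s' t → s'.reg x = N → (p.forTo x y).Frame s s' →
      Q s' (t + (8 * N + 6))) :
    WP E (p.forTo x y) s Q := by
  have hdcond : (Expr.lt (.reg x) (.reg y)).deg ≤ 40 := (by decide : 2 ≤ 40)
  have hdnext : (Expr.reg x + 1).deg ≤ 40 := (by decide : 2 ≤ 40)
  refine .of_bounded fun hs => .assign_seq (by simp) (by simp) ?_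
  have hNB : (N : ℤ) ≤ E.B := hN ▸ (hs.1 y).2
  refine .loop (fun s' => (N - s'.reg x).toNat)
    (fun s' t => ∃ (k : ℕ) (t₀ : ℕ), k ≤ N ∧ I k s' t₀ ∧ s'.reg x = k ∧ t = t₀ + 8 * k)
    ⟨0, 0, by omega, by simpa using h0, by simp, rfl⟩ (by simp) ?_ ?_ hdcond
  · rintro s' t ⟨k, t₀, _, hI, hxk, rfl⟩ hF hcond
    have hkN : k < N := by
      simpa [hxk, hF.forTo.reg_forTo hx.1 hx.2.2, hN] using hcond
    refine .seq ((hstep k s' t₀ hkN hI hxk hF.forTo).mono fun s₁ t₁ _ hF₁ hI₁ => ?_)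
    have hx₁ : s₁.reg x = k := by rw [hF₁.1 x hx.2.1, hxk]
    refine .assign (by simp) (by simp [hx₁]; omega) ?_ hdnext
    refine ⟨?_, k + 1, t₀ + t₁, hkN, by simpa [hx₁] using hI₁, by simp [hx₁], ?_⟩
    · simp only [hx₁, hxk, Expr.eval_add, Expr.eval_reg, Expr.eval_ofNat, State.reg_setReg, if_true]
      omega
    · simp only [Expr.cost_bin, Expr.cost_reg, Expr.cost_add, Expr.cost_ofNat]
      ring
  · rintro s' t ⟨k, t₀, hk, hI, hxk, rfl⟩ hF hcond
    obtain rfl : k = N := by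
      have : N ≤ k := by simpa [hxk, hF.forTo.reg_forTo hx.1 hx.2.2, hN] using hcond
      omega
    convert hend s' t₀ hI hxk hF.forTo using 1
    simp only [Expr.cost_bin, Expr.cost_reg, Expr.cost_ofNat]
    ring

theorem WP.forTo_le (N τ : ℕ) (I : ℕ → State → Prop)
    (hN : s.reg y = N) (hx : x ≠ y ∧ x ∉ p.regs ∧ y ∉ p.regs)
    (h0 : I 0 (s.setReg x 0))
    (hstep : ∀ k s', k < N → I k s' → s'.reg x = k → (p.forTo x y).Frame s s' →
      WP E p s' fun s'' t' => t' ≤ τ ∧ I (k + 1) (s''.setReg x (k + 1)))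
    (hend : ∀ s' t, I N s' → s'.reg x = N → (p.forTo x y).Frame s s' →
      t ≤ N * (τ + 8) + 6 → Q s' t) :
    WP E (p.forTo x y) s Q := by
  refine .forTo N (fun k s t => t ≤ k * τ ∧ I k s) hN hx ⟨by simp, h0⟩ ?_ ?_
  · rintro k s' t hk ⟨ht, hI⟩ hxk hF
    refine (hstep k s' hk hI hxk hF).mono fun s₁ t₁ _ _ h => ⟨?_, h.2⟩
    rw [add_mul, one_mul]
    exact add_le_add ht h.1
  · rintro s' t ⟨ht, hI⟩ hxN hF
    exact hend s' _ hI hxN hF (by rw [mul_add]; omega)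

theorem WP.forTo_fill {r : ℕ} (N τ : ℕ) (v : ℕ → ℤ) (hN : s.reg y = N)
    (hx : x ≠ y ∧ x ∉ p.regs ∧ y ∉ p.regs)
    (hstep : ∀ (k : ℕ) (s' : State), k < N → s'.reg x = k → (p.forTo x y).Frame s s' →
      WP E p s' fun s'' t => s''.arr r = Function.update (s'.arr r) k (v k) ∧ t ≤ τ) :
    WP E (p.forTo x y) s fun s' t => (∀ k : ℕ, k < N → s'.arr r k = v k) ∧
      (∀ c, s'.arr r c = s.arr r c ∨ ∃ k : ℕ, k < N ∧ s'.arr r c = v k) ∧ t ≤ N * (τ + 8) + 6 := by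
  refine .forTo_le N τ (fun k s' => (∀ l : ℕ, l < k → s'.arr r l = v l) ∧
    ∀ c, s'.arr r c = s.arr r c ∨ ∃ l : ℕ, l < N ∧ s'.arr r c = v l) hN hx ⟨by simp, by simp⟩ ?_ ?_
  · rintro k s₁ hk ⟨hfilled, hsource⟩ hxk hF
    refine (hstep k s₁ hk hxk hF).mono fun s₂ t _ _ ⟨hupdate, ht⟩ =>
      ⟨ht, fun l hl => ?_, fun c => ?_⟩
    · rw [State.arr_setReg, hupdate]
      rcases Nat.lt_succ_iff_lt_or_eq.1 hl with hlk | rfl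
      · rw [Function.update_of_ne (by omega), hfilled l hlk]
      · rw [Function.update_self]
    · rw [State.arr_setReg, hupdate, Function.update_apply]
      split_ifs
      · exact .inr ⟨k, hk, rfl⟩
      · exact hsource c
  · rintro s' t ⟨hfilled, hsource⟩ - - ht
    exact ⟨hfilled, hsource, ht⟩

end ForTo

/-- Run `p` with the registers `q` and `r` set to the quotient and the remainder of the registers
`x` and `y`. -/
def Prog.divMod (q r x y : ℕ) (p : Prog) : Prog :=
  .seq (.assign q (.reg x / .reg y)) (.seq (.assign r (.reg x - .reg q * .reg y)) p)

theorem WP.divMod {E : Env} {s : State} {Q : State → ℕ → Prop} {q r x y : ℕ} {p : Prog}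
    {i j n : ℕ} (hx : s.reg x = (i * n + j : ℕ)) (hy : s.reg y = n) (hj : j < n)
    (hq : x ≠ q ∧ y ≠ q)
    (h : WP E p ((s.setReg q i).setReg r j) fun s' t => Q s' (10 + t)) :
    WP E (p.divMod q r x y) s Q := by
  have hdquot : (Expr.reg x / .reg y).deg ≤ 40 := (by decide : 2 ≤ 40)
  have hdrem : (Expr.reg x - .reg q * .reg y).deg ≤ 40 := (by decide : 3 ≤ 40)
  refine .of_bounded fun hs => ?_
  have hB : i * n + j ≤ E.B := by exact_mod_cast hx ▸ (hs.1 x).2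
  have hi : i ≤ i * n := Nat.le_mul_of_pos_right i (by omega)
  have hquot : (Expr.reg x / .reg y).eval s = i := by
    rw [Expr.eval_div, Expr.eval_reg, Expr.eval_reg, hx, hy, ← Int.natCast_ediv, mul_comm,
      Nat.mul_add_div (by omega), Nat.div_eq_of_lt hj, add_zero]
  refine .assign_seq (by simp) (by rw [hquot]; omega) ?_ hdquot
  rw [hquot]
  have hrem : (Expr.reg x - .reg q * .reg y).eval (s.setReg q i) = j := by
    simp [hq, hx, hy]
  refine .assign_seq (by simp) (by rw [hrem]; omega) ?_ hdrem
  rw [hrem]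
  refine h.mono fun _ _ _ _ hQ => ?_
  convert hQ using 1
  simp only [Expr.cost_div, Expr.cost_sub, Expr.cost_mul, Expr.cost_reg]
  omega

/-! ### From CoDiameter to all-pairs shortest paths -/

namespace WDigraph

variable {G : WDigraph}

theorem isDiameterVertex_iff {D : Fin G.n → Fin G.n → WithTop ℤ}
    (hD : ∀ u v, G.IsDist u v (D u v)) {X : Fin G.n → Fin G.n → ℤ}
    (hX : ∀ u v u' v', D u v ≤ D u' v' ↔ X u v ≤ X u' v') {m : ℤ} (hm : ∀ u v, X u v ≤ m)
    (hattained : ∃ u v, X u v = m) (u : Fin G.n) : G.IsDiameterVertex u ↔ ∃ v, X u v = m := by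
  obtain ⟨u₀, v₀, rfl⟩ := hattained
  have hdiam : G.IsDiameter (D u₀ v₀) := by
    refine ⟨⟨u₀, v₀, hD _ _⟩, ?_⟩
    rintro z ⟨x, y, hz⟩
    rw [IsGLB.unique hz (hD x y)]
    exact (hX _ _ _ _).2 (hm x y)
  constructor
  · rintro ⟨v, d, hdist, hd⟩
    have heq : D u v = D u₀ v₀ := (IsGLB.unique (hD u v) hdist).trans (hd.unique hdiam)
    exact ⟨v, le_antisymm (hm u v) ((hX _ _ _ _).1 heq.ge)⟩
  · rintro ⟨v, hv⟩
    have heq : D u v = D u₀ v₀ := le_antisymm ((hX _ _ _ _).2 hv.le) ((hX _ _ _ _).2 hv.ge)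
    exact ⟨v, _, hD u v, heq ▸ hdiam⟩

theorem NonnegWeights.isDist_bounds (hG : G.NonnegWeights) {u v : Fin G.n} {d : ℤ}
    (hd : G.IsDist u v d) : 0 ≤ d ∧ d ≤ (G.n * G.maxWeight : ℕ) := by
  obtain ⟨hwalk, hmin⟩ := hG.isDist_coe_iff.1 hd
  obtain ⟨c, l, -, hp⟩ := hwalk.exists_simplePath hG.noNegCycle
  refine ⟨hG.nonneg_of_hasWalk hwalk, ?_⟩
  calc d ≤ c := hmin c hp.hasWalk
    _ ≤ |c| := le_abs_self c
    _ ≤ G.n * G.maxWeight := hp.abs_le_mul G.weightsLE_maxWeight (by positivity) le_rfl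
    _ = (G.n * G.maxWeight : ℕ) := by push_cast; rfl

end WDigraph

theorem rowMajor_lt {m n i j : ℕ} (hi : i < m) (hj : j < n) : i * n + j < m * n := by
  have := Nat.mul_le_mul_right n (Nat.succ_le_of_lt hi)
  rw [Nat.succ_mul] at this
  omega

theorem exists_rowMajor {n k : ℕ} (hk : k < n * n) :
    ∃ i j : Fin n, (i : ℕ) * n + j = k ∧ k / n = i := by
  have hn : 0 < n := Nat.pos_of_ne_zero fun h => by simp [h] at hk
  exact ⟨⟨k / n, Nat.div_lt_of_lt_mul hk⟩, ⟨k % n, Nat.mod_lt _ hn⟩, Nat.div_add_mod' k n, rfl⟩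

theorem rowMajor_div {n i j : ℕ} (hj : j < n) : (i * n + j) / n = i := by
  rw [mul_comm, Nat.mul_add_div (by omega), Nat.div_eq_of_lt hj, add_zero]

/-- The array `A` holds `N` entries, as in `HoldsMatrix`, that are infinite or between `0` and
`b`. -/
def EntriesLE (A : ℤ → ℤ) (N : ℕ) (b : ℤ) : Prop :=
  ∀ k < N, (A (2 * k) = 0 ∨ A (2 * k) = 1) ∧ 0 ≤ A (2 * k + 1) ∧ A (2 * k + 1) ≤ b

/-- A value that exceeds all finite ones among the first `N` entries in the array `A`. -/
def inftyValue (A : ℤ → ℤ) (N : ℕ) : ℤ := 1 + ∑ k ∈ Finset.range N, A (2 * k + 1)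

/-- The entry `k` in the array `A`, with infinity replaced by `inftyValue A N`. -/
def finiteEntry (A : ℤ → ℤ) (N k : ℕ) : ℤ := if A (2 * k) = 0 then inftyValue A N else A (2 * k + 1)

namespace EntriesLE

variable {A : ℤ → ℤ} {N k : ℕ} {b : ℤ}

theorem inftyValue_le (h : EntriesLE A N b) : inftyValue A N ≤ 1 + N * b := by
  have := Finset.sum_le_card_nsmul (Finset.range N) (fun k : ℕ => A (2 * k + 1)) b
    fun k hk => (h k (Finset.mem_range.1 hk)).2.2
  simpa [inftyValue] using this

theorem inftyValue_mono (h : EntriesLE A N b) (hk : k ≤ N) : inftyValue A k ≤ inftyValue A N :=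
  add_le_add_right (Finset.sum_le_sum_of_subset_of_nonneg (Finset.range_mono hk)
    fun i hi _ => (h i (Finset.mem_range.1 hi)).2.1) _

theorem inftyValue_pos (h : EntriesLE A N b) (hk : k ≤ N) : 0 < inftyValue A k := by
  have := Finset.sum_nonneg fun i (hi : i ∈ Finset.range k) =>
    (h i ((Finset.mem_range.1 hi).trans_le hk)).2.1
  simp only [inftyValue]
  omega

theorem inftyValue_succ : inftyValue A (k + 1) = inftyValue A k + A (2 * k + 1) := by
  rw [inftyValue, Finset.sum_range_succ, ← add_assoc, ← inftyValue]

theorem lt_inftyValue (h : EntriesLE A N b) (hk : k < N) : A (2 * k + 1) < inftyValue A N := by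
  have := h.inftyValue_mono hk
  have := h.inftyValue_pos hk.le
  rw [inftyValue_succ] at *
  omega

theorem finiteEntry_mem (h : EntriesLE A N b) (hk : k < N) :
    0 ≤ finiteEntry A N k ∧ finiteEntry A N k ≤ inftyValue A N := by
  have := h.lt_inftyValue hk
  have := (h k hk).2.1
  rw [finiteEntry]
  split <;> omega

end EntriesLE

theorem HoldsMatrix.apply_zero {n : ℕ} {A : ℤ → ℤ} {D : Fin n → Fin n → WithTop ℤ}
    (hA : HoldsMatrix A 0 D) (i j : Fin n) :
    A (2 * (i * n + j : ℕ)) = (if D i j = ⊤ then 0 else 1) ∧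
    A (2 * (i * n + j : ℕ) + 1) = (D i j).untopD 0 := by
  simpa using hA i j

section Distances

variable {G : WDigraph} {D : Fin G.n → Fin G.n → WithTop ℤ} {A : ℤ → ℤ}

theorem entriesLE_of_isDist (hG : G.NonnegWeights) (hD : ∀ u v, G.IsDist u v (D u v))
    (hA : HoldsMatrix A 0 D) : EntriesLE A (G.n * G.n) (G.n * G.maxWeight : ℕ) := by
  intro k hk
  obtain ⟨i, j, rfl, -⟩ := exists_rowMajor hk
  obtain ⟨hflag, hvalue⟩ := hA.apply_zero i j
  rw [hflag, hvalue]
  cases hd : D i j with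
  | top => simp only [if_true, true_or, WithTop.untopD_top, le_refl, Nat.cast_nonneg, and_self]
  | coe d => simpa using hG.isDist_bounds (hd ▸ hD i j)

theorem le_iff_finiteEntry_le {b : ℤ} (hb : EntriesLE A (G.n * G.n) b) (hA : HoldsMatrix A 0 D)
    (u v u' v' : Fin G.n) : D u v ≤ D u' v' ↔
      finiteEntry A (G.n * G.n) (u * G.n + v) ≤ finiteEntry A (G.n * G.n) (u' * G.n + v') := by
  have hlt := hb.lt_inftyValue (rowMajor_lt u.2 v.2)
  have hlt' := hb.lt_inftyValue (rowMajor_lt u'.2 v'.2)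
  obtain ⟨hflag, hvalue⟩ := hA.apply_zero u v
  obtain ⟨hflag', hvalue'⟩ := hA.apply_zero u' v'
  rw [hvalue] at hlt
  rw [hvalue'] at hlt'
  rw [finiteEntry, finiteEntry, hflag, hvalue, hflag', hvalue']
  cases h : D u v <;> cases h' : D u' v' <;> simp_all [-Nat.cast_add, -Nat.cast_mul, le_of_lt]

theorem isDiameterVertex_iff_finiteEntry (hG : G.NonnegWeights)
    (hD : ∀ u v, G.IsDist u v (D u v)) (hA : HoldsMatrix A 0 D) (u : Fin G.n) :
    G.IsDiameterVertex u ↔ ∃ k < G.n * G.n, finiteEntry A (G.n * G.n) k =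
      (Finset.range (G.n * G.n)).fold max 0 (finiteEntry A (G.n * G.n)) ∧ k / G.n = u := by
  have hb := entriesLE_of_isDist hG hD hA
  set X := finiteEntry A (G.n * G.n)
  obtain ⟨hm0, hle⟩ := (Finset.fold_max_le ((Finset.range (G.n * G.n)).fold max 0 X)).1 le_rfl
  have hmax := (Finset.le_fold_max ((Finset.range (G.n * G.n)).fold max 0 X)).1 le_rfl
  set m := (Finset.range (G.n * G.n)).fold max 0 X
  have huu : (u : ℕ) * G.n + u < G.n * G.n := rowMajor_lt u.2 u.2
  have hattained : ∃ u v : Fin G.n, X (u * G.n + v) = m := by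
    rcases hmax with hm | ⟨k, hk, hkm⟩
    · have := hle _ (Finset.mem_range.2 huu)
      have : 0 ≤ X (u * G.n + u) := (hb.finiteEntry_mem huu).1
      exact ⟨u, u, by omega⟩
    · obtain ⟨i, j, rfl, -⟩ := exists_rowMajor (Finset.mem_range.1 hk)
      exact ⟨i, j, le_antisymm (hle _ hk) hkm⟩
  rw [WDigraph.isDiameterVertex_iff hD (le_iff_finiteEntry_le hb hA)
    (fun u v => hle _ (Finset.mem_range.2 (rowMajor_lt u.2 v.2))) hattained u]
  constructor
  · rintro ⟨v, hv⟩
    exact ⟨_, rowMajor_lt u.2 v.2, hv, rowMajor_div v.2⟩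
  · rintro ⟨k, hk, hkm, hku⟩
    obtain ⟨i, j, rfl, hi⟩ := exists_rowMajor hk
    obtain rfl : i = u := Fin.ext (hi.symm.trans hku)
    exact ⟨j, hkm⟩

end Distances

local notation "rVerts" => (0 : ℕ)
local notation "rEntries" => (1 : ℕ)
local notation "rInfty" => (2 : ℕ)
local notation "rMax" => (3 : ℕ)
local notation "rFound" => (4 : ℕ)
local notation "rIndex" => (5 : ℕ)
local notation "rEntry" => (6 : ℕ)
local notation "aDist" => (4 : ℕ)
local notation "aMark" => (5 : ℕ)

open FineGrained.Expr (reg cell)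

def sumProg : Prog := .forTo rIndex rEntries <|
  .assign rInfty (reg rInfty + cell aAnswer (2 * reg rIndex + 1))

def loadEntryProg : Prog := .ite (cell aAnswer (2 * reg rIndex))
  (.assign rEntry (cell aAnswer (2 * reg rIndex + 1))) (.assign rEntry (reg rInfty))

def raiseMaxProg : Prog :=
  .ite (.lt (reg rMax) (reg rEntry)) (.assign rMax (reg rEntry)) .skip

def maxProg : Prog := .forTo rIndex rEntries <|
  .seq loadEntryProg <| .seq raiseMaxProg <| .store aDist (reg rIndex) (reg rEntry)

def markProg : Prog := .forTo rIndex rEntries <|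
  .ite (cell aDist (reg rIndex) - reg rMax) .skip (.store aMark (reg rIndex / reg rVerts) 1)

def findProg : Prog := .forTo rIndex rVerts <|
  .ite (cell aMark (reg rIndex)) .skip (.assign rFound (reg rIndex))

/-- Mark the endpoints of diameters, given the distances in array `aAnswer`. -/
def diameterProg : Prog :=
  .seq (.assign rInfty 1) <|
  .seq sumProg <|
  .seq (.assign rMax 0) <|
  .seq maxProg markProg

/-- Find a vertex that is not an endpoint of a diameter. -/
def coDiameterProg : Prog :=
  .seq (.call aInput aAnswer) <|
  .seq (.assign rVerts (cell aInput 0)) <|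
  .seq (.assign rEntries (reg rVerts * reg rVerts)) <|
  .seq diameterProg <|
  .seq (.assign rFound (.const (-1))) <|
  .seq findProg (.store aOutput 0 (reg rFound))

section CoDiameterProg

variable {E : Env} {s : State} {A : ℤ → ℤ} {N n : ℕ} {b : ℤ}

theorem sumProg_wp (hN : s.reg rEntries = N) (hinfty : s.reg rInfty = 1)
    (hanswer : s.arr aAnswer = A) (hA : EntriesLE A N b) (hB : inftyValue A N ≤ E.B) :
    WP E sumProg s fun s' t => s'.reg rInfty = inftyValue A N ∧ t ≤ 17 * N + 6 := by
  refine .forTo_le N 9 (fun k s => s.reg rInfty = inftyValue A k) hN (by decide)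
    (by simpa [inftyValue] using hinfty) (fun k s' hk hI hx hF => ?_)
    fun s' t hI _ _ ht => ⟨hI, by omega⟩
  have hanswer' : s'.arr aAnswer = A := (hF.2 aAnswer (by decide)).trans hanswer
  have : inftyValue A (k + 1) ≤ inftyValue A N := hA.inftyValue_mono hk
  have := hA.inftyValue_pos hk.le
  have := (hA k hk).2.1
  have hsucc : inftyValue A (k + 1) = inftyValue A k + A (2 * k + 1) := EntriesLE.inftyValue_succ
  refine .assign ?_ ?_ ?_
  · simp [hx, hanswer']; omega
  · simp [hx, hanswer', hI]; omega
  · simp [hx, hanswer', hI, hsucc]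

theorem loadEntryProg_wp {k : ℕ} (hk : k < N) (hindex : s.reg rIndex = k)
    (hanswer : s.arr aAnswer = A) (hinfty : s.reg rInfty = inftyValue A N)
    (hA : EntriesLE A N b) :
    WP E loadEntryProg s fun s' t => s' = s.setReg rEntry (finiteEntry A N k) ∧ t ≤ 15 := by
  refine .of_bounded fun hs => ?_
  have hinftyB := hs.1 rInfty
  have := E.eight_le
  have := hA.lt_inftyValue hk
  obtain ⟨hflag, hvalue, -⟩ := hA k hk
  rw [hinfty] at hinftyB
  refine .ite ?_ (fun hc => ?_) (fun hc => ?_)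
  · simp [hindex, hanswer]; omega
  · have hc' : A (2 * k) ≠ 0 := by simpa [hindex, hanswer] using hc
    refine .assign ?_ ?_ ?_
    · simp [hindex, hanswer]; omega
    · simp [hindex, hanswer]; omega
    · simp [hindex, hanswer, finiteEntry, hc']
  · have hc' : A (2 * k) = 0 := by simpa [hindex, hanswer] using hc
    refine .assign (by simp) (by simpa [hinfty] using hinftyB) ?_
    simp [hinfty, finiteEntry, hc']

theorem raiseMaxProg_wp :
    WP E raiseMaxProg s fun s' t =>
      s' = s.setReg rMax (max (s.reg rMax) (s.reg rEntry)) ∧ t ≤ 8 := by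
  refine .of_bounded fun hs => .ite_lt trivial trivial (fun hc => ?_) (fun hc => ?_)
  · exact .assign trivial (hs.1 rEntry)
      ⟨congrArg (s.setReg rMax) (max_eq_right hc.le).symm, by simp⟩
  · refine .skip ⟨?_, by simp⟩
    have hkeep : max (s.reg rMax) (s.reg rEntry) = s.reg rMax := max_eq_left hc
    rw [hkeep, State.setReg, Function.update_eq_self]

theorem maxProg_wp (hN : s.reg rEntries = N) (hinfty : s.reg rInfty = inftyValue A N)
    (hmax : s.reg rMax = 0) (hanswer : s.arr aAnswer = A) (hA : EntriesLE A N b) :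
    WP E maxProg s fun s' t => (∀ k < N, s'.arr aDist k = finiteEntry A N k) ∧
      s'.reg rMax = (Finset.range N).fold max 0 (finiteEntry A N) ∧ t ≤ 36 * N + 6 := by
  refine .forTo_le N 28 (fun k s => (∀ i < k, s.arr aDist i = finiteEntry A N i) ∧
      s.reg rMax = (Finset.range k).fold max 0 (finiteEntry A N)) hN (by decide)
    (by simpa using hmax) ?_ fun s' t hI _ _ ht => ⟨hI.1, hI.2, by omega⟩
  rintro k s' hk ⟨hdist, hmax⟩ hx hF
  have hinfty' : s'.reg rInfty = inftyValue A N := (hF.1 rInfty (by decide)).trans hinfty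
  have hanswer' : s'.arr aAnswer = A := (hF.2 aAnswer (by decide)).trans hanswer
  refine .seq ((loadEntryProg_wp hk hx hanswer' hinfty' hA).mono ?_)
  rintro _ t₁ - - ⟨rfl, ht₁⟩
  refine .seq (raiseMaxProg_wp.mono ?_)
  rintro _ t₂ hs - ⟨rfl, ht₂⟩
  refine .store (by simp) (by simp) (hs.1 rEntry) ⟨?_, ?_, ?_⟩
  · simp only [Expr.cost_reg]
    omega
  · intro i hi
    rcases Nat.lt_succ_iff_lt_or_eq.1 hi with hik | rfl
    · simp [hx, Function.update_of_ne (Nat.cast_injective.ne hik.ne), hdist i hik]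
    · simp [hx]
  · rw [Finset.range_add_one, Finset.fold_insert Finset.notMem_range_self, max_comm, ← hmax]
    simp

theorem markProg_wp {X : ℕ → ℤ} (hn : s.reg rVerts = n) (hN : s.reg rEntries = (n * n : ℕ))
    (hdist : ∀ k < n * n, s.arr aDist k = X k) (hmark : ∀ i, s.arr aMark i = 0) :
    WP E markProg s fun s' t =>
      (∀ u : ℕ, s'.arr aMark u ≠ 0 ↔ ∃ k < n * n, X k = s.reg rMax ∧ k / n = u) ∧
      t ≤ 20 * (n * n) + 6 := by
  refine .forTo_le (n * n) 12
    (fun k s' => ∀ u : ℕ, s'.arr aMark u ≠ 0 ↔ ∃ i < k, X i = s.reg rMax ∧ i / n = u) hN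
    (by decide) (by simp [hmark]) ?_ fun s' t hI _ _ ht => ⟨hI, by omega⟩
  intro k s' hk hI hx hF
  have hdist' : s'.arr aDist k = X k := (congrFun (hF.2 aDist (by decide)) k).trans (hdist k hk)
  have hn' : s'.reg rVerts = n := (hF.1 rVerts (by decide)).trans hn
  have hmax' : s'.reg rMax = s.reg rMax := hF.1 rMax (by decide)
  have := E.eight_le
  refine .ite (by simp) (fun hc => ?_) (fun hc => ?_)
  · have hkmax : X k ≠ s.reg rMax := by simpa [hx, hdist', hmax', sub_eq_zero] using hc
    refine .skip ⟨by simp, fun u => ?_⟩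
    simp only [State.arr_setReg, hI u, Nat.exists_lt_succ_right, hkmax, false_and, or_false]
  · have hkmax : X k = s.reg rMax := by simpa [hx, hdist', hmax', sub_eq_zero] using hc
    refine .store (by simp) (by simp) (by simp; omega) ⟨by simp, fun u => ?_⟩
    have hindex : s'.reg rIndex / s'.reg rVerts = (k / n : ℕ) := by rw [hx, hn']; push_cast; rfl
    simp only [State.arr_setReg, State.arr_setCell_same, Expr.eval_div, Expr.eval_reg, hindex,
      Nat.exists_lt_succ_right, hkmax, true_and, ← hI u]
    by_cases hu : k / n = u
    · simp only [hu, Function.update_self, Expr.eval_ofNat, or_true, iff_true]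
      exact one_ne_zero
    · simp only [hu, Function.update_of_ne (Nat.cast_injective.ne (Ne.symm hu)), or_false]

theorem findProg_wp (hn : s.reg rVerts = n) (hfound : s.reg rFound = -1) :
    WP E findProg s fun s' t =>
      ((∃ u < n, s'.reg rFound = (u : ℕ) ∧ s.arr aMark u = 0) ∨
        (s'.reg rFound = -1 ∧ ∀ u < n, s.arr aMark (u : ℕ) ≠ 0)) ∧ t ≤ 20 * n + 6 := by
  refine .forTo_le n 12 (fun k s' => (∃ u < k, s'.reg rFound = (u : ℕ) ∧ s.arr aMark u = 0) ∨
        (s'.reg rFound = -1 ∧ ∀ u < k, s.arr aMark (u : ℕ) ≠ 0)) hn (by decide)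
    (by simp [hfound]) ?_ fun s' t hI _ _ ht => ⟨hI, by omega⟩
  intro k s' _ hI hx hF
  have hmark : s'.arr aMark = s.arr aMark := hF.2 aMark (by decide)
  refine .of_bounded fun hs => .ite (by simp) (fun hc => ?_) (fun hc => ?_)
  · have hmarked : s.arr aMark k ≠ 0 := by simpa [hx, hmark] using hc
    refine .skip ⟨by simp, ?_⟩
    rcases hI with ⟨u, hu, hfound⟩ | ⟨hfound, hall⟩
    · exact .inl ⟨u, hu.trans (Nat.lt_succ_self k), by simpa using hfound⟩
    · exact .inr ⟨by simpa using hfound, Nat.forall_lt_succ_right.2 ⟨hall, hmarked⟩⟩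
  · have hunmarked : s.arr aMark k = 0 := by simpa [hx, hmark] using hc
    exact .assign (by simp) (hs.1 rIndex)
      ⟨by simp, .inl ⟨k, Nat.lt_succ_self k, by simp [hx], hunmarked⟩⟩

theorem diameterProg_wp (hn : s.reg rVerts = n) (hN : s.reg rEntries = (n * n : ℕ))
    (hanswer : s.arr aAnswer = A) (hmark : ∀ i, s.arr aMark i = 0)
    (hA : EntriesLE A (n * n) b) (hB : inftyValue A (n * n) ≤ E.B) :
    WP E diameterProg s fun s' t =>
      (∀ u : ℕ, s'.arr aMark u ≠ 0 ↔ ∃ k < n * n, finiteEntry A (n * n) k =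
        (Finset.range (n * n)).fold max 0 (finiteEntry A (n * n)) ∧ k / n = u) ∧
      t ≤ 73 * (n * n) + 22 := by
  have := E.eight_le
  refine .assign_seq (by simp) (by simp; omega) ?_
  refine .seq ((sumProg_wp (N := n * n) (by simpa using hN) (by simp) (by simpa using hanswer)
    hA hB).mono fun s₁ t₁ _ hF₁ ⟨hinfty, _⟩ => ?_)
  refine .assign_seq (by simp) (by simp) ?_
  have hN₁ : s₁.reg rEntries = (n * n : ℕ) := (hF₁.1 _ (by decide)).trans (by simpa using hN)
  have hanswer₁ : s₁.arr aAnswer = A := (hF₁.2 _ (by decide)).trans (by simpa using hanswer)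
  refine .seq ((maxProg_wp (N := n * n) (by simpa using hN₁) (by simpa using hinfty) (by simp)
    (by simpa using hanswer₁) hA).mono fun s₂ t₂ _ hF₂ ⟨hdist, hmax, _⟩ => ?_)
  have hF : diameterProg.Frame s s₂ :=
    (Prog.frame_setReg s rInfty 1 _).seq_left.trans <| Prog.Frame.seq_right <|
      hF₁.seq_left.trans <| Prog.Frame.seq_right <|
      (Prog.frame_setReg s₁ rMax 0 _).seq_left.trans hF₂.seq_left.seq_right
  have hN₂ : s₂.reg rEntries = (n * n : ℕ) := (hF.1 _ (by decide)).trans hN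
  have hmark₂ : ∀ i, s₂.arr aMark i = 0 := by
    have h₁ : s₁.arr aMark = s.arr aMark := hF₁.2 _ (by decide)
    have h₂ : s₂.arr aMark = s₁.arr aMark := hF₂.2 _ (by decide)
    simpa [h₂, h₁] using hmark
  refine (markProg_wp ((hF.1 _ (by decide)).trans hn) hN₂ hdist hmark₂).mono
    fun _ _ _ _ ⟨hmark₃, _⟩ => ⟨hmax ▸ hmark₃, ?_⟩
  simp only [Expr.cost_ofNat]
  omega

end CoDiameterProg

theorem State.start_bounded (B : ℕ) (a : ℤ → ℤ) : (State.start a).Bounded B := by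
  refine ⟨fun x => by simp [State.start], fun r h0 _ i => ?_⟩
  simp [State.start, Function.update_of_ne h0]

theorem coDiameterProg_wp {O : APSP.Inst → ℤ → ℤ} {T : ℕ → ℕ → ℕ} {W B : ℕ} (h8 : 8 ≤ B)
    (hW : B ^ 40 ≤ W) (hO : IsOracle APSP O) (G : WDigraph) (hG : G.NonnegWeights) {a : ℤ → ℤ}
    (ha : HoldsGraph a G) (hverts : G.n ≤ B) (hentries : G.n * G.n ≤ B)
    (hdist : 1 + G.n * G.n * (G.n * G.maxWeight) ≤ B) :
    WP ⟨APSP, O, T, W, B, h8, hW⟩ coDiameterProg (State.start a) fun s t =>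
      CoDiameter.Output ⟨G, hG⟩ (s.arr aOutput) ∧
        t ≤ T G.n G.maxWeight + 200 * (G.n + 1) * (G.n + 1) := by
  set x : APSP.Inst := ⟨G, hG.noNegCycle⟩
  obtain ⟨D, hD, hAD⟩ : ∃ D : Fin G.n → Fin G.n → WithTop ℤ,
    (∀ u v, G.IsDist u v (D u v)) ∧ HoldsMatrix (O x) 0 D := hO x
  have hA := entriesLE_of_isDist hG hD hAD
  have hinfty : inftyValue (O x) (G.n * G.n) ≤ B :=
    hA.inftyValue_le.trans (by exact_mod_cast hdist)
  refine .seq (.call x ha ?_)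
  set s₀ := (State.start a).setArr aAnswer (O x)
  have hinput : s₀.arr aInput 0 = G.n := ha.1
  refine .assign_seq (by simp [hinput]; omega) (by simp [hinput]; omega) ?_
  refine .assign_seq (by simp) (by simp [hinput]; norm_cast; omega) ?_
  refine .seq ((diameterProg_wp (n := G.n) (A := O x) (by simp [hinput]) (by simp [hinput])
    (by simp [s₀]) (by simp [s₀, State.start]) hA hinfty).mono
    fun s₁ t₁ _ hF₁ ⟨hmark, _⟩ => ?_)
  refine .assign_seq (by simp) (by simp; omega) ?_
  have hn₁ : s₁.reg rVerts = G.n := (hF₁.1 _ (by decide)).trans (by simp [hinput])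
  refine .seq ((findProg_wp (n := G.n) (by simp [hn₁]) (by simp)).mono
    fun s₂ t₂ hs₂ _ ⟨hfound, _⟩ => ?_)
  refine .store (by simp) (by simp) (hs₂.1 rFound) ⟨?_, ?_⟩
  · have hvert (u : Fin G.n) : G.IsDiameterVertex u ↔ s₁.arr aMark (u : ℕ) ≠ 0 := by
      rw [hmark, isDiameterVertex_iff_finiteEntry hG hD hAD]
    rcases hfound with ⟨u, hu, hfound, hunmarked⟩ | ⟨hfound, hall⟩
    · exact .inl ⟨⟨u, hu⟩, by simpa using hfound, fun h => (hvert _).1 h hunmarked⟩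
    · exact .inr ⟨by simpa using hfound, fun u => (hvert u).2 (hall u u.2)⟩
  · change 1 + T G.n G.maxWeight + _ ≤ _
    simp only [Expr.cost_cell, Expr.cost_ofNat, Expr.cost_mul, Expr.cost_reg, Expr.cost_const]
    nlinarith

theorem coDiameterProg_memory {c n M : ℕ} (hM : M ≤ (n + 2) ^ c) :
    8 ≤ (n + 2) ^ (c + 4) ∧ n ≤ (n + 2) ^ (c + 4) ∧ n * n ≤ (n + 2) ^ (c + 4) ∧
      1 + n * n * (n * M) ≤ (n + 2) ^ (c + 4) := by
  have hc : 1 ≤ (n + 2) ^ c := Nat.one_le_pow _ _ (by omega)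
  have h4 : (n + 2) ^ 4 ≤ (n + 2) ^ (c + 4) := Nat.pow_le_pow_right (by omega) (by omega)
  have h16 : 16 ≤ (n + 2) ^ 4 := Nat.pow_le_pow_left (by omega : 2 ≤ n + 2) 4
  have hsq : n * n ≤ (n + 2) ^ 4 := by nlinarith [Nat.zero_le (n * n * n)]
  have hcube : 1 + n * n * n ≤ (n + 2) ^ 4 := by
    nlinarith [Nat.zero_le (n * n * n), Nat.zero_le (n * n * n * n)]
  refine ⟨by omega, (Nat.le_mul_self n).trans (by omega), by omega, ?_⟩
  calc 1 + n * n * (n * M) = 1 + M * (n * n * n) := by ring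
    _ ≤ (n + 2) ^ c + (n + 2) ^ c * (n * n * n) := Nat.add_le_add hc (Nat.mul_le_mul_right _ hM)
    _ = (n + 2) ^ c * (1 + n * n * n) := by ring
    _ ≤ (n + 2) ^ c * (n + 2) ^ 4 := Nat.mul_le_mul_left _ hcube
    _ = (n + 2) ^ (c + 4) := (pow_add _ _ _).symm

theorem sq_le_rpow {x p : ℝ} (hx : 1 ≤ x) (hp : 2 ≤ p) : x ^ 2 ≤ x ^ p := by
  rw [← Real.rpow_two]
  exact Real.rpow_le_rpow_of_exponent_le hx hp

theorem add_quadratic_le_rpow {x t C ε K : ℝ} (hx : 1 ≤ x) (hK : 0 ≤ K)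
    (ht : t ≤ C * x ^ (3 - ε)) : t + K * x ^ 2 ≤ (|C| + K) * x ^ (3 - min ε 1) := by
  have hC : C * x ^ (3 - ε) ≤ |C| * x ^ (3 - min ε 1) :=
    mul_le_mul (le_abs_self C) (Real.rpow_le_rpow_of_exponent_le hx (by linarith [min_le_left ε 1]))
      (by positivity) (abs_nonneg C)
  have hsq : x ^ 2 ≤ x ^ (3 - min ε 1) := sq_le_rpow hx (by linarith [min_le_right ε 1])
  nlinarith

theorem coDiameter_reducible_APSP : SubcubicReducible CoDiameter APSP := by
  refine ⟨coDiameterProg, fun c => ⟨(c + 4) * 40, fun T hT => ?_⟩⟩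
  obtain ⟨ε, hε, C, hC⟩ := hT c
  refine ⟨min ε 1, by positivity, |C| + 200, ?_⟩
  rintro O hO ⟨G, hG⟩ hweight a ha
  obtain ⟨h8, hverts, hentries, hdist⟩ := coDiameterProg_memory hweight
  obtain ⟨s, t, hexec, -, -, houtput, ht⟩ := coDiameterProg_wp (T := T) h8 (pow_mul _ _ _).ge hO G
    hG ha hverts hentries hdist (State.start_bounded _ a)
  refine ⟨s, t, hexec, houtput, ?_⟩
  calc (t : ℝ) ≤ T G.n G.maxWeight + 200 * ((G.n : ℝ) + 1) ^ 2 := by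
        rw [sq, ← mul_assoc]; exact_mod_cast ht
    _ ≤ (|C| + 200) * ((G.n : ℝ) + 1) ^ (3 - min ε 1) :=
        add_quadratic_le_rpow (by linarith [G.n.cast_nonneg (α := ℝ)]) (by norm_num)
          (hC G.n G.maxWeight hweight)

/-! ### Blocks of matrices -/

theorem rowMajor_inj {n i j i' j' : ℕ} (hj : j < n) (hj' : j' < n)
    (h : i * n + j = i' * n + j') : i = i' ∧ j = j' := by
  obtain rfl : i = i' := by rw [← rowMajor_div (i := i) hj, h, rowMajor_div hj']
  exact ⟨rfl, by omega⟩

/-- The entry `(i, j)` of the matrix that is stored in the array `a` in row-major order, with rows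
of length `m`. In contrast to `HoldsMatrix`, an entry takes one cell. -/
def mat (a : ℤ → ℤ) (m i j : ℤ) : ℤ := a (i * m + j)

/-- The array `u` holds an `m × m` matrix of estimates that exceed the entries of `C`. -/
def Above (m : ℕ) (C : ℕ → ℕ → ℤ) (u : ℤ → ℤ) : Prop :=
  ∀ i j : ℕ, i < m → j < m → C i j < mat u m i j

/-- The estimates `u'` for the `m × m` matrix `C` result from `u` by lowering, by at least `d` in
total, and still exceed `C`. -/
structure Refines (m : ℕ) (C : ℕ → ℕ → ℤ) (d : ℤ) (u u' : ℤ → ℤ) : Prop where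
  le : ∀ c, u' c ≤ u c
  above : Above m C u'
  sum_add_le : ∑ c ∈ Finset.range (m * m), u' c + d ≤ ∑ c ∈ Finset.range (m * m), u c

namespace Refines

variable {m : ℕ} {C : ℕ → ℕ → ℤ} {d d' : ℤ} {u u' u'' : ℤ → ℤ}

theorem refl (h : Above m C u) : Refines m C 0 u u :=
  ⟨fun _ => le_rfl, h, (add_zero _).le⟩

theorem trans (h : Refines m C d u u') (h' : Refines m C d' u' u'') :
    Refines m C (d + d') u u'' :=
  ⟨fun c => (h'.le c).trans (h.le c), h'.above, by linarith [h.sum_add_le, h'.sum_add_le]⟩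

theorem of_step (hd : 0 ≤ d) {c : ℕ} (hc : c < m * m) (hstep : ∀ c, u' c = u c ∨ u' c ≤ u c - d)
    (hdec : u' c ≤ u c - d) (habove : Above m C u') : Refines m C d u u' := by
  have hle : ∀ i ∈ Finset.range (m * m), u' i + (if i = c then d else 0) ≤ u i := by
    intro i _
    split_ifs with hi
    · subst hi; omega
    · rcases hstep i with h | h <;> omega
  refine ⟨fun i => by rcases hstep i with h | h <;> omega, habove, ?_⟩
  have := Finset.sum_le_sum hle
  rwa [Finset.sum_add_distrib, Finset.sum_ite_eq', if_pos (by simpa using hc)] at this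

theorem potential_lt (h : Refines m C d u u') (hd : 0 < d) {L : ℤ} (hL : ∀ c, -L ≤ u' c) :
    (∑ c ∈ Finset.range (m * m), (u' c + L)).toNat <
      (∑ c ∈ Finset.range (m * m), (u c + L)).toNat := by
  have hnonneg : 0 ≤ ∑ c ∈ Finset.range (m * m), (u' c + L) :=
    Finset.sum_nonneg fun c _ => by have := hL c; omega
  have := h.sum_add_le
  rw [Finset.sum_add_distrib] at hnonneg ⊢
  rw [Finset.sum_add_distrib]
  omega

end Refines

/-- A choice of three blocks of matrices of order `side ^ 3`, of size `side × side` each, for the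
products of the rows from `row` on with the columns from `col` on, restricted to the summands from
`mid` on. The entries of the matrix are at most `bound` in absolute value, and the estimates for its
square are tested up to an error of `scale`. -/
structure Block where
  side : ℕ
  bound : ℤ
  scale : ℤ
  row : ℕ
  col : ℕ
  mid : ℕ

namespace Block

variable (b : Block) (a u : ℤ → ℤ)

/-- The order of the matrices from which the blocks are taken. -/
def order : ℕ := b.side ^ 3

/-- The block of the left factor. -/
def left (x z : ℤ) : ℤ := mat a b.order (b.row + x) (b.mid + z)

/-- The block of the right factor. -/
def right (z y : ℤ) : ℤ := mat a b.order (b.mid + z) (b.col + y)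

/-- The block of the estimates, with the error subtracted. -/
def base (x y : ℤ) : ℤ := mat u b.order (b.row + x) (b.col + y) - b.scale

/-- The weights of the triangle graph of the blocks. -/
def weight (x y : ℤ) : ℤ :=
  triangleWeight b.side (4 * b.bound) (b.left a) (b.right a) (b.base u) x y

/-- The triangle graph of the blocks. -/
def graph : WDigraph := triangleGraph b.side (4 * b.bound) (b.left a) (b.right a) (b.base u)

/-- The blocks do not show that some estimate can be lowered by `scale`. -/
def NoNegTriangle : Prop :=
  ∀ x y z : ℕ, x < b.side → y < b.side → z < b.side →
    b.base u x y ≤ b.left a x z + b.right a z y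

/-- The array `u` with the estimate for the entry `(x, y)` of the block lowered by `scale` if the
summand `z` shows that it is still too large then. -/
def lower (x y z : ℤ) : ℤ → ℤ :=
  if b.left a x z + b.right a z y < b.base u x y then
    Function.update u ((b.row + x) * b.order + (b.col + y)) (b.base u x y)
  else u

/-- The conditions under which the triangle graph of the blocks has the intended meaning. -/
structure Bounds : Prop where
  side_pos : 0 < b.side
  bound_pos : 0 < b.bound
  scale_pos : 0 < b.scale
  scale_le : b.scale ≤ b.bound
  row_le : b.row + b.side ≤ b.order
  col_le : b.col + b.side ≤ b.order
  mid_le : b.mid + b.side ≤ b.order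
  matrix : ∀ c, -b.bound ≤ a c ∧ a c ≤ b.bound
  estimate : ∀ c, -(2 * b.bound) ≤ u c ∧ u c ≤ b.bound

variable {b a u}

theorem Bounds.triangleBounds (hb : b.Bounds a u) :
    TriangleBounds b.side (4 * b.bound) (b.left a) (b.right a) (b.base u) := by
  have := hb.bound_pos
  have := hb.scale_pos
  have := hb.scale_le
  refine ⟨fun x z _ _ _ _ => ?_, fun z y _ _ _ _ => ?_, fun x y _ _ _ _ => ?_⟩
  · have := hb.matrix ((b.row + x) * b.order + (b.mid + z))
    simp only [left, mat]
    omega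
  · have := hb.matrix ((b.mid + z) * b.order + (b.col + y))
    simp only [right, mat]
    omega
  · have := hb.estimate ((b.row + x) * b.order + (b.col + y))
    simp only [base, mat]
    omega

theorem Bounds.weight_mem (hb : b.Bounds a u) {x : ℤ} (hx : 0 ≤ x) (y : ℤ) :
    1 ≤ b.weight a u x y ∧ b.weight a u x y ≤ 12 * b.bound := by
  have := hb.triangleBounds.weight_mem hb.side_pos (y := y) hx
  rw [weight]
  omega

theorem Bounds.lower (hb : b.Bounds a u) (x y z : ℤ) : b.Bounds a (b.lower a u x y z) := by
  refine { hb with estimate := fun c => ?_ }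
  have := hb.scale_pos
  have := hb.estimate ((b.row + x) * b.order + (b.col + y))
  have := hb.matrix ((b.row + x) * b.order + (b.mid + z))
  have := hb.matrix ((b.mid + z) * b.order + (b.col + y))
  rw [Block.lower]
  split_ifs with hlt
  · simp only [left, right, base, mat] at hlt ⊢
    rw [Function.update_apply]
    split_ifs
    · omega
    · exact hb.estimate c
  · exact hb.estimate c

theorem NoNegTriangle.mono {u' : ℤ → ℤ} (h : b.NoNegTriangle a u) (hle : ∀ c, u' c ≤ u c) :
    b.NoNegTriangle a u' :=
  fun x y z hx hy hz => (sub_le_sub_right (hle _) _).trans (h x y z hx hy hz)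

variable (b a u) in
/-- The array `u'` results from `u` by `lower` in row `x`, for the first `k` pairs `(y, z)`. -/
structure RowUpdate (x k : ℕ) (u' : ℤ → ℤ) : Prop where
  step : ∀ c, u' c = u c ∨ u' c ≤ u c - b.scale
  reason : ∀ c, u' c ≠ u c → ∃ y < b.side, ∃ z < b.side,
    c = (b.row + x) * b.order + (b.col + y) ∧ b.left a x z + b.right a z y < u' c
  found : ∀ y z : ℕ, y < b.side → z < b.side → y * b.side + z < k →
    b.left a x z + b.right a z y < b.base u x y →
    mat u' b.order (b.row + x) (b.col + y) ≤ b.base u x y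

namespace RowUpdate

variable {x k : ℕ} {u' : ℤ → ℤ}

theorem zero : b.RowUpdate a u x 0 u :=
  ⟨fun _ => .inl rfl, fun _ hc => absurd rfl hc, fun _ _ _ _ h => absurd h (Nat.not_lt_zero _)⟩

theorem succ (hu : b.RowUpdate a u x k u') (hscale : 0 < b.scale) {y z : ℕ} (hy : y < b.side)
    (hz : z < b.side) (hk : k = y * b.side + z) :
    b.RowUpdate a u x (k + 1) (b.lower a u' x y z) := by
  obtain ⟨c₀, hc₀⟩ : ∃ c₀, c₀ = (b.row + x : ℤ) * b.order + (b.col + y) := ⟨_, rfl⟩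
  have hbase : b.base u' x y = u' c₀ - b.scale := by rw [hc₀, base, mat]
  have hbase₀ : b.base u x y = u c₀ - b.scale := by rw [hc₀, base, mat]
  have hc₀' := hu.step c₀
  have hpair {y' z' : ℕ} (hz' : z' < b.side) (hlt : y' * b.side + z' < k + 1) :
      y' * b.side + z' < k ∨ y' = y ∧ z' = z :=
    (Nat.lt_succ_iff_lt_or_eq.1 hlt).imp_right fun h => rowMajor_inj hz' hz (h.trans hk)
  rw [lower, ← hc₀]
  split_ifs with hlt
  · refine ⟨fun c => ?_, fun c hc => ?_, fun y' z' hy' hz' hk' hlt' => ?_⟩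
    · rcases eq_or_ne c c₀ with rfl | hne
      · rw [Function.update_self]; omega
      · rw [Function.update_of_ne hne]; exact hu.step c
    · rcases eq_or_ne c c₀ with rfl | hne
      · rw [Function.update_self]; exact ⟨y, hy, z, hz, hc₀, hlt⟩
      · rw [Function.update_of_ne hne] at hc ⊢; exact hu.reason c hc
    · by_cases hyy : y' = y
      · rw [mat, hyy, ← hc₀, Function.update_self]; omega
      · have hne : (b.row + x : ℤ) * b.order + (b.col + y') ≠ c₀ := by omega
        rw [mat, Function.update_of_ne hne]
        exact hu.found y' z' hy' hz' ((hpair hz' hk').resolve_right fun h => hyy h.1) hlt'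
  · refine ⟨hu.step, hu.reason, fun y' z' hy' hz' hk' hlt' => ?_⟩
    rcases hpair hz' hk' with hk' | ⟨rfl, rfl⟩
    · exact hu.found y' z' hy' hz' hk' hlt'
    · rw [mat, ← hc₀]; omega

theorem above (hu : b.RowUpdate a u x k u') (hb : b.Bounds a u) {C : ℕ → ℕ → ℤ}
    (hC : IsMinPlusSq b.order (fun i j => mat a b.order i j) C) (habove : Above b.order C u) :
    Above b.order C u' := by
  intro i j hi hj
  by_cases heq : u' (i * b.order + j) = u (i * b.order + j)
  · rw [mat, heq]
    exact habove i j hi hj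
  · obtain ⟨y, hy, z, hz, hc, hlt⟩ := hu.reason _ heq
    have hcol := hb.col_le
    have hmid := hb.mid_le
    obtain ⟨rfl, rfl⟩ : i = b.row + x ∧ j = b.col + y :=
      rowMajor_inj hj (by omega) (by exact_mod_cast hc)
    have hsum := (hC _ _ hi hj).1 (b.mid + z) (by omega)
    push_cast at hsum hlt
    exact hsum.trans_lt hlt

theorem refines (hu : b.RowUpdate a u x (b.side * b.side) u') (hb : b.Bounds a u)
    (hx : x < b.side) {C : ℕ → ℕ → ℤ}
    (hC : IsMinPlusSq b.order (fun i j => mat a b.order i j) C) (habove : Above b.order C u)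
    (hneg : ∃ y z : ℕ, y < b.side ∧ z < b.side ∧
      b.left a x z + b.right a z y < b.base u x y) :
    Refines b.order C b.scale u u' := by
  obtain ⟨y, z, hy, hz, hlt⟩ := hneg
  have hrow := hb.row_le
  have hcol := hb.col_le
  refine .of_step hb.scale_pos.le (c := (b.row + x) * b.order + (b.col + y))
    (rowMajor_lt (by omega) (by omega)) hu.step ?_ (hu.above hb hC habove)
  have hdec := hu.found y z hy hz (rowMajor_lt hy hz) hlt
  simp only [mat, base] at hdec
  exact_mod_cast hdec

end RowUpdate

end Block

/-- The array `g` holds, in the format of `HoldsGraph`, the first `k` of the weights `w` of the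
edges between `n` vertices. -/
def HoldsEdges (g : ℤ → ℤ) (n k : ℕ) (w : ℤ → ℤ → ℤ) : Prop :=
  ∀ x y : ℕ, x < n → y < n → x * n + y < k →
    g (2 * ((x * n + y : ℕ) : ℤ) + 1) = 1 ∧ g (2 * ((x * n + y : ℕ) : ℤ) + 2) = w x y

theorem HoldsEdges.succ {g : ℤ → ℤ} {n k : ℕ} {w : ℤ → ℤ → ℤ} (hg : HoldsEdges g n k w) {x y : ℕ}
    (hy : y < n) (hk : x * n + y = k) :
    HoldsEdges (Function.update (Function.update g (2 * k + 1) 1) (2 * k + 2) (w x y))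
      n (k + 1) w := by
  intro x' y' hx' hy' hlt
  rcases Nat.lt_succ_iff_lt_or_eq.1 hlt with hlt | heq
  · have hg' := hg x' y' hx' hy' hlt
    generalize x' * n + y' = l at *
    iterate 4 rw [Function.update_of_ne (by omega)]
    exact hg'
  · obtain ⟨rfl, rfl⟩ := rowMajor_inj hy' hy (heq.trans hk.symm)
    rw [heq, Function.update_of_ne (by omega), Function.update_self, Function.update_self]
    exact ⟨rfl, rfl⟩

theorem HoldsEdges.holdsGraph {b : Block} {a u g : ℤ → ℤ} {n : ℕ} (hn : n = 4 * b.side + 1)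
    (h0 : g 0 = n) (hg : HoldsEdges g n (n * n) (b.weight a u)) : HoldsGraph g (b.graph a u) := by
  subst hn
  refine ⟨h0, fun x y => ?_⟩
  have hg' := hg x y x.2 y.2 (rowMajor_lt x.2 y.2)
  have hw : (b.graph a u).w x y = (b.weight a u (x : ℕ) (y : ℕ) : WithTop ℤ) := rfl
  have hcell : (1 + 2 * ((x : ℕ) * ((b.graph a u).n : ℕ) + (y : ℕ)) : ℤ) =
      2 * (((x : ℕ) * (4 * b.side + 1) + (y : ℕ) : ℕ) : ℤ) + 1 := by
    have hn : ((b.graph a u).n : ℤ) = (4 * b.side + 1 : ℕ) := rfl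
    rw [hn]
    push_cast
    ring
  rw [hw, if_neg WithTop.coe_ne_top, WithTop.untopD_coe, hcell, add_assoc, one_add_one_eq_two]
  exact hg'

local notation "rSide" => (1 : ℕ)
local notation "rOrder" => (2 : ℕ)
local notation "rCells" => (3 : ℕ)
local notation "rScale" => (9 : ℕ)
local notation "rGraphVerts" => (10 : ℕ)
local notation "rGraphCells" => (11 : ℕ)
local notation "rEdgeBase" => (12 : ℕ)
local notation "rSideSq" => (13 : ℕ)
local notation "rBlockIndex" => (23 : ℕ)
local notation "rEdgeIndex" => (24 : ℕ)
local notation "rPairIndex" => (25 : ℕ)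
local notation "rRow" => (26 : ℕ)
local notation "rCol" => (27 : ℕ)
local notation "rMid" => (28 : ℕ)
local notation "rFst" => (29 : ℕ)
local notation "rSnd" => (30 : ℕ)
local notation "rWeight" => (31 : ℕ)
local notation "rSearching" => (32 : ℕ)
local notation "rFoundRow" => (33 : ℕ)
local notation "aGraph" => (2 : ℕ)
local notation "aMatrix" => (4 : ℕ)
local notation "aEstimate" => (5 : ℕ)
local notation "rBound" => (6 : ℕ)
local notation "rPhases" => (7 : ℕ)
local notation "rPhase" => (21 : ℕ)
local notation "rCellIndex" => (22 : ℕ)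
local notation "rRowCol" => (34 : ℕ)

/-! ### Covering a matrix by blocks -/

/-- The block for the products of the `p`-th group of rows with the `q`-th group of columns,
restricted to the `r`-th group of summands. -/
def blockAt (σ : ℕ) (R h : ℤ) (p q r : ℕ) : Block := ⟨σ, R, h, p * σ, q * σ, r * σ⟩

/-- The position of a block among the `g ^ 3` blocks. -/
def searchIndex (g p q r : ℕ) : ℕ := (p * g + q) * g + r

theorem exists_searchIndex {g k : ℕ} (hk : k < g * g * g) :
    ∃ p q r, p < g ∧ q < g ∧ r < g ∧ searchIndex g p q r = k := by
  have hg : 0 < g := Nat.pos_of_ne_zero (by rintro rfl; simp at hk)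
  have hquot : k / g < g * g := Nat.div_lt_of_lt_mul (by linarith)
  refine ⟨k / g / g, k / g % g, k % g, Nat.div_lt_of_lt_mul hquot, Nat.mod_lt _ hg,
    Nat.mod_lt _ hg, ?_⟩
  rw [searchIndex, Nat.div_add_mod', Nat.div_add_mod']

theorem searchIndex_lt {g p q r : ℕ} (hp : p < g) (hq : q < g) (hr : r < g) :
    searchIndex g p q r < g * g * g :=
  rowMajor_lt (rowMajor_lt hp hq) hr

theorem searchIndex_inj {g p q r p' q' r' : ℕ} (hq : q < g) (hr : r < g) (hq' : q' < g)
    (hr' : r' < g) (h : searchIndex g p q r = searchIndex g p' q' r') :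
    p = p' ∧ q = q' ∧ r = r' := by
  obtain ⟨hpq, hr⟩ := rowMajor_inj hr hr' h
  obtain ⟨hp, hq⟩ := rowMajor_inj hq hq' hpq
  exact ⟨hp, hq, hr⟩

theorem add_le_pow_three {σ p : ℕ} (hp : p < σ * σ) : p * σ + σ ≤ σ ^ 3 := by
  rw [← Nat.succ_mul, pow_three']
  exact Nat.mul_le_mul_right σ hp

theorem le_add_of_noNegTriangle {σ : ℕ} {R h : ℤ} {C : ℕ → ℕ → ℤ} {a u : ℤ → ℤ}
    (hC : IsMinPlusSq (σ ^ 3) (fun i j => mat a (σ ^ 3 : ℕ) i j) C)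
    (hblocks : ∀ p q r : ℕ, p < σ * σ → q < σ * σ → r < σ * σ →
      (blockAt σ R h p q r).NoNegTriangle a u)
    {i j : ℕ} (hi : i < σ ^ 3) (hj : j < σ ^ 3) : mat u (σ ^ 3 : ℕ) i j ≤ C i j + h := by
  obtain ⟨k, hk, hCk⟩ := (hC i j hi hj).2
  have hσ : 0 < σ := Nat.pos_of_ne_zero (by rintro rfl; simp at hi)
  have hdiv : ∀ {w : ℕ}, w < σ ^ 3 → w / σ < σ * σ := fun hw =>
    Nat.div_lt_of_lt_mul (by rwa [pow_three] at hw)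
  have hcast : ∀ w : ℕ, ((w / σ * σ : ℕ) : ℤ) + (w % σ : ℕ) = w := fun w => by
    exact_mod_cast Nat.div_add_mod' w σ
  have hle := hblocks _ _ _ (hdiv hi) (hdiv hj) (hdiv hk) (i % σ) (j % σ) (k % σ)
    (Nat.mod_lt _ hσ) (Nat.mod_lt _ hσ) (Nat.mod_lt _ hσ)
  simp only [Block.base, Block.left, Block.right, Block.order, blockAt, hcast] at hle
  rw [hCk]
  exact sub_le_iff_le_add.1 hle

theorem Refines.count_le {m f : ℕ} {C : ℕ → ℕ → ℤ} {h : ℤ} {u u' : ℤ → ℤ}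
    (hrefines : Refines m C (h * f) u u') (hh : 0 < h)
    (hu : ∀ i j : ℕ, i < m → j < m → mat u m i j ≤ C i j + 2 * h) : f ≤ 2 * (m * m) := by
  have hdrop : ∀ c ∈ Finset.range (m * m), u c ≤ u' c + 2 * h := by
    intro c hc
    obtain ⟨i, j, rfl, -⟩ := exists_rowMajor (Finset.mem_range.1 hc)
    have := hu i j i.2 j.2
    have := hrefines.above i j i.2 j.2
    simp only [mat] at *
    push_cast
    omega
  have hsum := hrefines.sum_add_le.trans (Finset.sum_le_sum hdrop)
  rw [Finset.sum_add_distrib, Finset.sum_const, Finset.card_range, nsmul_eq_mul,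
    add_le_add_iff_left, mul_comm, ← mul_assoc] at hsum
  have := le_of_mul_le_mul_right hsum hh
  push_cast at this
  zify
  linarith

/-! ### Searching a block for negative triangles -/

def firstGroupProg : Prog :=
  .ite (.lt (reg rSnd) (reg rSide)) (.assign rWeight (3 * reg rEdgeBase - 1)) <|
  .ite (.lt (reg rSnd) (2 * reg rSide))
    (.assign rWeight (reg rEdgeBase + cell aMatrix
      ((reg rRow + reg rFst) * reg rOrder + (reg rMid + (reg rSnd - reg rSide))))) <|
  .ite (reg rSnd - (reg rFst + 3 * reg rSide)) (.assign rWeight (3 * reg rEdgeBase - 1))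
    (.assign rWeight (3 * reg rEdgeBase))

def secondGroupProg : Prog :=
  .ite (.lt (reg rSnd) (2 * reg rSide)) (.assign rWeight (3 * reg rEdgeBase)) <|
  .ite (.lt (reg rSnd) (3 * reg rSide))
    (.assign rWeight (reg rEdgeBase + cell aMatrix
      ((reg rMid + (reg rFst - reg rSide)) * reg rOrder +
        (reg rCol + (reg rSnd - 2 * reg rSide)))))
    (.assign rWeight (3 * reg rEdgeBase))

def thirdGroupProg : Prog :=
  .ite (.lt (reg rSnd) (3 * reg rSide)) (.assign rWeight (3 * reg rEdgeBase)) <|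
  .ite (.lt (reg rSnd) (4 * reg rSide))
    (.assign rWeight (reg rEdgeBase - (cell aEstimate
      ((reg rRow + (reg rSnd - 3 * reg rSide)) * reg rOrder +
        (reg rCol + (reg rFst - 2 * reg rSide))) - reg rScale)))
    (.assign rWeight (3 * reg rEdgeBase))

/-- Compute the weight of the edge from `rFst` to `rSnd` in the triangle graph. -/
def weightProg : Prog :=
  .ite (.lt (reg rFst) (reg rSide)) firstGroupProg <|
  .ite (.lt (reg rFst) (2 * reg rSide)) secondGroupProg <|
  .ite (.lt (reg rFst) (3 * reg rSide)) thirdGroupProg (.assign rWeight (3 * reg rEdgeBase))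

def edgeProg : Prog :=
  .divMod rFst rSnd rEdgeIndex rGraphVerts <|
  .seq weightProg <|
  .seq (.store aGraph (2 * reg rEdgeIndex + 1) 1)
    (.store aGraph (2 * reg rEdgeIndex + 2) (reg rWeight))

/-- Store the triangle graph of the block in the array `aGraph`. -/
def buildProg : Prog :=
  .seq (.store aGraph 0 (reg rGraphVerts)) <| .forTo rEdgeIndex rGraphCells edgeProg

def lowerProg : Prog :=
  .divMod rFst rSnd rPairIndex rSide <|
  .seq (.assign rWeight
    (cell aEstimate (reg rFoundRow * reg rOrder + (reg rCol + reg rFst)) - reg rScale)) <|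
  .ite (.lt (cell aMatrix (reg rFoundRow * reg rOrder + (reg rMid + reg rSnd)) +
      cell aMatrix ((reg rMid + reg rSnd) * reg rOrder + (reg rCol + reg rFst))) (reg rWeight))
    (.store aEstimate (reg rFoundRow * reg rOrder + (reg rCol + reg rFst)) (reg rWeight)) .skip

/-- Lower the estimates in the row `rFoundRow` that the block shows to be too large. -/
def rowProg : Prog := .forTo rPairIndex rSideSq lowerProg

/-- The registers that hold the sizes. -/
structure Sizes (σ : ℕ) (R : ℤ) (s : State) : Prop where
  side : s.reg rSide = σ
  order : s.reg rOrder = (σ ^ 3 : ℕ)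
  cells : s.reg rCells = (σ ^ 3 * σ ^ 3 : ℕ)
  graphVerts : s.reg rGraphVerts = (4 * σ + 1 : ℕ)
  graphCells : s.reg rGraphCells = ((4 * σ + 1) * (4 * σ + 1) : ℕ)
  edgeBase : s.reg rEdgeBase = 4 * R
  sideSq : s.reg rSideSq = (σ * σ : ℕ)

abbrev sizeRegs : List ℕ :=
  [rSide, rOrder, rCells, rGraphVerts, rGraphCells, rEdgeBase, rSideSq]

theorem Sizes.congr {σ : ℕ} {R : ℤ} {s s' : State} (h : Sizes σ R s)
    (h' : ∀ x ∈ sizeRegs, s'.reg x = s.reg x) : Sizes σ R s' := by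
  simp only [List.mem_cons, List.not_mem_nil, or_false, forall_eq_or_imp, forall_eq] at h'
  obtain ⟨h1, h2, h3, h4, h5, h6, h7⟩ := h'
  exact ⟨h1 ▸ h.side, h2 ▸ h.order, h3 ▸ h.cells, h4 ▸ h.graphVerts, h5 ▸ h.graphCells,
    h6 ▸ h.edgeBase, h7 ▸ h.sideSq⟩

/-- The memory holds the block, the matrix and the estimates. -/
structure Block.Loaded (b : Block) (E : Env) (s : State) : Prop where
  sizes : Sizes b.side b.bound s
  scale : s.reg rScale = b.scale
  row : s.reg rRow = b.row
  col : s.reg rCol = b.col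
  mid : s.reg rMid = b.mid
  bounds : b.Bounds (s.arr aMatrix) (s.arr aEstimate)
  bound_le : 12 * b.bound ≤ E.B
  cells_le : (4 * b.side + 1) * (4 * b.side + 1) ≤ E.B

abbrev blockRegs : List ℕ := [rScale, rRow, rCol, rMid] ++ sizeRegs

section BlockProg

variable {E : Env} {s s' : State} {b : Block} {x y : ℤ}

theorem Block.Loaded.congr (hb : b.Loaded E s) (hregs : ∀ x ∈ blockRegs, s'.reg x = s.reg x)
    (hbounds : b.Bounds (s'.arr aMatrix) (s'.arr aEstimate)) : b.Loaded E s' where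
  sizes := hb.sizes.congr fun x hx => hregs x (List.mem_append_right _ hx)
  scale := (hregs rScale (by simp)).trans hb.scale
  row := (hregs rRow (by simp)).trans hb.row
  col := (hregs rCol (by simp)).trans hb.col
  mid := (hregs rMid (by simp)).trans hb.mid
  bounds := hbounds
  bound_le := hb.bound_le
  cells_le := hb.cells_le

theorem Block.Loaded.of_frame {p : Prog} (hb : b.Loaded E s) (hF : p.Frame s s')
    (hregs : ∀ x ∈ blockRegs, x ∉ p.regs)
    (hbounds : b.Bounds (s'.arr aMatrix) (s'.arr aEstimate)) : b.Loaded E s' :=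
  hb.congr (fun x hx => hF.1 x (hregs x hx)) hbounds

theorem Block.Loaded.assign_weight (hb : b.Loaded E s) (hx : 0 ≤ x) {e : Expr}
    (he : e.Safe E.B s)
    (hv : e.eval s = b.weight (s.arr aMatrix) (s.arr aEstimate) x y) (hcost : e.cost ≤ 22)
    (hd : e.deg ≤ 40 := by decide) :
    WP E (.assign rWeight e) s fun s' t =>
      s' = s.setReg rWeight (b.weight (s.arr aMatrix) (s.arr aEstimate) x y) ∧ t ≤ 23 := by
  have := hb.bound_le
  have := hb.bounds.weight_mem hx y
  exact .assign he (by omega) ⟨by rw [hv], by omega⟩ hd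

theorem firstGroupProg_wp (hb : b.Loaded E s) (hfst : s.reg rFst = x) (hsnd : s.reg rSnd = y)
    (hx : 0 ≤ x) (hx' : x < b.side) :
    WP E firstGroupProg s fun s' t =>
      s' = s.setReg rWeight (b.weight (s.arr aMatrix) (s.arr aEstimate) x y) ∧ t ≤ 42 := by
  have hσ := hb.sizes.side
  have hK := hb.sizes.edgeBase
  refine .ite_lt (by simp) (by simp) (fun hc => ?_) fun hc => .ite_lt (by simp) (by simp)
    (fun hc' => ?_) fun hc' => .ite (by simp) (fun hc'' => ?_) fun hc'' => ?_
  · have hy : y < b.side := by simpa [hsnd, hσ] using hc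
    refine (hb.assign_weight (y := y) hx (by simp) ?_ (by simp)).mono
      fun _ _ _ _ h => ⟨h.1, by simp; omega⟩
    rw [Block.weight, triangleWeight, if_pos hx', if_pos hy]
    simp [hK]
  · have hy : b.side ≤ y := by simpa [hsnd, hσ] using hc
    have hy' : y < 2 * b.side := by simpa [hsnd, hσ] using hc'
    refine (hb.assign_weight (y := y) hx (by simp) ?_ (by simp)).mono
      fun _ _ _ _ h => ⟨h.1, by simp; omega⟩
    rw [Block.weight, triangleWeight_first_second hx' hy hy']
    simp [hK, hσ, hfst, hsnd, hb.row, hb.mid, hb.sizes.order, Block.left, Block.order, mat]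
  · have hy : 2 * b.side ≤ y := by simpa [hsnd, hσ] using hc'
    have hy' : y ≠ x + 3 * b.side := by simpa [hfst, hsnd, hσ, sub_eq_zero] using hc''
    refine (hb.assign_weight (y := y) hx (by simp) ?_ (by simp)).mono
      fun _ _ _ _ h => ⟨h.1, by simp; omega⟩
    rw [Block.weight, triangleWeight, if_pos hx', if_neg (by omega), if_neg (by omega),
      if_neg hy']
    simp [hK]
  · have hy : 2 * b.side ≤ y := by simpa [hsnd, hσ] using hc'
    have hy' : y = x + 3 * b.side := by simpa [hfst, hsnd, hσ, sub_eq_zero] using hc''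
    refine (hb.assign_weight (y := y) hx (by simp) ?_ (by simp)).mono
      fun _ _ _ _ h => ⟨h.1, by simp; omega⟩
    rw [Block.weight, triangleWeight, if_pos hx', if_neg (by omega), if_neg (by omega),
      if_pos hy']
    simp [hK]

theorem secondGroupProg_wp (hb : b.Loaded E s) (hfst : s.reg rFst = x) (hsnd : s.reg rSnd = y)
    (hx : b.side ≤ x) (hx' : x < 2 * b.side) :
    WP E secondGroupProg s fun s' t =>
      s' = s.setReg rWeight (b.weight (s.arr aMatrix) (s.arr aEstimate) x y) ∧ t ≤ 42 := by
  have hσ := hb.sizes.side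
  have hK := hb.sizes.edgeBase
  refine .ite_lt (by simp) (by simp) (fun hc => ?_) fun hc => .ite_lt (by simp) (by simp)
    (fun hc' => ?_) fun hc' => ?_
  · have hy : y < 2 * b.side := by simpa [hsnd, hσ] using hc
    refine (hb.assign_weight (x := x) (y := y) (by omega) (by simp) ?_ (by simp)).mono
      fun _ _ _ _ h => ⟨h.1, by simp; omega⟩
    rw [Block.weight, triangleWeight, if_neg (by omega), if_pos hx', if_neg (by omega)]
    simp [hK]
  · have hy : 2 * b.side ≤ y := by simpa [hsnd, hσ] using hc
    have hy' : y < 3 * b.side := by simpa [hsnd, hσ] using hc'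
    refine (hb.assign_weight (x := x) (y := y) (by omega) (by simp) ?_ (by simp)).mono
      fun _ _ _ _ h => ⟨h.1, by simp; omega⟩
    rw [Block.weight, triangleWeight_second_third hx hx' hy hy']
    simp [hK, hσ, hfst, hsnd, hb.col, hb.mid, hb.sizes.order, Block.right, Block.order, mat]
  · have hy : 3 * b.side ≤ y := by simpa [hsnd, hσ] using hc'
    refine (hb.assign_weight (x := x) (y := y) (by omega) (by simp) ?_ (by simp)).mono
      fun _ _ _ _ h => ⟨h.1, by simp; omega⟩
    rw [Block.weight, triangleWeight, if_neg (by omega), if_pos hx', if_neg (by omega)]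
    simp [hK]

theorem thirdGroupProg_wp (hb : b.Loaded E s) (hfst : s.reg rFst = x) (hsnd : s.reg rSnd = y)
    (hx : 2 * b.side ≤ x) (hx' : x < 3 * b.side) :
    WP E thirdGroupProg s fun s' t =>
      s' = s.setReg rWeight (b.weight (s.arr aMatrix) (s.arr aEstimate) x y) ∧ t ≤ 42 := by
  have hσ := hb.sizes.side
  have hK := hb.sizes.edgeBase
  refine .ite_lt (by simp) (by simp) (fun hc => ?_) fun hc => .ite_lt (by simp) (by simp)
    (fun hc' => ?_) fun hc' => ?_
  · have hy : y < 3 * b.side := by simpa [hsnd, hσ] using hc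
    refine (hb.assign_weight (x := x) (y := y) (by omega) (by simp) ?_ (by simp)).mono
      fun _ _ _ _ h => ⟨h.1, by simp; omega⟩
    rw [Block.weight, triangleWeight, if_neg (by omega), if_neg (by omega), if_pos hx',
      if_neg (by omega)]
    simp [hK]
  · have hy : 3 * b.side ≤ y := by simpa [hsnd, hσ] using hc
    have hy' : y < 4 * b.side := by simpa [hsnd, hσ] using hc'
    refine (hb.assign_weight (x := x) (y := y) (by omega) (by simp) ?_ (by simp)).mono
      fun _ _ _ _ h => ⟨h.1, by simp; omega⟩
    rw [Block.weight, triangleWeight_third_fourth hx hx' hy hy']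
    simp [hK, hσ, hfst, hsnd, hb.row, hb.col, hb.scale, hb.sizes.order, Block.base, Block.order,
      mat]
  · have hy : 4 * b.side ≤ y := by simpa [hsnd, hσ] using hc'
    refine (hb.assign_weight (x := x) (y := y) (by omega) (by simp) ?_ (by simp)).mono
      fun _ _ _ _ h => ⟨h.1, by simp; omega⟩
    rw [Block.weight, triangleWeight, if_neg (by omega), if_neg (by omega), if_pos hx',
      if_neg (by omega)]
    simp [hK]

theorem weightProg_wp (hb : b.Loaded E s) (hfst : s.reg rFst = x) (hsnd : s.reg rSnd = y)
    (hx : 0 ≤ x) :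
    WP E weightProg s fun s' t =>
      s' = s.setReg rWeight (b.weight (s.arr aMatrix) (s.arr aEstimate) x y) ∧ t ≤ 60 := by
  have hσ := hb.sizes.side
  refine .ite_lt (by simp) (by simp) (fun hc => ?_) fun hc => .ite_lt (by simp) (by simp)
    (fun hc' => ?_) fun hc' => .ite_lt (by simp) (by simp) (fun hc'' => ?_) fun hc'' => ?_
  · have hx' : x < b.side := by simpa [hfst, hσ] using hc
    exact (firstGroupProg_wp hb hfst hsnd hx hx').mono fun _ _ _ _ h => ⟨h.1, by simp; omega⟩
  · have hx₁ : b.side ≤ x := by simpa [hfst, hσ] using hc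
    have hx₂ : x < 2 * b.side := by simpa [hfst, hσ] using hc'
    exact (secondGroupProg_wp hb hfst hsnd hx₁ hx₂).mono fun _ _ _ _ h => ⟨h.1, by simp; omega⟩
  · have hx₂ : 2 * b.side ≤ x := by simpa [hfst, hσ] using hc'
    have hx₃ : x < 3 * b.side := by simpa [hfst, hσ] using hc''
    exact (thirdGroupProg_wp hb hfst hsnd hx₂ hx₃).mono fun _ _ _ _ h => ⟨h.1, by simp; omega⟩
  · have hx₃ : 3 * b.side ≤ x := by simpa [hfst, hσ] using hc''
    refine (hb.assign_weight (y := y) hx (by simp) ?_ (by simp)).mono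
      fun _ _ _ _ h => ⟨h.1, by simp; omega⟩
    rw [Block.weight, triangleWeight, if_neg (by omega), if_neg (by omega), if_neg (by omega)]
    simp [hb.sizes.edgeBase]

theorem edgeProg_wp (hb : b.Loaded E s) {k i j : ℕ} (hk : s.reg rEdgeIndex = k)
    (hkij : i * (4 * b.side + 1) + j = k) (hj : j < 4 * b.side + 1) :
    WP E edgeProg s fun s' t => s'.arr aGraph =
      Function.update (Function.update (s.arr aGraph) (2 * k + 1) 1) (2 * k + 2)
        (b.weight (s.arr aMatrix) (s.arr aEstimate) i j) ∧ t ≤ 100 := by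
  have := hb.bound_le
  have := E.eight_le
  have hweight := hb.bounds.weight_mem (Int.natCast_nonneg i) j
  refine .divMod (by rw [hk, hkij]) hb.sizes.graphVerts hj (by decide) ?_
  have hb' : b.Loaded E ((s.setReg rFst i).setReg rSnd j) := hb.congr (by simp) hb.bounds
  refine .seq ((weightProg_wp (x := i) (y := j) hb' (by simp) (by simp) (by simp)).mono ?_)
  rintro _ t - - ⟨rfl, ht⟩
  simp only [State.arr_setReg]
  refine .store_seq (by simp) (by simp) (by simp; omega) ?_
  refine .store (by simp) (by simp) (by simp; omega) ⟨?_, by simp; omega⟩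
  simp [hk]

theorem buildProg_wp (hb : b.Loaded E s) :
    WP E buildProg s fun s' t =>
      HoldsGraph (s'.arr aGraph) (b.graph (s.arr aMatrix) (s.arr aEstimate)) ∧
        t ≤ (4 * b.side + 1) * (4 * b.side + 1) * 108 + 9 := by
  have := hb.cells_le
  have := E.eight_le
  have hB : 4 * b.side + 1 ≤ E.B := by nlinarith
  have hverts := hb.sizes.graphVerts
  refine .of_frame (.store_seq (by simp) (by simp) (by simp [hverts]; omega) ?_)
  refine .forTo_le ((4 * b.side + 1) * (4 * b.side + 1)) 100
    (fun k s' => s'.arr aGraph 0 = (4 * b.side + 1 : ℕ) ∧ HoldsEdges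
      (s'.arr aGraph) (4 * b.side + 1) k (b.weight (s.arr aMatrix) (s.arr aEstimate)))
    (by simpa using hb.sizes.graphCells) (by decide)
    ⟨by simp [hverts], fun _ _ _ _ h => absurd h (Nat.not_lt_zero _)⟩ ?_ ?_
  · rintro k s' hk ⟨h0, hedges⟩ hkreg hF
    obtain ⟨i, j, hkij, -⟩ := exists_rowMajor hk
    have hmatrix : s'.arr aMatrix = s.arr aMatrix := by
      rw [hF.2 _ (by decide)]; simp [State.arr_setCell]
    have hestimate : s'.arr aEstimate = s.arr aEstimate := by
      rw [hF.2 _ (by decide)]; simp [State.arr_setCell]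
    have hb' : b.Loaded E s' := hb.congr
      (fun x hx => hF.1 x ((by decide : ∀ x ∈ blockRegs, x ∉ _) x hx))
      (by rw [hmatrix, hestimate]; exact hb.bounds)
    refine (edgeProg_wp hb' hkreg hkij j.2).mono fun s'' t _ _ ⟨hgraph, ht⟩ => ⟨ht, ?_⟩
    rw [hmatrix, hestimate] at hgraph
    rw [State.arr_setReg, hgraph]
    refine ⟨?_, hedges.succ j.2 hkij⟩
    rw [Function.update_of_ne (by omega), Function.update_of_ne (by omega), h0]
  · rintro s' t ⟨h0, hedges⟩ - - ht _
    exact ⟨hedges.holdsGraph rfl h0, by simp; omega⟩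

theorem lowerProg_wp (hb : b.Loaded E s) {i k y z : ℕ} (hi : s.reg rFoundRow = b.row + i)
    (hk : s.reg rPairIndex = k) (hkyz : y * b.side + z = k) (hz : z < b.side) :
    WP E lowerProg s fun s' t =>
      s'.arr aEstimate = b.lower (s.arr aMatrix) (s.arr aEstimate) i y z ∧ t ≤ 90 := by
  have := hb.bound_le
  have := hb.bounds.bound_pos
  have := hb.bounds.scale_pos
  have := hb.bounds.scale_le
  have hentry := hb.bounds.estimate ((b.row + i) * b.order + (b.col + y))
  refine .divMod (by rw [hk, hkyz]) hb.sizes.side hz (by decide) ?_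
  have heval : (cell aEstimate (reg rFoundRow * reg rOrder + (reg rCol + reg rFst)) -
      reg rScale).eval ((s.setReg rFst y).setReg rSnd z) = b.base (s.arr aEstimate) i y := by
    simp [hi, hb.sizes.order, hb.col, hb.scale, Block.base, Block.order, mat]
  refine .assign_seq (by simp) (by rw [heval, Block.base, mat]; omega) ?_
  rw [heval]
  refine .ite_lt (by simp) (by simp) (fun hc => ?_) fun hc => .skip ⟨?_, by simp⟩
  · have hlt : b.left (s.arr aMatrix) i z + b.right (s.arr aMatrix) z y <
        b.base (s.arr aEstimate) i y := by
      simpa [hi, hb.sizes.order, hb.mid, hb.col, Block.left, Block.right, Block.order, mat] using hc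
    refine .store (by simp) (by simp) (by simp [Block.base, mat]; omega) ⟨?_, by simp⟩
    rw [Block.lower, if_pos hlt]
    simp [hi, hb.sizes.order, hb.col, Block.order]
  · have hle : ¬ b.left (s.arr aMatrix) i z + b.right (s.arr aMatrix) z y <
        b.base (s.arr aEstimate) i y := by
      simpa [hi, hb.sizes.order, hb.mid, hb.col, Block.left, Block.right, Block.order, mat] using hc
    rw [Block.lower, if_neg hle]
    simp

theorem rowProg_wp (hb : b.Loaded E s) {i : ℕ} (hi : s.reg rFoundRow = b.row + i) :
    WP E rowProg s fun s' t => b.Bounds (s'.arr aMatrix) (s'.arr aEstimate) ∧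
      b.RowUpdate (s.arr aMatrix) (s.arr aEstimate) i (b.side * b.side) (s'.arr aEstimate) ∧
      t ≤ b.side * b.side * 98 + 6 := by
  refine .forTo_le (b.side * b.side) 90 (fun k s' => s'.arr aMatrix = s.arr aMatrix ∧
    b.Bounds (s.arr aMatrix) (s'.arr aEstimate) ∧
    b.RowUpdate (s.arr aMatrix) (s.arr aEstimate) i k (s'.arr aEstimate)) hb.sizes.sideSq
    (by decide) ⟨rfl, hb.bounds, .zero⟩ ?_ ?_
  · rintro k s' hk ⟨hmatrix, hbounds, hrow⟩ hkreg hF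
    obtain ⟨y, z, hkyz, -⟩ := exists_rowMajor hk
    have hb' : b.Loaded E s' := hb.of_frame hF (by decide) (by rw [hmatrix]; exact hbounds)
    refine (lowerProg_wp hb' ((hF.1 _ (by decide)).trans hi) hkreg hkyz z.2).mono ?_
    rintro s'' t - hF' ⟨hestimate, ht⟩
    rw [State.arr_setReg, State.arr_setReg, hestimate, hF'.2 _ (by decide), hmatrix]
    exact ⟨ht, rfl, hbounds.lower .., hrow.succ hbounds.scale_pos y.2 z.2 hkyz.symm⟩
  · rintro s' t ⟨hmatrix, hbounds, hrow⟩ - - ht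
    rw [hmatrix]
    exact ⟨hbounds, hrow, ht⟩

end BlockProg

/-- Ask for a vertex of the triangle graph that is no endpoint of a diameter. -/
def queryProg : Prog := .seq buildProg (.call aGraph aAnswer)

def updateProg : Prog :=
  .ite (.lt (cell aAnswer 0) 0) (.assign rSearching 0)
    (.seq (.assign rFoundRow (reg rRow + cell aAnswer 0)) rowProg)

/-- Lower the estimates until the block has no negative triangles. -/
def blockProg : Prog :=
  .seq (.assign rSearching 1) <| .loop (reg rSearching) <| .seq queryProg updateProg

/-- Calls with a graph with `v` vertices return correct answers for CoDiameter within time `τ`. -/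
def SolvesCoDiameter (E : Env) (v τ : ℕ) : Prop :=
  ∀ (s : State) (G : CoDiameter.Inst), CoDiameter.size G = v → CoDiameter.weight G ≤ E.B →
    CoDiameter.Input G (s.arr aGraph) → WP E (.call aGraph aAnswer) s fun s' t =>
      CoDiameter.Output G (s'.arr aAnswer) ∧ t ≤ 1 + τ

/-- A bound for the time that it takes to search a block once. -/
def searchTime (σ τ : ℕ) : ℕ := (4 * σ + 1) * (4 * σ + 1) * 108 + σ * σ * 98 + τ + 40

section SearchProg

variable {E : Env} {s : State} {b : Block} {τ : ℕ} {C : ℕ → ℕ → ℤ}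

/-- The answer `o` is a row of the block with a negative triangle, or `-1` if there is none. -/
def Block.Answer (b : Block) (a u : ℤ → ℤ) (o : ℤ) : Prop :=
  (∃ x y z : ℕ, o = x ∧ x < b.side ∧ y < b.side ∧ z < b.side ∧
    b.left a x z + b.right a z y < b.base u x y) ∨ o = -1 ∧ b.NoNegTriangle a u

theorem Block.Bounds.answer {a u o : ℤ → ℤ} (hb : b.Bounds a u)
    {hG : (b.graph a u).NonnegWeights} (ho : CoDiameter.Output ⟨b.graph a u, hG⟩ o) :
    b.Answer a u (o 0) := by
  have hspec := triangleGraph.not_isDiameterVertex_iff hb.triangleBounds hb.side_pos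
  rcases ho with ⟨x, hx, hnot⟩ | ⟨hnone, hall⟩
  · obtain ⟨hxσ, y, z, hy, hz, hlt⟩ := (hspec x).1 hnot
    exact .inl ⟨x, y, z, hx, hxσ, hy, hz, hlt⟩
  · refine .inr ⟨hnone, fun x y z hx hy hz => ?_⟩
    by_contra! hlt
    exact (hspec ⟨x, by change x < 4 * b.side + 1; omega⟩).2 ⟨hx, y, z, hy, hz, hlt⟩ (hall _)

theorem queryProg_wp (hsolves : SolvesCoDiameter E (4 * b.side + 1) τ) (hb : b.Loaded E s) :
    WP E queryProg s fun s' t =>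
      b.Answer (s.arr aMatrix) (s.arr aEstimate) (s'.arr aAnswer 0) ∧
        t ≤ (4 * b.side + 1) * (4 * b.side + 1) * 108 + τ + 10 := by
  have hG := triangleGraph.nonnegWeights hb.bounds.triangleBounds hb.bounds.side_pos
  have hmax := triangleGraph.maxWeight_le hb.bounds.triangleBounds hb.bounds.side_pos
  have := hb.bound_le
  have := hb.bounds.bound_pos
  refine .seq ((buildProg_wp hb).mono fun s₁ t₁ _ _ ⟨hgraph, _⟩ => ?_)
  refine (hsolves s₁ ⟨b.graph (s.arr aMatrix) (s.arr aEstimate), hG⟩ rfl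
    (hmax.trans (by omega)) hgraph).mono fun s₂ t₂ _ _ ⟨hout, _⟩ => ?_
  exact ⟨hb.bounds.answer hout, by omega⟩

/-- The outcome of a search: there is no negative triangle, or estimates have been lowered. -/
def Block.Searched (b : Block) (C : ℕ → ℕ → ℤ) (s s' : State) : Prop :=
  s'.reg rSearching = 0 ∧ s'.arr aEstimate = s.arr aEstimate ∧
      b.NoNegTriangle (s.arr aMatrix) (s.arr aEstimate) ∨
    s'.reg rSearching = s.reg rSearching ∧
      Refines b.order C b.scale (s.arr aEstimate) (s'.arr aEstimate)

theorem updateProg_wp (hb : b.Loaded E s)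
    (hanswer : b.Answer (s.arr aMatrix) (s.arr aEstimate) (s.arr aAnswer 0))
    (hC : IsMinPlusSq b.order (fun i j => mat (s.arr aMatrix) b.order i j) C)
    (habove : Above b.order C (s.arr aEstimate)) :
    WP E updateProg s fun s' t => b.Bounds (s'.arr aMatrix) (s'.arr aEstimate) ∧
      b.Searched C s s' ∧ t ≤ b.side * b.side * 98 + 20 := by
  have := E.eight_le
  have := hb.bounds.row_le
  refine .of_bounded fun hs => ?_
  have horder : (b.order : ℤ) ≤ E.B := hb.sizes.order ▸ (hs.1 rOrder).2
  rcases hanswer with ⟨x, y, z, ho, hx, hy, hz, hlt⟩ | ⟨ho, hnone⟩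
  · refine .ite_lt (by simp [ho]; omega) (by simp) (fun hc => ?_) fun _ => ?_
    · exact absurd hc (by simp [ho])
    have heval : (reg rRow + cell aAnswer 0).eval s = b.row + x := by simp [hb.row, ho]
    refine .assign_seq (by simp [ho]; omega) (by rw [heval]; omega) ?_
    rw [heval]
    have hb' : b.Loaded E (s.setReg rFoundRow (b.row + x)) := hb.congr (by simp) hb.bounds
    refine (rowProg_wp (i := x) hb' (by simp)).mono fun s' t _ hF ⟨hbounds, hrow, _⟩ => ?_
    refine ⟨hbounds, .inr ⟨by rw [hF.1 _ (by decide)]; simp, ?_⟩, by simp; omega⟩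
    exact hrow.refines hb.bounds hx hC habove ⟨y, z, hy, hz, hlt⟩
  · refine .ite_lt (by simp [ho]; omega) (by simp) (fun _ => ?_) fun hc => ?_
    · exact .assign (by simp) (by simp)
        ⟨hb.bounds, .inl ⟨by simp, rfl, hnone⟩, by simp⟩
    · exact absurd hc (by simp [ho])

theorem searchProg_wp (hsolves : SolvesCoDiameter E (4 * b.side + 1) τ) (hb : b.Loaded E s)
    (hC : IsMinPlusSq b.order (fun i j => mat (s.arr aMatrix) b.order i j) C)
    (habove : Above b.order C (s.arr aEstimate)) :
    WP E (.seq queryProg updateProg) s fun s' t => b.Bounds (s'.arr aMatrix) (s'.arr aEstimate) ∧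
      b.Searched C s s' ∧ t + 5 ≤ searchTime b.side τ := by
  refine .seq ((queryProg_wp hsolves hb).mono fun s₁ t₁ _ hF ⟨hanswer, ht₁⟩ => ?_)
  have hmatrix : s₁.arr aMatrix = s.arr aMatrix := hF.2 _ (by decide)
  have hestimate : s₁.arr aEstimate = s.arr aEstimate := hF.2 _ (by decide)
  have hsearching : s₁.reg rSearching = s.reg rSearching := hF.1 _ (by decide)
  have hb₁ : b.Loaded E s₁ :=
    hb.of_frame hF (by decide) (by rw [hmatrix, hestimate]; exact hb.bounds)
  rw [← hmatrix, ← hestimate] at hanswer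
  rw [← hmatrix] at hC
  rw [← hestimate] at habove
  refine (updateProg_wp hb₁ hanswer hC habove).mono fun s₂ t₂ _ _ ⟨hbounds, hsearched, ht₂⟩ => ?_
  rw [Block.Searched, hmatrix, hestimate, hsearching] at hsearched
  exact ⟨hbounds, hsearched, by rw [searchTime]; omega⟩

theorem blockProg_wp (hsolves : SolvesCoDiameter E (4 * b.side + 1) τ) (hb : b.Loaded E s)
    (hC : IsMinPlusSq b.order (fun i j => mat (s.arr aMatrix) b.order i j) C)
    (habove : Above b.order C (s.arr aEstimate)) :
    WP E blockProg s fun s' t => b.Bounds (s'.arr aMatrix) (s'.arr aEstimate) ∧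
      b.NoNegTriangle (s.arr aMatrix) (s'.arr aEstimate) ∧
      ∃ f : ℕ, Refines b.order C (b.scale * f) (s.arr aEstimate) (s'.arr aEstimate) ∧
        t ≤ searchTime b.side τ * (f + 1) + 4 := by
  have := E.eight_le
  refine .assign_seq (by simp) (by simp; omega) ?_
  have hb₀ : b.Loaded E (s.setReg rSearching 1) := hb.congr (by simp) hb.bounds
  refine .loop (fun s' => (∑ c ∈ Finset.range (b.order * b.order),
      (s'.arr aEstimate c + 2 * b.bound)).toNat + (s'.reg rSearching).toNat)
    (fun s' t => b.Bounds (s'.arr aMatrix) (s'.arr aEstimate) ∧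
      ∃ f : ℕ, Refines b.order C (b.scale * f) (s.arr aEstimate) (s'.arr aEstimate) ∧
        (s'.reg rSearching = 1 ∧ t ≤ searchTime b.side τ * f ∨
          s'.reg rSearching = 0 ∧ b.NoNegTriangle (s.arr aMatrix) (s'.arr aEstimate) ∧
            t ≤ searchTime b.side τ * (f + 1)))
    ⟨hb.bounds, 0, by simpa using Refines.refl habove, .inl (by simp)⟩ (by simp) ?_ ?_
  · rintro s' t ⟨hbounds, f, hrefines, ⟨hsearching, ht⟩ | ⟨hdone, -, -⟩⟩ hF hcond
    swap
    · exact absurd hdone hcond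
    have hb' : b.Loaded E s' := hb₀.of_frame hF (by decide) hbounds
    have hmatrix : s'.arr aMatrix = s.arr aMatrix := hF.2 _ (by decide)
    refine (searchProg_wp hsolves hb' (by rw [hmatrix]; exact hC) hrefines.above).mono ?_
    rintro s'' t' - - ⟨hbounds', ⟨hdone, heq, hnone⟩ | ⟨hfound, hrefines'⟩, ht'⟩
    · rw [hmatrix] at hnone
      rw [heq, hdone, hsearching]
      exact ⟨by simp, heq ▸ hbounds', f, hrefines, .inr ⟨rfl, hnone, by simp [mul_add]; omega⟩⟩
    · rw [hfound, hsearching]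
      refine ⟨Nat.add_lt_add_right (hrefines'.potential_lt hb.bounds.scale_pos
        fun c => (hbounds'.estimate c).1) _, hbounds', f + 1, ?_, .inl ⟨rfl, ?_⟩⟩
      · rw [Nat.cast_succ, mul_add, mul_one]
        exact hrefines.trans hrefines'
      · simp [mul_add]; omega
  · rintro s' t ⟨hbounds, f, hrefines, ⟨hsearching, -⟩ | ⟨-, hnone, ht⟩⟩ - hend
    · exact absurd hend (by simp [hsearching])
    · exact ⟨hbounds, hnone, f, hrefines, by simp; omega⟩

end SearchProg

/-! ### Squaring a matrix -/

/-- Search the block with number `rBlockIndex`. -/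
def visitProg : Prog :=
  .divMod rRowCol rMid rBlockIndex rSideSq <|
  .divMod rRow rCol rRowCol rSideSq <|
  .seq (.assign rRow (reg rRow * reg rSide)) <|
  .seq (.assign rCol (reg rCol * reg rSide)) <|
  .seq (.assign rMid (reg rMid * reg rSide)) blockProg

/-- Lower the estimates until they are correct up to an error of `rScale`. -/
def phaseProg : Prog := .forTo rBlockIndex rCells visitProg

def initProg : Prog := .forTo rCellIndex rCells (.store aEstimate (reg rCellIndex) (reg rBound))

def halveProg : Prog := .seq phaseProg (.assign rScale (reg rScale / 2))

/-- Find the square by a binary search for all its entries at once. -/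
def refineProg : Prog := .seq (.assign rScale (reg rBound)) (.forTo rPhase rPhases halveProg)

def copyProg : Prog :=
  .forTo rCellIndex rCells (.store aMatrix (reg rCellIndex) (cell aEstimate (reg rCellIndex) - 1))

/-- Square the matrix in `aMatrix` with respect to minimum and addition. -/
def squareProg : Prog := .seq initProg (.seq refineProg copyProg)

/-- The memory holds the sizes, and a matrix and estimates within the bounds. -/
structure Stored (E : Env) (σ : ℕ) (R : ℤ) (s : State) : Prop where
  sizes : Sizes σ R s
  bound_pos : 0 < R
  bound_le : 12 * R ≤ E.B
  cells_le : (4 * σ + 1) * (4 * σ + 1) ≤ E.B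
  matrix : ∀ c, -R ≤ s.arr aMatrix c ∧ s.arr aMatrix c ≤ R
  estimate : ∀ c, -(2 * R) ≤ s.arr aEstimate c ∧ s.arr aEstimate c ≤ R

/-- The memory during the repeated squaring of a matrix with entries at most `2 ^ e` in absolute
value. -/
structure Work (E : Env) (σ e : ℕ) (s : State) : Prop extends Stored E σ (2 ^ e) s where
  bound : s.reg rBound = 2 ^ e
  phases : s.reg rPhases = (e + 1 : ℕ)

/-- The entries of `u` exceed those of `C` by at least one and at most `d`. -/
structure Approximates (m : ℕ) (C : ℕ → ℕ → ℤ) (d : ℤ) (u : ℤ → ℤ) : Prop where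
  above : Above m C u
  le : ∀ i j : ℕ, i < m → j < m → mat u m i j ≤ C i j + d

section SquareProg

variable {E : Env} {s s' : State} {σ τ : ℕ} {R h : ℤ} {C : ℕ → ℕ → ℤ}

theorem Stored.congr (hs : Stored E σ R s) (hregs : ∀ x ∈ sizeRegs, s'.reg x = s.reg x)
    (hmatrix : ∀ c, -R ≤ s'.arr aMatrix c ∧ s'.arr aMatrix c ≤ R)
    (hestimate : ∀ c, -(2 * R) ≤ s'.arr aEstimate c ∧ s'.arr aEstimate c ≤ R) :
    Stored E σ R s' :=
  { hs with sizes := hs.sizes.congr hregs, matrix := hmatrix, estimate := hestimate }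

theorem Stored.loaded {p q r : ℕ} (hs : Stored E σ R s) (hh : 0 < h) (hhR : h ≤ R)
    (hp : p < σ * σ) (hq : q < σ * σ) (hr : r < σ * σ) (hscale : s.reg rScale = h)
    (hrow : s.reg rRow = (p * σ : ℕ)) (hcol : s.reg rCol = (q * σ : ℕ))
    (hmid : s.reg rMid = (r * σ : ℕ)) : (blockAt σ R h p q r).Loaded E s where
  sizes := hs.sizes
  scale := hscale
  row := hrow
  col := hcol
  mid := hmid
  bounds := ⟨Nat.pos_of_mul_pos_left (Nat.zero_lt_of_lt hp), hs.bound_pos, hh, hhR,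
    add_le_pow_three hp, add_le_pow_three hq, add_le_pow_three hr, hs.matrix, hs.estimate⟩
  bound_le := hs.bound_le
  cells_le := hs.cells_le

theorem visitProg_wp (hsolves : SolvesCoDiameter E (4 * σ + 1) τ) (hs : Stored E σ R s)
    (hh : 0 < h) (hhR : h ≤ R) (hscale : s.reg rScale = h)
    (hC : IsMinPlusSq (σ ^ 3) (fun i j => mat (s.arr aMatrix) (σ ^ 3 : ℕ) i j) C)
    (habove : Above (σ ^ 3) C (s.arr aEstimate)) {p q r : ℕ} (hp : p < σ * σ) (hq : q < σ * σ)
    (hr : r < σ * σ) (hindex : s.reg rBlockIndex = (searchIndex (σ * σ) p q r : ℕ)) :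
    WP E visitProg s fun s' t => Stored E σ R s' ∧
      (blockAt σ R h p q r).NoNegTriangle (s.arr aMatrix) (s'.arr aEstimate) ∧
      ∃ f : ℕ, Refines (σ ^ 3) C (h * f) (s.arr aEstimate) (s'.arr aEstimate) ∧
        t ≤ searchTime σ τ * (f + 1) + 40 := by
  refine .of_frame <| .of_bounded fun hB => ?_
  have horder : ((σ ^ 3 : ℕ) : ℤ) ≤ E.B := hs.sizes.order ▸ (hB.1 rOrder).2
  have hside := hs.sizes.side
  have hsideSq := hs.sizes.sideSq
  have hfits : ∀ {w : ℕ}, w < σ * σ → -(E.B : ℤ) ≤ w * σ ∧ (w : ℤ) * σ ≤ E.B := fun {w} hw => by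
    have := add_le_pow_three hw
    have : (0 : ℤ) ≤ w * σ := by positivity
    zify at *
    omega
  refine .divMod hindex hsideSq hr (by decide) <| .divMod (i := p) (j := q) (by simp)
    (by simpa using hsideSq) hq (by decide) ?_
  refine .assign_seq (by simp) (by simpa [hside] using hfits hp) ?_
  refine .assign_seq (by simp) (by simpa [hside] using hfits hq) ?_
  refine .assign_seq (by simp) (by simpa [hside] using hfits hr) ?_
  refine .mono (blockProg_wp (b := blockAt σ R h p q r) hsolves ?_ hC habove) ?_
  · refine Stored.loaded (hs.congr ?_ hs.matrix hs.estimate) hh hhR hp hq hr ?_ ?_ ?_ ?_ <;>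
    simp [hscale, hside]
  rintro s' t - - ⟨hbounds, hnone, f, hrefines, ht⟩ hF
  refine ⟨hs.congr (fun x hx => hF.1 x ?_) hbounds.matrix hbounds.estimate, hnone, f, hrefines, ?_⟩
  · revert x; decide
  · simp only [blockAt] at ht
    simp; omega

/-- After visiting `k` blocks, no visited block has a negative triangle, and the `f` successful
searches have each lowered the estimates by at least `h`. -/
structure Visited (σ : ℕ) (R h : ℤ) (C : ℕ → ℕ → ℤ) (a u : ℤ → ℤ) (k f : ℕ) (u' : ℤ → ℤ) :
    Prop where
  refines : Refines (σ ^ 3) C (h * f) u u'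
  noNegTriangle : ∀ p q r : ℕ, p < σ * σ → q < σ * σ → r < σ * σ → searchIndex (σ * σ) p q r < k →
    (blockAt σ R h p q r).NoNegTriangle a u'

theorem Visited.succ {a u u' u'' : ℤ → ℤ} {p q r f f' : ℕ}
    (hu : Visited σ R h C a u (searchIndex (σ * σ) p q r) f u') (hp : p < σ * σ) (hq : q < σ * σ)
    (hr : r < σ * σ) (hrefines : Refines (σ ^ 3) C (h * f') u' u'')
    (hnone : (blockAt σ R h p q r).NoNegTriangle a u'') :
    Visited σ R h C a u (searchIndex (σ * σ) p q r + 1) (f + f') u'' where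
  refines := by
    rw [Nat.cast_add, mul_add]
    exact hu.refines.trans hrefines
  noNegTriangle p' q' r' hp' hq' hr' hlt := by
    rcases Nat.lt_succ_iff_lt_or_eq.1 hlt with hlt | heq
    · exact (hu.noNegTriangle p' q' r' hp' hq' hr' hlt).mono hrefines.le
    · obtain ⟨rfl, rfl, rfl⟩ := searchIndex_inj hq' hr' hq hr heq
      exact hnone

theorem phaseProg_wp (hsolves : SolvesCoDiameter E (4 * σ + 1) τ) (hs : Stored E σ R s)
    (hh : 0 < h) (hhR : h ≤ R) (hscale : s.reg rScale = h)
    (hC : IsMinPlusSq (σ ^ 3) (fun i j => mat (s.arr aMatrix) (σ ^ 3 : ℕ) i j) C)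
    (habove : Above (σ ^ 3) C (s.arr aEstimate)) :
    WP E phaseProg s fun s' t => Stored E σ R s' ∧
      Approximates (σ ^ 3) C h (s'.arr aEstimate) ∧
      ∃ f : ℕ, Refines (σ ^ 3) C (h * f) (s.arr aEstimate) (s'.arr aEstimate) ∧
        t ≤ searchTime σ τ * (f + σ ^ 3 * σ ^ 3) + 60 * (σ ^ 3 * σ ^ 3) + 6 := by
  have hcells : σ ^ 3 * σ ^ 3 = σ * σ * (σ * σ) * (σ * σ) := by ring
  refine .forTo (σ ^ 3 * σ ^ 3) (fun k s' t => Stored E σ R s' ∧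
    ∃ f, Visited σ R h C (s.arr aMatrix) (s.arr aEstimate) k f (s'.arr aEstimate) ∧
      t ≤ searchTime σ τ * (f + k) + 40 * k) hs.sizes.cells (by decide) ?_ ?_ ?_
  · exact ⟨hs.congr (by simp) hs.matrix hs.estimate, 0,
      ⟨by simpa using Refines.refl habove, by simp⟩, by simp⟩
  · rintro k s₁ t₁ hk ⟨hs₁, f, hvisited, ht₁⟩ hindex hF
    obtain ⟨p, q, r, hp, hq, hr, rfl⟩ := exists_searchIndex (hcells ▸ hk)
    have hmatrix : s₁.arr aMatrix = s.arr aMatrix := hF.2 _ (by decide)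
    refine (visitProg_wp hsolves hs₁ hh hhR ((hF.1 _ (by decide)).trans hscale)
      (by rw [hmatrix]; exact hC) hvisited.refines.above hp hq hr hindex).mono ?_
    rintro s₂ t₂ - - ⟨hs₂, hnone, f', hrefines, ht₂⟩
    refine ⟨hs₂.congr (by simp) hs₂.matrix hs₂.estimate, f + f',
      hvisited.succ hp hq hr hrefines (hmatrix ▸ hnone), ?_⟩
    calc t₁ + t₂ ≤ _ := add_le_add ht₁ ht₂
      _ = _ := by ring
  · rintro s' t ⟨hs', f, hvisited, ht⟩ - -
    refine ⟨hs', ⟨hvisited.refines.above, fun i j hi hj => le_add_of_noNegTriangle hC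
      (fun p q r hp hq hr => hvisited.noNegTriangle p q r hp hq hr ?_) hi hj⟩,
      f, hvisited.refines, by omega⟩
    exact hcells ▸ searchIndex_lt hp hq hr

theorem halveProg_wp (hsolves : SolvesCoDiameter E (4 * σ + 1) τ) (hs : Stored E σ R s)
    (hh : 0 < h) (hhR : h ≤ R) (hscale : s.reg rScale = h)
    (hC : IsMinPlusSq (σ ^ 3) (fun i j => mat (s.arr aMatrix) (σ ^ 3 : ℕ) i j) C)
    (hu : Approximates (σ ^ 3) C (2 * h) (s.arr aEstimate)) :
    WP E halveProg s fun s' t => Stored E σ R s' ∧ s'.reg rScale = h / 2 ∧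
      Approximates (σ ^ 3) C h (s'.arr aEstimate) ∧
      t ≤ searchTime σ τ * (3 * (σ ^ 3 * σ ^ 3)) + 60 * (σ ^ 3 * σ ^ 3) + 12 := by
  have := E.eight_le
  refine .seq ((phaseProg_wp hsolves hs hh hhR hscale hC hu.above).mono ?_)
  rintro s₁ t - hF ⟨hs₁, hu₁, f, hrefines, ht⟩
  have hscale₁ : s₁.reg rScale = h := (hF.1 _ (by decide)).trans hscale
  have := hs.bound_le
  refine .assign (by simp) (by simp [hscale₁]; omega)
    ⟨hs₁.congr (by simp) hs₁.matrix hs₁.estimate, by simp [hscale₁], hu₁, ?_⟩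
  have : f ≤ 2 * (σ ^ 3 * σ ^ 3) := hrefines.count_le hh hu.le
  have : searchTime σ τ * (f + σ ^ 3 * σ ^ 3) ≤ searchTime σ τ * (3 * (σ ^ 3 * σ ^ 3)) :=
    Nat.mul_le_mul_left _ (by omega)
  simp
  omega

theorem initProg_wp (hs : Stored E σ R s) (hbound : s.reg rBound = R) :
    WP E initProg s fun s' t => Stored E σ R s' ∧
      (∀ k : ℕ, k < σ ^ 3 * σ ^ 3 → s'.arr aEstimate k = R) ∧ t ≤ σ ^ 3 * σ ^ 3 * 11 + 6 := by
  have := hs.bound_pos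
  have := hs.bound_le
  refine .of_frame <|
    (WP.forTo_fill (r := aEstimate) _ 3 (fun _ => R) hs.sizes.cells (by decide) ?_).mono ?_
  · intro k s' _ hk hF
    have hbound' : s'.reg rBound = R := (hF.1 _ (by decide)).trans hbound
    exact .store (by simp) (by simp) (by simp [hbound']; omega) ⟨by simp [hk, hbound'], by simp⟩
  · rintro s' t - - ⟨hfilled, hsource, ht⟩ hF
    refine ⟨hs.congr (fun x hx => hF.1 x ?_) (hF.2 aMatrix (by decide) ▸ hs.matrix) fun c => ?_,
      hfilled, ht⟩
    · revert x; decide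
    · rcases hsource c with h | ⟨_, -, h⟩
      · exact h ▸ hs.estimate c
      · omega

theorem refineProg_wp {e : ℕ} (hsolves : SolvesCoDiameter E (4 * σ + 1) τ) (hs : Work E σ e s)
    (hC : IsMinPlusSq (σ ^ 3) (fun i j => mat (s.arr aMatrix) (σ ^ 3 : ℕ) i j) C)
    (hu : Approximates (σ ^ 3) C (2 * 2 ^ e) (s.arr aEstimate)) :
    WP E refineProg s fun s' t => Stored E σ (2 ^ e) s' ∧
      Approximates (σ ^ 3) C 1 (s'.arr aEstimate) ∧
      t ≤ (e + 1) * (searchTime σ τ * (3 * (σ ^ 3 * σ ^ 3)) + 60 * (σ ^ 3 * σ ^ 3) + 20) + 8 := by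
  have := hs.bound_le
  have := hs.bound_pos
  refine .assign_seq (by simp) (by simp [hs.bound]; omega) ?_
  simp only [Expr.eval_reg, hs.bound]
  refine .forTo_le (e + 1)
    (searchTime σ τ * (3 * (σ ^ 3 * σ ^ 3)) + 60 * (σ ^ 3 * σ ^ 3) + 12)
    (fun k s' => Stored E σ (2 ^ e) s' ∧ s'.reg rScale = 2 ^ (e + 1 - k) / 2 ∧
      Approximates (σ ^ 3) C (2 ^ (e + 1 - k)) (s'.arr aEstimate))
    (by simpa using hs.phases) (by decide) ?_ ?_ ?_
  · refine ⟨hs.congr (by simp) hs.matrix hs.estimate, ?_, ?_⟩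
    · simp [pow_succ]
    · simpa [pow_succ'] using hu
  · rintro k s₁ hk ⟨hs₁, hscale, hu₁⟩ - hF
    have hmatrix : s₁.arr aMatrix = s.arr aMatrix := hF.2 _ (by decide)
    rw [Nat.sub_add_comm (Nat.le_of_lt_succ hk), pow_succ' (2 : ℤ)] at hscale hu₁
    rw [Int.mul_ediv_cancel_left _ two_ne_zero] at hscale
    refine (halveProg_wp hsolves hs₁ (by positivity)
      (pow_le_pow_right₀ one_le_two (Nat.sub_le e k)) hscale
      (by rw [hmatrix]; exact hC) hu₁).mono ?_
    rintro s₂ t - - ⟨hs₂, hscale₂, hu₂, ht⟩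
    rw [Nat.add_sub_add_right]
    exact ⟨ht, hs₂.congr (by simp) hs₂.matrix hs₂.estimate, by simpa using hscale₂, hu₂⟩
  · rintro s' t ⟨hs', -, hu'⟩ - - ht
    rw [Nat.sub_self, pow_zero] at hu'
    refine ⟨hs', hu', ?_⟩
    calc _ ≤ _ := Nat.add_le_add_left ht _
      _ = _ := by simp; ring

theorem copyProg_wp (hs : Stored E σ R s)
    (hu : Approximates (σ ^ 3) C 1 (s.arr aEstimate))
    (hC : ∀ i j : ℕ, i < σ ^ 3 → j < σ ^ 3 → -R ≤ C i j ∧ C i j < R) :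
    WP E copyProg s fun s' t => Stored E σ R s' ∧
      (∀ i j : ℕ, i < σ ^ 3 → j < σ ^ 3 → mat (s'.arr aMatrix) (σ ^ 3 : ℕ) i j = C i j) ∧
      t ≤ σ ^ 3 * σ ^ 3 * 16 + 6 := by
  have := hs.bound_le
  have hestimate : ∀ k : ℕ, k < σ ^ 3 * σ ^ 3 → -R ≤ s.arr aEstimate k - 1 ∧
      s.arr aEstimate k - 1 < R := by
    intro k hk
    obtain ⟨i, j, rfl, -⟩ := exists_rowMajor hk
    have := hu.above i j i.2 j.2
    have := hu.le i j i.2 j.2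
    have := hC i j i.2 j.2
    simp only [mat] at *
    rw [Nat.cast_add, Nat.cast_mul]
    omega
  refine .of_frame <| (WP.forTo_fill (r := aMatrix) _ 8 (fun k => s.arr aEstimate k - 1)
    hs.sizes.cells (by decide) ?_).mono ?_
  · intro k s' hkN hk hF
    have hcell : s'.arr aEstimate = s.arr aEstimate := hF.2 _ (by decide)
    have := hestimate k hkN
    exact .store (by simp) (by simp) (by simp [hk, hcell]; omega) ⟨by simp [hk, hcell], by simp⟩
  · rintro s' t - - ⟨hfilled, hsource, ht⟩ hF
    refine ⟨hs.congr (fun x hx => hF.1 x ?_) (fun c => ?_)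
      (hF.2 aEstimate (by decide) ▸ hs.estimate), fun i j hi hj => ?_, ht⟩
    · revert x; decide
    · rcases hsource c with h | ⟨k, hk, h⟩
      · exact h ▸ hs.matrix c
      · have := hestimate k hk
        omega
    · have hfill := hfilled (i * σ ^ 3 + j) (rowMajor_lt hi hj)
      have := hu.above i j hi hj
      have := hu.le i j hi hj
      simp only [mat] at *
      rw [Nat.cast_add, Nat.cast_mul] at hfill
      omega

/-- A bound for the time of one squaring. -/
def squareTime (σ τ e : ℕ) : ℕ :=
  (e + 1) * (searchTime σ τ * (3 * (σ ^ 3 * σ ^ 3)) + 60 * (σ ^ 3 * σ ^ 3) + 20) +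
    40 * (σ ^ 3 * σ ^ 3) + 30

theorem squareProg_wp {e : ℕ} (hsolves : SolvesCoDiameter E (4 * σ + 1) τ) (hs : Work E σ e s)
    (hC : IsMinPlusSq (σ ^ 3) (fun i j => mat (s.arr aMatrix) (σ ^ 3 : ℕ) i j) C)
    (hCbound : ∀ i j : ℕ, i < σ ^ 3 → j < σ ^ 3 → -(2 : ℤ) ^ e ≤ C i j ∧ C i j < 2 ^ e) :
    WP E squareProg s fun s' t => Work E σ e s' ∧
      (∀ i j : ℕ, i < σ ^ 3 → j < σ ^ 3 → mat (s'.arr aMatrix) (σ ^ 3 : ℕ) i j = C i j) ∧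
      t ≤ squareTime σ τ e := by
  refine .of_frame <| .seq ((initProg_wp hs.toStored hs.bound).mono ?_)
  rintro s₁ t₁ - hF₁ ⟨hs₁, hinit, ht₁⟩
  have hmatrix : s₁.arr aMatrix = s.arr aMatrix := hF₁.2 _ (by decide)
  have hwork₁ : Work E σ e s₁ :=
    ⟨hs₁, (hF₁.1 _ (by decide)).trans hs.bound, (hF₁.1 _ (by decide)).trans hs.phases⟩
  have hentry : ∀ i j : ℕ, i < σ ^ 3 → j < σ ^ 3 →
      mat (s₁.arr aEstimate) (σ ^ 3 : ℕ) i j = 2 ^ e := fun i j hi hj => by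
    simpa [mat] using hinit _ (rowMajor_lt hi hj)
  have hu : Approximates (σ ^ 3) C (2 * 2 ^ e) (s₁.arr aEstimate) := by
    refine ⟨fun i j hi hj => ?_, fun i j hi hj => ?_⟩ <;>
    · have := hCbound i j hi hj
      rw [hentry i j hi hj]
      omega
  refine .seq ((refineProg_wp hsolves hwork₁ (by rw [hmatrix]; exact hC) hu).mono ?_)
  rintro s₂ t₂ - - ⟨hs₂, hu₂, ht₂⟩
  refine (copyProg_wp hs₂ hu₂ hCbound).mono ?_
  rintro s₃ t₃ - - ⟨hs₃, hsquare, ht₃⟩ hF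
  refine ⟨⟨hs₃, (hF.1 _ (by decide)).trans hs.bound, (hF.1 _ (by decide)).trans hs.phases⟩,
    hsquare, ?_⟩
  rw [squareTime]
  omega

end SquareProg

local notation "rGraphOrder" => (0 : ℕ)
local notation "rMaxDist" => (4 : ℕ)
local notation "rMissing" => (5 : ℕ)
local notation "rSquarings" => (8 : ℕ)
local notation "rSteps" => (14 : ℕ)
local notation "rNorm" => (15 : ℕ)
local notation "rGraphEntries" => (16 : ℕ)
local notation "rRange" => (17 : ℕ)
local notation "rCounter" => (20 : ℕ)

/-! ### Preparing the repeated squaring -/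

theorem HoldsGraph.apply {G : WDigraph} {a : ℤ → ℤ} (ha : HoldsGraph a G) (i j : Fin G.n) :
    a (2 * (i * G.n + j : ℕ) + 1) = (if G.w i j = ⊤ then 0 else 1) ∧
    a (2 * (i * G.n + j : ℕ) + 2) = (G.w i j).untopD 0 := by
  obtain ⟨hflag, hvalue⟩ := ha.2 i j
  rw [add_comm 1] at hflag hvalue
  rw [add_assoc, one_add_one_eq_two] at hvalue
  rw [Nat.cast_add, Nat.cast_mul]
  exact ⟨hflag, hvalue⟩

/-- The sum of the squares of the weights of the graph in the array `a`. It bounds their absolute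
values, and unlike these it is computed without comparisons. -/
def squareSum (a : ℤ → ℤ) (N : ℕ) : ℤ := ∑ k ∈ Finset.range N, a (2 * k + 2) ^ 2

section SquareSum

variable {G : WDigraph} {a : ℤ → ℤ} {k : ℕ}

theorem sq_le_squareSum {N : ℕ} (hk : k < N) : a (2 * k + 2) ^ 2 ≤ squareSum a N :=
  Finset.single_le_sum (f := fun k : ℕ => a (2 * k + 2) ^ 2) (fun _ _ => sq_nonneg _)
    (Finset.mem_range.2 hk)

theorem squareSum_nonneg : 0 ≤ squareSum a k := Finset.sum_nonneg fun _ _ => sq_nonneg _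

theorem HoldsGraph.abs_weight_le (ha : HoldsGraph a G) (hk : k < G.n * G.n) :
    |a (2 * k + 2)| ≤ G.maxWeight := by
  obtain ⟨i, j, rfl, -⟩ := exists_rowMajor hk
  rw [(ha.apply i j).2]
  cases hw : G.w i j with
  | top => simp
  | coe d => exact G.weightsLE_maxWeight hw

theorem HoldsGraph.squareSum_le (ha : HoldsGraph a G) (hk : k ≤ G.n * G.n) :
    squareSum a k ≤ (G.n * G.n * G.maxWeight ^ 2 : ℕ) := by
  calc squareSum a k ≤ ∑ _l ∈ Finset.range k, (G.maxWeight : ℤ) ^ 2 :=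
        Finset.sum_le_sum fun l hl => sq_le_sq.2 <|
          (ha.abs_weight_le ((Finset.mem_range.1 hl).trans_le hk)).trans (le_abs_self _)
    _ = k * (G.maxWeight : ℤ) ^ 2 := by simp
    _ ≤ (G.n * G.n * G.maxWeight ^ 2 : ℕ) := by
        exact_mod_cast Nat.mul_le_mul_right (G.maxWeight ^ 2) hk

theorem HoldsGraph.weightsLE_squareSum (ha : HoldsGraph a G) :
    G.WeightsLE (squareSum a (G.n * G.n)) := by
  intro u v d hd
  have hvalue := (ha.apply u v).2
  rw [hd, WithTop.untopD_coe] at hvalue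
  calc |d| ≤ |d| ^ 2 := Int.le_self_sq _
    _ = a (2 * (u * G.n + v : ℕ) + 2) ^ 2 := by rw [hvalue, sq_abs]
    _ ≤ squareSum a (G.n * G.n) := sq_le_squareSum (rowMajor_lt u.2 v.2)

end SquareSum

/-- The number `σ` is the cube root of `n` up to a constant. -/
structure NearCubeRoot (n σ : ℕ) : Prop where
  le_cube : n ≤ σ ^ 3
  cube_le : σ ^ 3 ≤ 8 * n
  le : σ ≤ n

theorem lt_of_cube_lt {n k : ℕ} (hk : k ^ 3 < n) : k < n :=
  (Nat.le_self_pow (by norm_num) k).trans_lt hk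

theorem succ_cube_le {n k : ℕ} (hk : k ^ 3 < n) : (k + 1) ^ 3 ≤ 8 * n := by
  rcases Nat.eq_zero_or_pos k with rfl | hk0
  · omega
  · calc (k + 1) ^ 3 ≤ (2 * k) ^ 3 := Nat.pow_le_pow_left (by omega) 3
      _ = 8 * k ^ 3 := by ring
      _ ≤ 8 * n := by omega

section NearCubeRoot

variable {n σ : ℕ}

theorem NearCubeRoot.cells_le (hσ : NearCubeRoot n σ) : σ ^ 3 * σ ^ 3 ≤ 64 * (n + 1) * (n + 1) :=
  calc σ ^ 3 * σ ^ 3 ≤ 8 * n * (8 * n) := Nat.mul_le_mul hσ.cube_le hσ.cube_le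
    _ ≤ 64 * (n + 1) * (n + 1) := by linarith

theorem NearCubeRoot.graphCells_le (hσ : NearCubeRoot n σ) :
    (4 * σ + 1) * (4 * σ + 1) ≤ 64 * (n + 1) * (n + 1) := by
  have hle : 4 * σ + 1 ≤ 4 * (n + 1) := by have := hσ.le; omega
  calc (4 * σ + 1) * (4 * σ + 1) ≤ 4 * (n + 1) * (4 * (n + 1)) := Nat.mul_le_mul hle hle
    _ ≤ 64 * (n + 1) * (n + 1) := by nlinarith [Nat.zero_le (n * n)]

end NearCubeRoot

def normStepProg : Prog :=
  .seq (.assign rWeight (cell aInput (2 * reg rCounter + 2)))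
    (.assign rNorm (reg rNorm + reg rWeight * reg rWeight))

/-- Add the squares of all weights to `rNorm`. -/
def normProg : Prog :=
  .seq (.assign rGraphEntries (reg rGraphOrder * reg rGraphOrder))
    (.forTo rCounter rGraphEntries normStepProg)

/-- Find the first power of two that is at least the register `y`. The power goes to the register
`x` and its exponent to the register `l`. -/
def powerProg (x l y : ℕ) : Prog :=
  .seq (.assign x 1) <| .seq (.assign l 0) <|
  .loop (.lt (reg x) (reg y)) (.seq (.assign x (reg x + reg x)) (.assign l (reg l + 1)))

def rootProg : Prog :=
  .loop (.lt (reg rSide * reg rSide * reg rSide) (reg rGraphOrder))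
    (.assign rSide (reg rSide + 1))

def sizeProg : Prog :=
  .seq (.assign rOrder (reg rSide * reg rSide * reg rSide)) <|
  .seq (.assign rCells (reg rOrder * reg rOrder)) <|
  .seq (.assign rGraphVerts (4 * reg rSide + 1)) <|
  .seq (.assign rGraphCells (reg rGraphVerts * reg rGraphVerts)) <|
  .seq (.assign rEdgeBase (4 * reg rBound)) (.assign rSideSq (reg rSide * reg rSide))

section Preparations

variable {E : Env} {s : State} {G : WDigraph} {n σ : ℕ} {R : ℤ}

theorem normProg_wp (ha : HoldsGraph (s.arr aInput) G) (horder : s.reg rGraphOrder = G.n)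
    (hnorm : s.reg rNorm = 0) (hn : G.n * G.n ≤ E.B)
    (hB : G.n * G.n * G.maxWeight ^ 2 ≤ E.B) :
    WP E normProg s fun s' t => s'.reg rGraphEntries = (G.n * G.n : ℕ) ∧
      s'.reg rNorm = squareSum (s.arr aInput) (G.n * G.n) ∧ t ≤ 30 * (G.n * G.n) + 10 := by
  have hentries : (reg rGraphOrder * reg rGraphOrder).eval s = (G.n * G.n : ℕ) := by simp [horder]
  refine .assign_seq (by simp) (by rw [hentries]; omega) ?_
  rw [hentries]
  refine .forTo_le (G.n * G.n) 22 (fun k s' => s'.reg rGraphEntries = (G.n * G.n : ℕ) ∧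
      s'.reg rNorm = squareSum (s.arr aInput) k) (by simp) (by decide)
    (by simp [hnorm, squareSum]) ?_ ?_
  · rintro k s' hk ⟨hentries', hnorm'⟩ hcounter hF
    have hinput : s'.arr aInput = s.arr aInput := hF.2 _ (by decide)
    have hle := (ha.squareSum_le hk).trans (Nat.cast_le.2 hB)
    have hsq := (sq_le_squareSum (a := s.arr aInput) (Nat.lt_succ_self k)).trans hle
    have hweight : |s.arr aInput (2 * k + 2)| ≤ E.B :=
      (Int.le_self_sq _).trans (by rwa [sq_abs])
    have hsucc := squareSum_nonneg (a := s.arr aInput) (k := k + 1)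
    rw [squareSum, Finset.sum_range_succ, ← squareSum, pow_two] at hle hsucc
    have heval : (cell aInput (2 * reg rCounter + 2)).eval s' = s.arr aInput (2 * k + 2) := by
      simp [hinput, hcounter]
    have := abs_le.1 hweight
    refine .assign_seq ⟨by simp, fun _ => by rwa [← Expr.eval_cell, heval]⟩ (heval ▸ this) ?_
    rw [heval]
    refine .assign (by simp) (by simp [hnorm']; omega) ⟨by simp, by simp [hentries'], ?_⟩
    rw [squareSum, Finset.sum_range_succ, ← squareSum]
    simp [hnorm', pow_two]
  · rintro s' t ⟨hentries', hnorm'⟩ - - ht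
    exact ⟨hentries', hnorm', by simp; omega⟩

theorem powerProg_wp {x l y : ℕ} (hxl : x ≠ l) (hxy : x ≠ y) (hly : l ≠ y)
    (hy : 0 ≤ s.reg y) (hB : 2 * s.reg y + 1 ≤ E.B) :
    WP E (powerProg x l y) s fun s' t => ∃ e : ℕ, s'.reg x = 2 ^ e ∧ s'.reg l = e ∧
      s.reg y ≤ 2 ^ e ∧ 2 ^ e ≤ 2 * s.reg y + 1 ∧ t ≤ 12 * e + 10 := by
  have := E.eight_le
  have hdcond : (Expr.lt (reg x) (reg y)).deg ≤ 40 := (by decide : 2 ≤ 40)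
  have hddouble : (reg x + reg x).deg ≤ 40 := (by decide : 2 ≤ 40)
  have hdnext : (reg l + 1).deg ≤ 40 := (by decide : 2 ≤ 40)
  refine .assign_seq (by simp) (by simp; omega) (.assign_seq (by simp) (by simp) ?_)
  refine .loop (fun s' => (s.reg y - s'.reg x).toNat)
    (fun s' t => ∃ e : ℕ, s'.reg x = 2 ^ e ∧ s'.reg l = e ∧ s'.reg y = s.reg y ∧
      2 ^ e ≤ 2 * s.reg y + 1 ∧ t = 12 * e) ⟨0, ?_⟩ (by simp) ?_ ?_ hdcond
  · simp [hxl, hxy.symm, hly.symm, hy]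
  · rintro s' t ⟨e, hx, hl, hy', _, rfl⟩ - hcond
    have hlt : 2 ^ e < s.reg y := by simpa [hx, hy'] using hcond
    have he : (e : ℤ) < 2 ^ e := by exact_mod_cast e.lt_two_pow_self
    refine .assign_seq (by simp) (by simp [hx]; omega) ?_ hddouble
    refine .assign (by simp) (by simp [hxl.symm, hl]; omega) ⟨?_, e + 1, ?_⟩ hdnext
    · simp [hxl, hx]; omega
    · have hpow : (2 : ℤ) ^ (e + 1) = 2 ^ e + 2 ^ e := by ring
      simp [hxl, hxl.symm, hxy.symm, hly.symm, hx, hl, hy', hpow]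
      omega
  · rintro s' t ⟨e, hx, hl, hy', hle, rfl⟩ - hcond
    have hge : s.reg y ≤ 2 ^ e := by simpa [hx, hy'] using hcond
    exact ⟨e, hx, hl, hge, hle, by simp; omega⟩

theorem rootProg_wp (hside : s.reg rSide = 0) (horder : s.reg rGraphOrder = n) :
    WP E rootProg s fun s' t => ∃ σ : ℕ, NearCubeRoot n σ ∧ s'.reg rSide = σ ∧
      t ≤ 12 * n + 8 := by
  refine .of_bounded fun hs => ?_
  have hnB : (n : ℤ) ≤ E.B := horder ▸ (hs.1 rGraphOrder).2
  refine .loop (fun s' => (n - s'.reg rSide).toNat) (fun s' t => ∃ k : ℕ, s'.reg rSide = k ∧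
      k ^ 3 ≤ 8 * n ∧ k ≤ n ∧ t = 12 * k) ⟨0, by simp [hside]⟩ (by simp) ?_ ?_
  · rintro s' t ⟨k, hk, _, _, rfl⟩ hF hcond
    have horder' : s'.reg rGraphOrder = n := (hF.1 _ (by decide)).trans horder
    have hlt : k ^ 3 < n := by
      rw [pow_three']
      zify
      simpa [hk, horder'] using hcond
    have := lt_of_cube_lt hlt
    refine .assign (by simp) (by simp [hk]; omega) ⟨?_, k + 1, ?_, succ_cube_le hlt, this, ?_⟩
    · simp [hk]; omega
    · simp [hk]
    · simp; ring
  · rintro s' t ⟨σ, hσ, hcube, hle, rfl⟩ hF hcond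
    have horder' : s'.reg rGraphOrder = n := (hF.1 _ (by decide)).trans horder
    have hge : n ≤ σ ^ 3 := by
      rw [pow_three']
      zify
      simpa [hσ, horder'] using hcond
    exact ⟨σ, ⟨hge, hcube, hle⟩, hσ, by simp; omega⟩

theorem WP.assign_natCast_seq {x k : ℕ} {e : Expr} {q : Prog} {Q : State → ℕ → Prop}
    (he : e.Safe E.B s) (hv : e.eval s = k) (hk : k ≤ E.B)
    (h : WP E q (s.setReg x k) fun s' t => Q s' (e.cost + 1 + t))
    (hd : e.deg ≤ 40 := by decide) : WP E (.seq (.assign x e) q) s Q :=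
  .assign_seq he (by omega) (by rwa [hv]) hd

theorem sizeProg_wp (hside : s.reg rSide = σ) (hbound : s.reg rBound = R) (hR : 0 ≤ R)
    (hRB : 4 * R ≤ E.B) (hσ : NearCubeRoot n σ) (hB : 64 * (n + 1) * (n + 1) ≤ E.B) :
    WP E sizeProg s fun s' t => Sizes σ R s' ∧ t ≤ 40 := by
  have hcells : σ ^ 3 * σ ^ 3 ≤ E.B := hσ.cells_le.trans hB
  have hgraphCells : (4 * σ + 1) * (4 * σ + 1) ≤ E.B := hσ.graphCells_le.trans hB
  have hcube : σ ^ 3 ≤ E.B := (Nat.le_mul_self _).trans hcells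
  have hverts : 4 * σ + 1 ≤ E.B := (Nat.le_mul_self _).trans hgraphCells
  have hsq : σ * σ ≤ E.B := by
    have hle : σ ≤ 4 * σ + 1 := by omega
    exact (Nat.mul_le_mul hle hle).trans hgraphCells
  refine .assign_natCast_seq (k := σ ^ 3) (by simp) (by simp [hside, pow_three']) hcube ?_
  refine .assign_natCast_seq (k := σ ^ 3 * σ ^ 3) (by simp) (by simp) hcells ?_
  refine .assign_natCast_seq (k := 4 * σ + 1) (by simp) (by simp [hside]) hverts ?_
  refine .assign_natCast_seq (k := (4 * σ + 1) * (4 * σ + 1)) (by simp) (by simp) hgraphCells ?_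
  refine .assign_seq (by simp) (by simp [hbound]; omega) ?_
  refine .assign (by simp) (by simp [hside]; omega) ⟨⟨?_, ?_, ?_, ?_, ?_, ?_, ?_⟩, by decide⟩ <;>
    simp [hside, hbound]

end Preparations

/-! ### Reading the weights and writing the distances -/

/-- Unless the edge from the vertex `rRow` to the vertex `rCol` is missing, read its weight. -/
def readEdgeProg : Prog :=
  .ite (cell aInput (2 * (reg rRow * reg rGraphOrder + reg rCol) + 1))
    (.assign rWeight (cell aInput (2 * (reg rRow * reg rGraphOrder + reg rCol) + 2))) .skip

/-- Compute the entry of `WDigraph.finWeight` in row `rRow` and column `rCol`. -/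
def finWeightProg : Prog :=
  .seq (.assign rWeight (reg rMissing)) <|
  .ite (reg rRow - reg rCol)
    (.ite (.lt (reg rRow) (reg rGraphOrder))
      (.ite (.lt (reg rCol) (reg rGraphOrder)) readEdgeProg .skip) .skip)
    (.assign rWeight 0)

def fillProg : Prog :=
  .forTo rCounter rCells <| .divMod rRow rCol rCounter rOrder <|
  .seq finWeightProg (.store aMatrix (reg rCounter) (reg rWeight))

/-- Entries of the matrix above `rMaxDist` stand for infinite distances. -/
def outputEntryProg : Prog :=
  .seq (.assign rWeight (cell aMatrix (reg rRow * reg rOrder + reg rCol))) <|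
  .ite (.lt (reg rMaxDist) (reg rWeight))
    (.seq (.store aOutput (2 * reg rCounter) 0) (.store aOutput (2 * reg rCounter + 1) 0))
    (.seq (.store aOutput (2 * reg rCounter) 1)
      (.store aOutput (2 * reg rCounter + 1) (reg rWeight)))

def outputProg : Prog :=
  .forTo rCounter rGraphEntries <| .divMod rRow rCol rCounter rGraphOrder outputEntryProg

/-- The array `a` holds the entries of the matrix `D`, as in `HoldsMatrix`, that come before the
position `N` in row-major order. -/
def HoldsEntries (a : ℤ → ℤ) {n : ℕ} (N : ℕ) (D : Fin n → Fin n → WithTop ℤ) : Prop :=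
  ∀ i j : Fin n, (i : ℕ) * n + j < N →
    a (2 * (i * n + j : ℕ)) = (if D i j = ⊤ then 0 else 1) ∧
    a (2 * (i * n + j : ℕ) + 1) = (D i j).untopD 0

section HoldsEntries

variable {n N : ℕ} {a : ℤ → ℤ} {D : Fin n → Fin n → WithTop ℤ}

theorem HoldsEntries.succ (ha : HoldsEntries a N D) {i j : Fin n} (hN : (i : ℕ) * n + j = N) :
    HoldsEntries (Function.update (Function.update a (2 * N) (if D i j = ⊤ then 0 else 1))
      (2 * N + 1) ((D i j).untopD 0)) (N + 1) D := by
  intro i' j' hlt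
  rcases Nat.lt_succ_iff_lt_or_eq.1 hlt with hlt | heq
  · have ha' := ha i' j' hlt
    generalize (i' : ℕ) * n + j' = l at *
    iterate 4 rw [Function.update_of_ne (by omega)]
    exact ha'
  · obtain ⟨hi, hj⟩ := rowMajor_inj j'.2 j.2 (heq.trans hN.symm)
    obtain rfl := Fin.ext hi
    obtain rfl := Fin.ext hj
    rw [heq, Function.update_of_ne (by omega), Function.update_self, Function.update_self]
    exact ⟨rfl, rfl⟩

theorem HoldsEntries.holdsMatrix (ha : HoldsEntries a (n * n) D) : HoldsMatrix a 0 D := by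
  intro i j
  have ha' := ha i j (rowMajor_lt i.2 j.2)
  rw [Nat.cast_add, Nat.cast_mul] at ha'
  rwa [zero_add]

end HoldsEntries

section MatrixTransfer

variable {E : Env} {s : State} {G : WDigraph} {H q : ℤ} {i j k m n : ℕ}

theorem readEdgeProg_wp (ha : HoldsGraph (s.arr aInput) G) (hG : G.WeightsLE H) {i j : Fin G.n}
    (horder : s.reg rGraphOrder = G.n) (hrow : s.reg rRow = (i : ℕ)) (hcol : s.reg rCol = (j : ℕ))
    (hweight : s.reg rWeight = H) :
    WP E readEdgeProg s fun s' t => s'.reg rWeight = (G.w i j).untopD H ∧ t ≤ 25 := by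
  refine .of_bounded fun hs => ?_
  have hHB := hs.1 rWeight
  rw [hweight] at hHB
  obtain ⟨hflag, hvalue⟩ := ha.apply i j
  have hflag' : (cell aInput (2 * (reg rRow * reg rGraphOrder + reg rCol) + 1)).eval s =
      if G.w i j = ⊤ then 0 else 1 := by
    simpa [hrow, hcol, horder] using hflag
  have hvalue' : (cell aInput (2 * (reg rRow * reg rGraphOrder + reg rCol) + 2)).eval s =
      (G.w i j).untopD 0 := by
    simpa [hrow, hcol, horder] using hvalue
  have hflagB : -(E.B : ℤ) ≤ (if G.w i j = ⊤ then 0 else 1) ∧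
      (if G.w i j = ⊤ then 0 else 1) ≤ (E.B : ℤ) := by
    have := E.eight_le
    split_ifs <;> omega
  refine .ite ⟨by simp, fun _ => by rwa [← Expr.eval_cell, hflag']⟩ (fun hc => ?_) fun hc => ?_
  · obtain ⟨d, hd⟩ := WithTop.ne_top_iff_exists.1 fun htop => hc (by rw [hflag', if_pos htop])
    have hdB := abs_le.1 (hG hd.symm)
    rw [← hd, WithTop.untopD_coe] at hvalue' ⊢
    have hdB' : -(E.B : ℤ) ≤ d ∧ d ≤ E.B := by omega
    exact .assign ⟨by simp, fun _ => by rwa [← Expr.eval_cell, hvalue']⟩ (by rwa [hvalue'])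
      ⟨by rw [hvalue', State.reg_setReg, if_pos rfl], by decide⟩
  · have htop : G.w i j = ⊤ := by
      by_contra hne
      exact one_ne_zero (((hflag'.trans (if_neg hne)).symm).trans hc)
    exact .skip ⟨by rw [htop, WithTop.untopD_top, hweight], by decide⟩

theorem finWeightProg_wp (ha : HoldsGraph (s.arr aInput) G) (hG : G.WeightsLE H)
    (horder : s.reg rGraphOrder = G.n) (hmissing : s.reg rMissing = H) (hrow : s.reg rRow = i)
    (hcol : s.reg rCol = j) :
    WP E finWeightProg s fun s' t => s'.reg rWeight = G.finWeight H i j ∧ t ≤ 44 := by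
  refine .of_bounded fun hs => .assign_seq (by simp) (hs.1 rMissing) ?_
  refine .ite (by simp) (fun hc => ?_) fun hc => ?_
  · have hij : i ≠ j := by
      rintro rfl
      simp [hrow, hcol] at hc
    refine .ite_lt (by simp) (by simp) (fun hi => .ite_lt (by simp) (by simp) (fun hj => ?_)
      fun hj => .skip ⟨?_, by decide⟩) fun hi => .skip ⟨?_, by decide⟩
    · have hi' : i < G.n := by simpa [hrow, horder] using hi
      have hj' : j < G.n := by simpa [hcol, horder] using hj
      refine (readEdgeProg_wp (i := ⟨i, hi'⟩) (j := ⟨j, hj'⟩) (by simpa using ha) hG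
        (by simpa using horder) (by simpa using hrow) (by simpa using hcol)
        (by simpa using hmissing)).mono fun s' t _ _ ⟨hweight, _⟩ => ⟨?_, by simp; omega⟩
      rw [hweight, WDigraph.finWeight, if_neg hij, dif_pos ⟨hi', hj'⟩]
    · have hj' : G.n ≤ j := by simpa [hcol, horder] using hj
      simp [WDigraph.finWeight, hij, hj'.not_gt, hmissing]
    · have hi' : G.n ≤ i := by simpa [hrow, horder] using hi
      simp [WDigraph.finWeight, hij, hi'.not_gt, hmissing]
  · have hij : i = j := by
      have : (i : ℤ) - j = 0 := by simpa [hrow, hcol] using hc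
      omega
    exact .assign (by simp) (by simp) ⟨by simp [WDigraph.finWeight, hij], by decide⟩

theorem fillProg_wp (ha : HoldsGraph (s.arr aInput) G) (hG : G.WeightsLE H)
    (horder : s.reg rGraphOrder = G.n) (hm : s.reg rOrder = m) (hcells : s.reg rCells = (m * m : ℕ))
    (hmissing : s.reg rMissing = H) (hmatrix : ∀ c, |s.arr aMatrix c| ≤ H) :
    WP E fillProg s fun s' t =>
      (∀ i j : ℕ, i < m → j < m → mat (s'.arr aMatrix) m i j = G.finWeight H i j) ∧
      (∀ c, |s'.arr aMatrix c| ≤ H) ∧ t ≤ 70 * (m * m) + 6 := by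
  have hH : 0 ≤ H := (abs_nonneg _).trans (hmatrix 0)
  refine (WP.forTo_fill (r := aMatrix) (m * m) 62 (fun k => G.finWeight H (k / m) (k % m)) hcells
    (by decide) fun k s' hk hcounter hF => ?_).mono
    fun s' t _ _ ⟨hfilled, hsource, _⟩ => ⟨fun i j hi hj => ?_, fun c => ?_, by omega⟩
  · have hm0 : 0 < m := Nat.pos_of_ne_zero fun h => by simp [h] at hk
    refine .divMod (i := k / m) (j := k % m) (by rw [hcounter, Nat.div_add_mod'])
      ((hF.1 _ (by decide)).trans hm) (Nat.mod_lt _ hm0) (by decide) (.seq ?_)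
    refine (finWeightProg_wp (H := H) (i := k / m) (j := k % m)
      (by simpa [hF.2 aInput (by decide)] using ha) hG
      (by simpa [hF.1 rGraphOrder (by decide)] using horder)
      (by simpa [hF.1 rMissing (by decide)] using hmissing) (by simp) (by simp)).mono
      fun s'' t _ hF' ⟨hweight, _⟩ => .of_bounded fun hs => ?_
    have hcounter' : s''.reg rCounter = k := (hF'.1 _ (by decide)).trans (by simp [hcounter])
    have hmatrix' : s''.arr aMatrix = s'.arr aMatrix := hF'.2 _ (by decide)
    exact .store (by simp) (by simp) (hs.1 rWeight)
      ⟨by simp [hcounter', hmatrix', hweight], by simp; omega⟩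
  · rw [mat, ← Nat.cast_mul, ← Nat.cast_add, hfilled _ (rowMajor_lt hi hj), rowMajor_div hj,
      Nat.mul_add_mod', Nat.mod_eq_of_lt hj]
  · rcases hsource c with h | ⟨k, -, h⟩
    · exact h ▸ hmatrix c
    · exact h ▸ hG.abs_finWeight_le le_rfl hH _ _

theorem outputEntryProg_wp {d : ℤ} (hm : s.reg rOrder = m) (hrow : s.reg rRow = i)
    (hcol : s.reg rCol = j) (hcounter : s.reg rCounter = k) (hmax : s.reg rMaxDist = q)
    (hd : mat (s.arr aMatrix) m i j = d) {x : WithTop ℤ}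
    (hx : x = if d ≤ q then (d : WithTop ℤ) else ⊤) :
    WP E outputEntryProg s fun s' t => s'.arr aOutput = Function.update (Function.update
      (s.arr aOutput) (2 * k) (if x = ⊤ then 0 else 1)) (2 * k + 1) (x.untopD 0) ∧ t ≤ 31 := by
  subst hx
  refine .of_bounded fun hs => ?_
  have heval : (cell aMatrix (reg rRow * reg rOrder + reg rCol)).eval s = d := by
    simpa [hrow, hm, hcol, mat] using hd
  have hdB := hs.2 aMatrix (by decide) (by decide) (i * m + j)
  rw [show s.arr aMatrix (i * m + j) = d from hd] at hdB
  refine .assign_seq (by simp) (by rwa [heval]) ?_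
  rw [heval]
  refine .ite_lt (by simp) (by simp) (fun hc => ?_) fun hc => ?_
  · have hlt : ¬ d ≤ q := by simpa [hmax] using hc
    rw [if_neg hlt]
    refine .store_seq (by simp) (by simp) (by simp) ?_
    exact .store (by simp) (by simp) (by simp) ⟨by simp [hcounter], by decide⟩
  · have hle : d ≤ q := by simpa [hmax] using hc
    rw [if_pos hle]
    have := E.eight_le
    refine .store_seq (by simp) (by simp) (by simp; omega) ?_
    exact .store (by simp) (by simp) (by simpa using hdB) ⟨by simp [hcounter], by decide⟩

theorem outputProg_wp {A : ℕ → ℕ → ℤ} (horder : s.reg rGraphOrder = n) (hm : s.reg rOrder = m)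
    (hentries : s.reg rGraphEntries = (n * n : ℕ)) (hmax : s.reg rMaxDist = q)
    (hA : ∀ i j : ℕ, i < n → j < n → mat (s.arr aMatrix) m i j = A i j) :
    WP E outputProg s fun s' t => HoldsMatrix (s'.arr aOutput) 0
      (fun u v : Fin n => if A u v ≤ q then (A u v : WithTop ℤ) else ⊤) ∧
      t ≤ 50 * (n * n) + 6 := by
  refine .forTo_le (n * n) 42 (fun k s' => HoldsEntries (s'.arr aOutput) k
    fun u v : Fin n => if A u v ≤ q then (A u v : WithTop ℤ) else ⊤) hentries (by decide)
    (fun _ _ h => absurd h (Nat.not_lt_zero _)) ?_ ?_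
  · intro k s' hk hheld hcounter hF
    obtain ⟨i, j, hkij, -⟩ := exists_rowMajor hk
    refine .divMod (by rw [hcounter, hkij]) ((hF.1 _ (by decide)).trans horder) j.2 (by decide) ?_
    refine (outputEntryProg_wp (k := k) (i := i) (j := j) (q := q) (d := A i j)
      (by simpa [hF.1 rOrder (by decide)] using hm) (by simp) (by simp) (by simpa using hcounter)
      (by simpa [hF.1 rMaxDist (by decide)] using hmax)
      (by simpa [hF.2 aMatrix (by decide)] using hA i j i.2 j.2) rfl).mono
      fun s'' t _ _ ⟨houtput, _⟩ => ⟨by omega, ?_⟩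
    rw [State.arr_setReg, houtput]
    exact hheld.succ hkij
  · exact fun s' t hheld _ _ ht => ⟨hheld.holdsMatrix, by omega⟩

end MatrixTransfer

/-! ### All-pairs shortest paths -/

theorem IsMinWalk.congr {W A A' : ℕ → ℕ → ℤ} {m k : ℕ} (hA : IsMinWalk W m k A)
    (h : ∀ i j, i < m → j < m → A' i j = A i j) : IsMinWalk W m k A' := fun i j hi hj => by
  rw [h i j hi hj]
  exact hA i j hi hj

/-- A bound for the entries of the matrices in the repeated squaring for a graph with `n` vertices
and weights at most `w`. -/
def entryBound (n w : ℕ) : ℕ := (2 * n + 1) * (2 * ((2 * n + 1) * (n * n * w ^ 2)) + 1)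

/-- The parameters of the repeated squaring: after `e` squarings the minima are over walks with
`2 ^ e` steps, missing edges get the weight `2 * (2 ^ e * M) + 1`, which exceeds all finite
distances, and all entries stay below `2 ^ f`. -/
structure Scales (E : Env) (G : WDigraph) (M : ℤ) (e f : ℕ) : Prop where
  weightsLE : G.WeightsLE M
  nonneg : 0 ≤ M
  le_steps : (G.n : ℤ) ≤ 2 ^ e
  range_lt : 2 ^ e * (2 * (2 ^ e * M) + 1) < (2 : ℤ) ^ f
  bound_le : 12 * (2 : ℤ) ^ f ≤ E.B

/-- The registers hold the parameters of the repeated squaring for the graph in `aInput`. -/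
structure Prepared (G : WDigraph) (M : ℤ) (e f : ℕ) (s : State) : Prop where
  input : HoldsGraph (s.arr aInput) G
  order : s.reg rGraphOrder = G.n
  entries : s.reg rGraphEntries = (G.n * G.n : ℕ)
  maxDist : s.reg rMaxDist = 2 ^ e * M
  missing : s.reg rMissing = 2 * (2 ^ e * M) + 1
  squarings : s.reg rSquarings = e
  bound : s.reg rBound = 2 ^ f
  phases : s.reg rPhases = (f + 1 : ℕ)

abbrev preparedRegs : List ℕ :=
  [rGraphOrder, rGraphEntries, rMaxDist, rMissing, rSquarings, rBound, rPhases]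

theorem Prepared.congr {G : WDigraph} {M : ℤ} {e f : ℕ} {s s' : State} (h : Prepared G M e f s)
    (hregs : ∀ x ∈ preparedRegs, s'.reg x = s.reg x) (hinput : s'.arr aInput = s.arr aInput) :
    Prepared G M e f s' where
  input := hinput ▸ h.input
  order := (hregs _ (by decide)).trans h.order
  entries := (hregs _ (by decide)).trans h.entries
  maxDist := (hregs _ (by decide)).trans h.maxDist
  missing := (hregs _ (by decide)).trans h.missing
  squarings := (hregs _ (by decide)).trans h.squarings
  bound := (hregs _ (by decide)).trans h.bound
  phases := (hregs _ (by decide)).trans h.phases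

def rangeProg : Prog :=
  .seq (.assign rMaxDist (reg rSteps * reg rNorm)) <|
  .seq (.assign rMissing (reg rMaxDist + reg rMaxDist + 1))
    (.assign rRange (reg rSteps * reg rMissing + 1))

/-- Compute the parameters in `Scales`. -/
def boundsProg : Prog :=
  .seq normProg <| .seq (powerProg rSteps rSquarings rGraphOrder) <| .seq rangeProg <|
  .seq (powerProg rBound rPhases rRange) (.assign rPhases (reg rPhases + 1))

/-- Choose the block side and write the weight matrix to `aMatrix`. -/
def setupProg : Prog := .seq rootProg <| .seq sizeProg fillProg

def squaringProg : Prog := .forTo rCounter rSquarings squareProg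

/-- Compute all distances with calls to an oracle for `CoDiameter`. -/
def apspProg : Prog :=
  .seq (.assign rGraphOrder (cell aInput 0)) <| .seq boundsProg <| .seq setupProg <|
  .seq squaringProg outputProg

section Scales

variable {E : Env} {G : WDigraph} {M : ℤ} {e f : ℕ}

theorem Scales.missing_nonneg (h : Scales E G M e f) : 0 ≤ 2 * (2 ^ e * M) + 1 := by
  have := h.nonneg
  positivity

theorem Scales.missing_le (h : Scales E G M e f) : 2 * (2 ^ e * M) + 1 ≤ 2 ^ f :=
  (le_mul_of_one_le_left h.missing_nonneg (one_le_pow₀ (by norm_num))).trans h.range_lt.le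

theorem Scales.le_missing (h : Scales E G M e f) : M ≤ 2 * (2 ^ e * M) + 1 := by
  have := h.nonneg
  have : M ≤ 2 ^ e * M := le_mul_of_one_le_left h.nonneg (one_le_pow₀ (by norm_num))
  omega

end Scales

section Bounds

variable {E : Env} {s : State} {G : WDigraph}

theorem rangeProg_wp {N M : ℤ} (hsteps : s.reg rSteps = N) (hnorm : s.reg rNorm = M)
    (hN : 1 ≤ N) (hM : 0 ≤ M) (hB : N * (2 * (N * M) + 1) + 1 ≤ E.B) :
    WP E rangeProg s fun s' t => s'.reg rMaxDist = N * M ∧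
      s'.reg rMissing = 2 * (N * M) + 1 ∧ s'.reg rRange = N * (2 * (N * M) + 1) + 1 ∧ t ≤ 30 := by
  have hdist : 0 ≤ N * M := by positivity
  have hrange : 2 * (N * M) + 1 ≤ N * (2 * (N * M) + 1) := le_mul_of_one_le_left (by omega) hN
  refine .assign_seq (by simp) (by simp [hsteps, hnorm]; omega) ?_
  refine .assign_seq (by simp) (by simp [hsteps, hnorm]; omega) ?_
  have hmissing : N * M + N * M + 1 = 2 * (N * M) + 1 := by ring
  refine .assign (by simp) (by simp [hsteps, hnorm, hmissing]; omega) ?_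
  simp [hsteps, hnorm, hmissing]

theorem range_le_entryBound {n w : ℕ} {N M : ℤ} (hN : 0 ≤ N) (hNn : N ≤ 2 * n + 1)
    (hM : 0 ≤ M) (hMw : M ≤ (n * n * w ^ 2 : ℕ)) :
    N * (2 * (N * M) + 1) ≤ entryBound n w := by
  rw [entryBound]
  push_cast at hMw ⊢
  gcongr

theorem boundsProg_wp (ha : HoldsGraph (s.arr aInput) G) (horder : s.reg rGraphOrder = G.n)
    (hnorm : s.reg rNorm = 0) (hn : 64 * (G.n + 1) * (G.n + 1) ≤ E.B)
    (hB : 12 * (2 * (entryBound G.n G.maxWeight + 1) + 1) ≤ E.B) :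
    WP E boundsProg s fun s' t => ∃ (M : ℤ) (e f : ℕ), Scales E G M e f ∧ Prepared G M e f s' ∧
      2 ^ e ≤ 2 * G.n + 1 ∧ t ≤ 30 * (G.n * G.n) + 12 * e + 12 * f + 70 := by
  have hverts : 2 * G.n + 1 ≤ E.B := by nlinarith
  refine .of_frame ?_
  have hcells : G.n * G.n ≤ E.B := by nlinarith
  have hdist : G.n * G.n * G.maxWeight ^ 2 ≤ entryBound G.n G.maxWeight := by
    rw [entryBound]
    nlinarith [Nat.zero_le (G.n * (G.n * G.n * G.maxWeight ^ 2)), Nat.zero_le (G.n * G.n)]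
  refine .seq ((normProg_wp ha horder hnorm hcells (by omega)).mono ?_)
  rintro s₁ t₁ - hF₁ ⟨hentries, hnorm₁, ht₁⟩
  have horder₁ : s₁.reg rGraphOrder = G.n := (hF₁.1 _ (by decide)).trans horder
  refine .seq ((powerProg_wp (by decide) (by decide) (by decide) (by omega)
    (by omega)).mono ?_)
  rintro s₂ t₂ - hF₂ ⟨e, hsteps, hsquarings, hne, hen, ht₂⟩
  rw [horder₁] at hne hen
  have hM0 := squareSum_nonneg (a := s.arr aInput) (k := G.n * G.n)
  have hrange := range_le_entryBound (by positivity) hen hM0 (ha.squareSum_le le_rfl)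
  refine .seq ((rangeProg_wp hsteps ((hF₂.1 _ (by decide)).trans hnorm₁)
    (one_le_pow₀ (by norm_num)) hM0 (by omega)).mono ?_)
  rintro s₃ t₃ - hF₃ ⟨hmaxDist, hmissing, hrange₃, ht₃⟩
  refine .seq ((powerProg_wp (by decide) (by decide) (by decide) (by rw [hrange₃]; positivity)
    (by omega)).mono ?_)
  rintro s₄ t₄ - hF₄ ⟨f, hbound, hphases, hlef, hfle, ht₄⟩
  have hlt : (f : ℤ) < 2 ^ f := by exact_mod_cast f.lt_two_pow_self
  rw [hrange₃] at hlef hfle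
  refine .assign (by simp) (by simp [hphases]; omega) fun hF => ⟨_, e, f,
    ⟨ha.weightsLE_squareSum, hM0, hne, by omega, by omega⟩, ⟨?_, ?_, ?_, ?_, ?_, ?_, ?_, ?_⟩,
    by exact_mod_cast hen, ?_⟩
  · rwa [hF.2 _ (by decide)]
  · exact (hF.1 _ (by decide)).trans horder
  · exact (hF₄.1 _ (by decide)).trans <| (hF₃.1 _ (by decide)).trans <|
      (hF₂.1 _ (by decide)).trans hentries
  · exact (hF₄.1 _ (by decide)).trans hmaxDist
  · exact (hF₄.1 _ (by decide)).trans hmissing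
  · exact (hF₄.1 _ (by decide)).trans <| (hF₃.1 _ (by decide)).trans hsquarings
  · exact hbound
  · simp [hphases]
  · simp; omega

theorem setup_wp {M : ℤ} {e f : ℕ} (hscales : Scales E G M e f) (hs : Prepared G M e f s)
    (hside : s.reg rSide = 0) (hmatrix : ∀ c, s.arr aMatrix c = 0)
    (hestimate : ∀ c, s.arr aEstimate c = 0) (hn : 64 * (G.n + 1) * (G.n + 1) ≤ E.B) :
    WP E setupProg s fun s' t => ∃ σ, NearCubeRoot G.n σ ∧ Work E σ f s' ∧ Prepared G M e f s' ∧
      (∀ i j : ℕ, i < σ ^ 3 → j < σ ^ 3 → mat (s'.arr aMatrix) (σ ^ 3 : ℕ) i j =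
        G.finWeight (2 * (2 ^ e * M) + 1) i j) ∧
      t ≤ 12 * G.n + 70 * (σ ^ 3 * σ ^ 3) + 60 := by
  have hmissing0 := hscales.missing_nonneg
  have hmissing := hscales.missing_le
  have hbound := hscales.bound_le
  refine .of_frame ?_
  refine .seq ((rootProg_wp hside hs.order).mono ?_)
  rintro s₁ t₁ - hF₁ ⟨σ, hσ, hside₁, ht₁⟩
  refine .seq ((sizeProg_wp hside₁ ((hF₁.1 _ (by decide)).trans hs.bound) (by positivity)
    (by omega) hσ hn).mono ?_)
  rintro s₂ t₂ - hF₂ ⟨hsizes, ht₂⟩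
  have hmatrix₂ (c : ℤ) : s₂.arr aMatrix c = 0 := by
    rw [hF₂.2 _ (by decide), hF₁.2 _ (by decide), hmatrix]
  have hs₂ : Prepared G M e f s₂ := hs.congr
    (fun x hx => (hF₂.1 x (by revert x; decide)).trans (hF₁.1 x (by revert x; decide)))
    ((hF₂.2 _ (by decide)).trans (hF₁.2 _ (by decide)))
  refine (fillProg_wp hs₂.input (fun u v d hd => (hscales.weightsLE hd).trans hscales.le_missing)
    hs₂.order hsizes.order hsizes.cells hs₂.missing
    fun c => by rwa [hmatrix₂, abs_zero]).mono ?_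
  rintro s₃ t₃ - hF₃ ⟨hentries, hle, ht₃⟩ hF
  have hs₃ : Prepared G M e f s₃ :=
    hs.congr (fun x hx => hF.1 x (by revert x; decide)) (hF.2 _ (by decide))
  refine ⟨σ, hσ, ⟨⟨hsizes.congr fun x hx => hF₃.1 x (by revert x; decide), by positivity, hbound,
    hσ.graphCells_le.trans hn, fun c => abs_le.1 ((hle c).trans hmissing), fun c => ?_⟩,
    hs₃.bound, hs₃.phases⟩, hs₃, hentries, by omega⟩
  rw [hF.2 _ (by decide), hestimate]
  constructor <;> omega

theorem Work.setReg_counter {σ f : ℕ} {v : ℤ} (hs : Work E σ f s) :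
    Work E σ f (s.setReg rCounter v) where
  toStored := hs.toStored.congr
    (fun x hx => by rw [State.reg_setReg, if_neg (by revert x; decide)]) hs.matrix hs.estimate
  bound := by simpa using hs.bound
  phases := by simpa using hs.phases

theorem squaring_wp {σ τ e f : ℕ} {H : ℤ} {W : ℕ → ℕ → ℤ}
    (hsolves : SolvesCoDiameter E (4 * σ + 1) τ) (hs : Work E σ f s)
    (hsquarings : s.reg rSquarings = e) (hH : ∀ i j, |W i j| ≤ H) (hHf : 2 ^ e * H < 2 ^ f)
    (hW : ∀ i j : ℕ, i < σ ^ 3 → j < σ ^ 3 → mat (s.arr aMatrix) (σ ^ 3 : ℕ) i j = W i j) :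
    WP E squaringProg s fun s' t => Work E σ f s' ∧
      IsMinWalk W (σ ^ 3) (2 ^ e) (fun i j => mat (s'.arr aMatrix) (σ ^ 3 : ℕ) i j) ∧
      t ≤ e * (squareTime σ τ f + 8) + 6 := by
  have hH0 : 0 ≤ H := (abs_nonneg _).trans (hH 0 0)
  refine .forTo_le e (squareTime σ τ f) (fun k s' => Work E σ f s' ∧
    IsMinWalk W (σ ^ 3) (2 ^ k) (fun i j => mat (s'.arr aMatrix) (σ ^ 3 : ℕ) i j)) hsquarings
    (by decide) ⟨hs.setReg_counter, (isMinWalk_one W _).congr hW⟩ ?_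
    fun s' t ⟨hs', hwalk⟩ _ _ ht => ⟨hs', hwalk, ht⟩
  rintro k s₁ hk ⟨hs₁, hwalk⟩ - -
  obtain ⟨C, hC⟩ := exists_isMinPlusSq (σ ^ 3) (fun i j => mat (s₁.arr aMatrix) (σ ^ 3 : ℕ) i j)
  have hsq : IsMinWalk W (σ ^ 3) (2 ^ (k + 1)) C := by
    rw [pow_succ 2, mul_two]
    exact hwalk.sq hC
  have hCbound (i j : ℕ) (hi : i < σ ^ 3) (hj : j < σ ^ 3) : |C i j| < 2 ^ f :=
    calc |C i j| ≤ (2 ^ (k + 1) : ℕ) * H := (hsq i j hi hj).1.abs_le hH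
      _ ≤ 2 ^ e * H := by
        gcongr
        exact_mod_cast Nat.pow_le_pow_right two_pos hk
      _ < 2 ^ f := hHf
  refine (squareProg_wp hsolves hs₁ hC fun i j hi hj => ?_).mono
    fun s₂ t₂ _ _ ⟨hs₂, hmat, ht⟩ => ⟨ht, hs₂.setReg_counter, hsq.congr hmat⟩
  exact ⟨(abs_lt.1 (hCbound i j hi hj)).1.le, (abs_lt.1 (hCbound i j hi hj)).2⟩

end Bounds

theorem solvesCoDiameter {O : CoDiameter.Inst → ℤ → ℤ} {T : ℕ → ℕ → ℕ} {W B v τ : ℕ} (h8 : 8 ≤ B)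
    (hW : B ^ 40 ≤ W) (hO : IsOracle CoDiameter O) (hT : ∀ M ≤ B, T v M ≤ τ) :
    SolvesCoDiameter ⟨CoDiameter, O, T, W, B, h8, hW⟩ v τ := by
  intro s G hv hM ha
  refine .call G ha ⟨hO G, Nat.add_le_add_left ?_ 1⟩
  change T (CoDiameter.size G) (CoDiameter.weight G) ≤ τ
  rw [hv]
  exact hT _ hM

theorem apspProg_wp {O : CoDiameter.Inst → ℤ → ℤ} {T : ℕ → ℕ → ℕ} {W B : ℕ} {τ : ℕ → ℕ}
    (h8 : 8 ≤ B) (hW : B ^ 40 ≤ W) (hO : IsOracle CoDiameter O) (G : WDigraph)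
    (hG : G.NoNegCycle) (hT : ∀ σ M, G.n ≤ σ ^ 3 → M ≤ B → T (4 * σ + 1) M ≤ τ σ) {a : ℤ → ℤ}
    (ha : HoldsGraph a G) (hn : 64 * (G.n + 1) * (G.n + 1) ≤ B)
    (hB : 12 * (2 * (entryBound G.n G.maxWeight + 1) + 1) ≤ B) :
    WP ⟨CoDiameter, O, T, W, B, h8, hW⟩ apspProg (State.start a) fun s t =>
      APSP.Output ⟨G, hG⟩ (s.arr aOutput) ∧ ∃ σ e f : ℕ, σ ^ 3 ≤ 8 * G.n ∧ 2 ^ e ≤ 2 * G.n + 1 ∧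
        2 ^ f ≤ B ∧ t ≤ 12 * G.n + 80 * (G.n * G.n) + 12 * e + 12 * f + 70 * (σ ^ 3 * σ ^ 3) +
          e * (squareTime σ (τ σ) f + 8) + 160 := by
  have hverts : G.n ≤ B := by nlinarith
  refine .assign_natCast_seq (k := G.n) ?_ ha.1 hverts ?_
  · simp [State.start, ha.1]; omega
  refine .seq ((boundsProg_wp (s := (State.start a).setReg rGraphOrder G.n) (G := G) ha (by simp)
    rfl hn hB).mono ?_)
  rintro s₁ t₁ - hF₁ ⟨M, e, f, hscales, hs₁, hen, ht₁⟩
  have harr₁ (r : ℕ) (hr : r ∉ 0 :: boundsProg.arrs) (c : ℤ) : s₁.arr r c = 0 := by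
    rw [hF₁.2 r (List.not_mem_of_not_mem_cons hr)]
    simp [State.start, List.ne_of_not_mem_cons hr]
  refine .seq ((setup_wp hscales hs₁ (hF₁.1 _ (by decide)) (harr₁ _ (by decide))
    (harr₁ _ (by decide)) hn).mono ?_)
  rintro s₂ t₂ - - ⟨σ, hσ, hwork₂, hs₂, hentries₂, ht₂⟩
  have hsolves : SolvesCoDiameter ⟨CoDiameter, O, T, W, B, h8, hW⟩ (4 * σ + 1) (τ σ) :=
    solvesCoDiameter h8 hW hO fun M hM => hT σ M hσ.le_cube hM
  refine .seq ((squaring_wp hsolves hwork₂ hs₂.squarings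
    (hscales.weightsLE.abs_finWeight_le hscales.le_missing hscales.missing_nonneg)
    hscales.range_lt hentries₂).mono ?_)
  rintro s₃ t₃ - hF₃ ⟨hwork₃, hwalk, ht₃⟩
  have hs₃ : Prepared G M e f s₃ :=
    hs₂.congr (fun x hx => hF₃.1 x (by revert x; decide)) (hF₃.2 _ (by decide))
  have hdist := WDigraph.isDist_of_isMinWalk (N := 2 ^ e) hG hscales.weightsLE hscales.nonneg
    (by exact_mod_cast hscales.le_steps) hσ.le_cube (by push_cast; exact hwalk)
  refine (outputProg_wp hs₃.order hwork₃.sizes.order hs₃.entries hs₃.maxDist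
    fun i j _ _ => rfl).mono ?_
  rintro s₄ t₄ - - ⟨hout, ht₄⟩
  have hfB : 12 * (2 : ℤ) ^ f ≤ B := hscales.bound_le
  refine ⟨⟨_, hdist, by exact_mod_cast hout⟩, σ, e, f, hσ.cube_le, hen, ?_, ?_⟩
  · zify
    linarith [pow_pos (two_pos (α := ℤ)) f]
  · simp only [Expr.cost_cell, Expr.cost_ofNat]
    omega

/-! ### The running time -/

theorem exists_exponent_le (b : ℕ) {η : ℝ} (hη : 0 < η) :
    ∃ L ≥ 0, ∀ n e : ℕ, 2 ^ e ≤ (n + 2) ^ b → (e : ℝ) ≤ L * ((n : ℝ) + 1) ^ η := by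
  refine ⟨2 * b * (1 + 1 / η), by positivity, fun n e h => ?_⟩
  obtain ⟨y, hy⟩ : ∃ y, y = (n : ℝ) + 1 := ⟨_, rfl⟩
  rw [← hy]
  have hy1 : 1 ≤ y := by linarith [n.cast_nonneg (α := ℝ)]
  have hpow : (2 : ℝ) ^ e ≤ (2 * y) ^ b :=
    calc (2 : ℝ) ^ e ≤ ((n : ℝ) + 2) ^ b := by exact_mod_cast h
      _ ≤ (2 * y) ^ b := by gcongr; linarith
  have hlog := Real.log_le_log (by positivity) hpow
  rw [Real.log_pow, Real.log_pow, Real.log_mul (by norm_num) (by positivity)] at hlog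
  have hlog_two : e * (1 / 2) ≤ e * Real.log 2 := by
    gcongr
    linarith [Real.log_two_gt_d9]
  have hlog_y : Real.log 2 + Real.log y ≤ (1 + 1 / η) * y ^ η := by
    rw [add_mul, one_div_mul_eq_div]
    linarith [Real.log_le_rpow_div (by positivity : 0 ≤ y) hη, Real.log_two_lt_d9,
      Real.one_le_rpow hy1 hη.le]
  have := mul_le_mul_of_nonneg_left hlog_y b.cast_nonneg
  linarith

section Time

variable {y z C ε L : ℝ} {σ τ n e f t : ℕ}

theorem cost_le_rpow (hz : 1 ≤ z) (hε0 : 0 < ε) (hε1 : ε ≤ 1) (hC : 0 ≤ C) (hσ : σ ≤ 2 * z)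
    (hτ : τ ≤ C * (4 * σ + 2) ^ (3 - ε)) : τ ≤ 1000 * C * z ^ (3 - ε) := by
  have hten : (10 : ℝ) ^ (3 - ε) ≤ 1000 :=
    calc (10 : ℝ) ^ (3 - ε) ≤ 10 ^ (3 : ℝ) :=
          Real.rpow_le_rpow_of_exponent_le (by norm_num) (by linarith)
      _ = 1000 := by norm_num
  calc (τ : ℝ) ≤ C * (4 * σ + 2) ^ (3 - ε) := hτ
    _ ≤ C * (10 * z) ^ (3 - ε) := by gcongr <;> linarith
    _ = C * (10 ^ (3 - ε) * z ^ (3 - ε)) := by rw [Real.mul_rpow (by norm_num) (by positivity)]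
    _ ≤ C * (1000 * z ^ (3 - ε)) := by gcongr
    _ = 1000 * C * z ^ (3 - ε) := by ring

theorem searchTime_le (hz : 1 ≤ z) (hε0 : 0 < ε) (hε1 : ε ≤ 1) (hC : 0 ≤ C) (hσ : σ ≤ 2 * z)
    (hτ : τ ≤ C * (4 * σ + 2) ^ (3 - ε)) :
    searchTime σ τ ≤ (10000 + 1000 * C) * z ^ (3 - ε) := by
  have hcost := cost_le_rpow hz hε0 hε1 hC hσ hτ
  have hsq : z ^ 2 ≤ z ^ (3 - ε) := sq_le_rpow hz (by linarith)
  have hone : 1 ≤ z ^ 2 := one_le_pow₀ hz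
  have hcells : (4 * (σ : ℝ) + 1) * (4 * σ + 1) ≤ 81 * z ^ 2 :=
    calc (4 * (σ : ℝ) + 1) * (4 * σ + 1) ≤ 9 * z * (9 * z) := by gcongr <;> linarith
      _ = 81 * z ^ 2 := by ring
  have hpairs : (σ : ℝ) * σ ≤ 4 * z ^ 2 :=
    calc (σ : ℝ) * σ ≤ 2 * z * (2 * z) := by gcongr
      _ = 4 * z ^ 2 := by ring
  rw [searchTime]
  push_cast
  linarith

theorem squareTime_le_of_root (hz : 1 ≤ z) (hε0 : 0 < ε) (hε1 : ε ≤ 1) (hC : 0 ≤ C)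
    (hσ : σ ≤ 2 * z) (hτ : τ ≤ C * (4 * σ + 2) ^ (3 - ε)) :
    squareTime σ τ f ≤ (f + 1) * (2000000 + 192000 * C) * z ^ (9 - ε) := by
  have hexp : z ^ (9 - ε) = z ^ (3 - ε) * z ^ 6 := by
    rw [← Real.rpow_natCast z 6, ← Real.rpow_add (by positivity)]
    congr 1
    norm_num
    ring
  have hone : 1 ≤ z ^ 6 := one_le_pow₀ hz
  have hsix : z ^ 6 ≤ z ^ (9 - ε) := by
    rw [hexp]
    exact le_mul_of_one_le_left (by positivity) (Real.one_le_rpow hz (by linarith))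
  have hcells : (σ : ℝ) ^ 3 * σ ^ 3 ≤ 64 * z ^ 6 :=
    calc (σ : ℝ) ^ 3 * σ ^ 3 ≤ (2 * z) ^ 3 * (2 * z) ^ 3 := by gcongr
      _ = 64 * z ^ 6 := by ring
  have hsearch : searchTime σ τ * (3 * ((σ : ℝ) ^ 3 * σ ^ 3)) ≤
      (1920000 + 192000 * C) * z ^ (9 - ε) :=
    calc searchTime σ τ * (3 * ((σ : ℝ) ^ 3 * σ ^ 3))
        ≤ (10000 + 1000 * C) * z ^ (3 - ε) * (3 * (64 * z ^ 6)) := by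
          gcongr
          exact searchTime_le hz hε0 hε1 hC hσ hτ
      _ = (1920000 + 192000 * C) * z ^ (9 - ε) := by rw [hexp]; ring
  rw [squareTime]
  push_cast
  calc (f + 1 : ℝ) * (searchTime σ τ * (3 * (σ ^ 3 * σ ^ 3)) + 60 * (σ ^ 3 * σ ^ 3) + 20) +
        40 * (σ ^ 3 * σ ^ 3) + 30
      ≤ (f + 1) * ((1940000 + 192000 * C) * z ^ (9 - ε)) + 1 * (60000 * z ^ (9 - ε)) := by
        rw [add_assoc _ (40 * _)]
        gcongr <;> linarith
    _ ≤ (f + 1) * ((1940000 + 192000 * C) * z ^ (9 - ε)) + (f + 1) * (60000 * z ^ (9 - ε)) := by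
        gcongr
        linarith [f.cast_nonneg (α := ℝ)]
    _ = (f + 1) * (2000000 + 192000 * C) * z ^ (9 - ε) := by ring

theorem squareTime_le (hy : 1 ≤ y) (hε0 : 0 < ε) (hε1 : ε ≤ 1) (hC : 0 ≤ C)
    (hσ : (σ : ℝ) ^ 3 ≤ 8 * y) (hτ : τ ≤ C * (4 * σ + 2) ^ (3 - ε)) :
    squareTime σ τ f ≤ (f + 1) * (2000000 + 192000 * C) * y ^ (3 - ε / 3) := by
  obtain ⟨z, hz, rfl⟩ : ∃ z, 1 ≤ z ∧ z ^ 3 = y :=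
    ⟨y ^ (3⁻¹ : ℝ), Real.one_le_rpow hy (by norm_num), Real.rpow_inv_natCast_pow (by linarith)
      three_ne_zero⟩
  have hσz : σ ≤ 2 * z :=
    le_of_pow_le_pow_left₀ three_ne_zero (by positivity) (by rw [mul_pow]; linarith)
  have hexp : (z ^ 3) ^ (3 - ε / 3) = z ^ (9 - ε) := by
    rw [← Real.rpow_natCast, ← Real.rpow_mul (by positivity)]
    congr 1
    push_cast
    ring
  rw [hexp]
  exact squareTime_le_of_root hz hε0 hε1 hC hσz hτ

theorem squarings_time_le (hy : 1 ≤ y) (hε0 : 0 < ε) (hε1 : ε ≤ 1) (hC : 0 ≤ C) (hL : 0 ≤ L)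
    (hσ : (σ : ℝ) ^ 3 ≤ 8 * y) (hτ : τ ≤ C * (4 * σ + 2) ^ (3 - ε))
    (he : e ≤ L * y ^ (ε / 12)) (hf : f ≤ L * y ^ (ε / 12)) :
    e * (squareTime σ τ f + 8 : ℝ) ≤
      L * ((L + 1) * (2000000 + 192000 * C) + 8) * y ^ (3 - ε / 6) := by
  set g := y ^ (ε / 12)
  have hg : 1 ≤ g := Real.one_le_rpow hy (by positivity)
  have hg_le : g ≤ y ^ (3 - ε / 6) := Real.rpow_le_rpow_of_exponent_le hy (by linarith)
  have hexp : g * g * y ^ (3 - ε / 3) = y ^ (3 - ε / 6) := by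
    rw [← Real.rpow_add (by linarith), ← Real.rpow_add (by linarith)]
    congr 1
    ring
  have hsquare : squareTime σ τ f ≤ (L + 1) * g * (2000000 + 192000 * C) * y ^ (3 - ε / 3) :=
    (squareTime_le hy hε0 hε1 hC hσ hτ).trans (by gcongr; linarith)
  calc e * (squareTime σ τ f + 8 : ℝ)
      ≤ L * g * ((L + 1) * g * (2000000 + 192000 * C) * y ^ (3 - ε / 3) + 8) := by gcongr
    _ = L * ((L + 1) * (2000000 + 192000 * C) * (g * g * y ^ (3 - ε / 3)) + 8 * g) := by ring
    _ ≤ L * ((L + 1) * (2000000 + 192000 * C) * y ^ (3 - ε / 6) + 8 * y ^ (3 - ε / 6)) := by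
        rw [hexp]
        gcongr
    _ = L * ((L + 1) * (2000000 + 192000 * C) + 8) * y ^ (3 - ε / 6) := by ring

theorem apsp_time_le (hε0 : 0 < ε) (hε1 : ε ≤ 1) (hC : 0 ≤ C) (hL : 0 ≤ L) (hσ : σ ^ 3 ≤ 8 * n)
    (hτ : τ ≤ C * (4 * σ + 2) ^ (3 - ε)) (he : e ≤ L * ((n : ℝ) + 1) ^ (ε / 12))
    (hf : f ≤ L * ((n : ℝ) + 1) ^ (ε / 12))
    (ht : t ≤ 12 * n + 80 * (n * n) + 12 * e + 12 * f + 70 * (σ ^ 3 * σ ^ 3) +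
      e * (squareTime σ τ f + 8) + 160) :
    t ≤ (5000 + 24 * L + L * ((L + 1) * (2000000 + 192000 * C) + 8)) *
      ((n : ℝ) + 1) ^ (3 - ε / 6) := by
  obtain ⟨y, hy⟩ : ∃ y, y = (n : ℝ) + 1 := ⟨_, rfl⟩
  rw [← hy] at he hf ⊢
  have hy1 : 1 ≤ y := by linarith [n.cast_nonneg (α := ℝ)]
  have hσ' : (σ : ℝ) ^ 3 ≤ 8 * y := by
    have : (σ : ℝ) ^ 3 ≤ 8 * n := by exact_mod_cast hσ
    linarith
  have hsquarings := squarings_time_le hy1 hε0 hε1 hC hL hσ' hτ he hf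
  have hlog : L * y ^ (ε / 12) ≤ L * y ^ (3 - ε / 6) := by
    gcongr
    linarith
  have hsq : y ^ 2 ≤ y ^ (3 - ε / 6) := sq_le_rpow hy1 (by linarith)
  have hn : (n : ℝ) ≤ y ^ 2 := by nlinarith
  have hnn : (n : ℝ) * n ≤ y ^ 2 := by nlinarith
  have hone : 1 ≤ y ^ 2 := one_le_pow₀ hy1
  have hcells : (σ : ℝ) ^ 3 * σ ^ 3 ≤ 64 * y ^ 2 :=
    calc (σ : ℝ) ^ 3 * σ ^ 3 ≤ 8 * y * (8 * y) := by gcongr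
      _ = 64 * y ^ 2 := by ring
  calc (t : ℝ) ≤ 12 * n + 80 * (n * n) + 12 * e + 12 * f + 70 * (σ ^ 3 * σ ^ 3) +
        e * (squareTime σ τ f + 8) + 160 := by exact_mod_cast ht
    _ ≤ _ := by linarith

end Time

theorem entryBound_le {n w c : ℕ} (hw : w ≤ (n + 2) ^ c) :
    entryBound n w ≤ (n + 2) ^ (2 * c + 8) := by
  have hn : 2 * n + 1 ≤ (n + 2) ^ 2 := by nlinarith
  have hdist : n * n * w ^ 2 ≤ (n + 2) ^ (2 * c + 2) :=
    calc n * n * w ^ 2 ≤ (n + 2) * (n + 2) * ((n + 2) ^ c) ^ 2 := by gcongr <;> omega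
      _ = (n + 2) ^ (2 * c + 2) := by ring
  have hsteps : 2 * ((2 * n + 1) * (n * n * w ^ 2)) + 1 ≤ (n + 2) ^ (2 * c + 6) :=
    calc 2 * ((2 * n + 1) * (n * n * w ^ 2)) + 1
        ≤ 2 * ((n + 2) ^ 2 * (n + 2) ^ (2 * c + 2)) + (n + 2) ^ 2 * (n + 2) ^ (2 * c + 2) := by
          gcongr
          exact Nat.mul_pos (by positivity) (by positivity)
      _ ≤ 2 ^ 2 * (n + 2) ^ (2 * c + 4) := by
          rw [← pow_add, show 2 + (2 * c + 2) = 2 * c + 4 by ring]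
          omega
      _ ≤ (n + 2) ^ 2 * (n + 2) ^ (2 * c + 4) := by gcongr; omega
      _ = (n + 2) ^ (2 * c + 6) := by ring
  calc entryBound n w ≤ (n + 2) ^ 2 * (n + 2) ^ (2 * c + 6) := Nat.mul_le_mul hn hsteps
    _ = (n + 2) ^ (2 * c + 8) := by ring

theorem apspProg_memory {n w c : ℕ} (hw : w ≤ (n + 2) ^ c) :
    8 ≤ (n + 2) ^ (2 * c + 15) ∧ 2 * n + 1 ≤ (n + 2) ^ (2 * c + 15) ∧
      64 * (n + 1) * (n + 1) ≤ (n + 2) ^ (2 * c + 15) ∧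
      12 * (2 * (entryBound n w + 1) + 1) ≤ (n + 2) ^ (2 * c + 15) := by
  have hpos : 1 ≤ (n + 2) ^ (2 * c + 8) := Nat.one_le_pow _ _ (by omega)
  have hle : 2 ^ 7 * (n + 2) ^ (2 * c + 8) ≤ (n + 2) ^ (2 * c + 15) :=
    calc 2 ^ 7 * (n + 2) ^ (2 * c + 8) ≤ (n + 2) ^ 7 * (n + 2) ^ (2 * c + 8) := by gcongr; omega
      _ = (n + 2) ^ (2 * c + 15) := by ring
  have hsq : (n + 1) * (n + 1) ≤ (n + 2) ^ (2 * c + 8) :=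
    calc (n + 1) * (n + 1) ≤ (n + 2) ^ 2 := by nlinarith
      _ ≤ (n + 2) ^ (2 * c + 8) := Nat.pow_le_pow_right (by omega) (by omega)
  have := entryBound_le hw
  exact ⟨by omega, by nlinarith, by rw [mul_assoc]; omega, by omega⟩

theorem exists_oracleTime {T : ℕ → ℕ → ℕ} {C ε ε₀ : ℝ} {b : ℕ}
    (hC : ∀ m M, M ≤ (m + 2) ^ (3 * b) → (T m M : ℝ) ≤ C * ((m : ℝ) + 1) ^ (3 - ε₀))
    (hε : ε ≤ ε₀) :
    ∃ τ : ℕ → ℕ, (∀ σ, (τ σ : ℝ) ≤ |C| * (4 * (σ : ℝ) + 2) ^ (3 - ε)) ∧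
      ∀ n σ M, n ≤ σ ^ 3 → M ≤ (n + 2) ^ b → T (4 * σ + 1) M ≤ τ σ := by
  refine ⟨fun σ => ⌊|C| * (4 * (σ : ℝ) + 2) ^ (3 - ε)⌋₊, fun σ => Nat.floor_le (by positivity),
    fun n σ M hσ hM => Nat.le_floor ?_⟩
  have hbase : n + 2 ≤ (4 * σ + 1 + 2) ^ 3 := by
    nlinarith [Nat.zero_le (σ ^ 3), Nat.zero_le (σ ^ 2)]
  have hM' : M ≤ (4 * σ + 1 + 2) ^ (3 * b) :=
    calc M ≤ (n + 2) ^ b := hM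
      _ ≤ ((4 * σ + 1 + 2) ^ 3) ^ b := by gcongr
      _ = (4 * σ + 1 + 2) ^ (3 * b) := (pow_mul _ _ _).symm
  calc (T (4 * σ + 1) M : ℝ) ≤ C * (((4 * σ + 1 : ℕ) : ℝ) + 1) ^ (3 - ε₀) := hC _ M hM'
    _ = C * (4 * (σ : ℝ) + 2) ^ (3 - ε₀) := by push_cast; ring_nf
    _ ≤ |C| * (4 * (σ : ℝ) + 2) ^ (3 - ε) := by
        gcongr
        · exact le_abs_self C
        · linarith [σ.cast_nonneg (α := ℝ)]

theorem APSP_reducible_coDiameter : SubcubicReducible APSP CoDiameter := by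
  refine ⟨apspProg, fun c => ⟨(2 * c + 15) * 40, fun T hT => ?_⟩⟩
  obtain ⟨ε₀, hε₀, C, hC⟩ := hT (3 * (2 * c + 15))
  obtain ⟨ε, hε0, hε1, hε⟩ : ∃ ε, 0 < ε ∧ ε ≤ 1 ∧ ε ≤ ε₀ :=
    ⟨min ε₀ 1, by positivity, min_le_right _ _, min_le_left _ _⟩
  obtain ⟨τ, hτ, hT⟩ := exists_oracleTime hC hε
  obtain ⟨L, hL0, hL⟩ := exists_exponent_le (2 * c + 15) (by positivity : 0 < ε / 12)
  refine ⟨ε / 6, by positivity,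
    5000 + 24 * L + L * ((L + 1) * (2000000 + 192000 * |C|) + 8), ?_⟩
  rintro O hO ⟨G, hG⟩ hweight a ha
  obtain ⟨h8, hsteps, hcells, hentries⟩ := apspProg_memory hweight
  obtain ⟨s, t, hexec, -, -, houtput, σ, e, f, hσ, he, hf, ht⟩ :=
    apspProg_wp (T := T) h8 (pow_mul _ _ _).ge hO G hG
      (hT G.n) ha hcells hentries (State.start_bounded _ a)
  exact ⟨s, t, hexec, houtput, apsp_time_le hε0 hε1 (abs_nonneg C) hL0 hσ (hτ σ)
    (hL _ _ (he.trans hsteps)) (hL _ _ hf) ht⟩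

end FineGrained

theorem theorem1p1 :
    FineGrained.SubcubicEquivalent FineGrained.APSP FineGrained.CoDiameter :=
  ⟨FineGrained.APSP_reducible_coDiameter, FineGrained.coDiameter_reducible_APSP⟩
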